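/- **Setting.** Let $\Omega=\{1,2\}^{\mathbb Z}$ with its product $\sigma$-algebra and coordinatewise order, and let $\alpha\ge 0$. The flip $\theta_x$ exchanges the values $1$ and $2$ at $x$ and changes nothing else. The sandpile addition operator $a_x$ is defined as follows. If $\eta(x)=1$, then $a_x\eta$ is $\eta$ with the value at $x$ changed to $2$. If $\eta(x)=2$, let $x^+=x^+_\eta\in\mathbb Z\cup\{+\infty\}$ and $x^-=x^-_\eta\in\mathbb Z\cup\{-\infty\}$ be the first sites to the right and to the left of $x$ where $\eta$ equals $1$ ($\pm\infty$ if there is none). Then $a_x\eta(y)=\eta(y)$ for $y\notin[x^-,x^+]$ and $a_x\eta(y)=2$ for $y\in[x^-,x^+]$, except that, if $x^+$ and $x^-$ are both finite, $a_x\eta(x^++x^--x)=1$. Put $$Lf(\eta)=\alpha\sum_{x\in\mathbb Z}\bigl(f(a_x\eta)-f(\eta)\bigr)+\sum_{x\in\mathbb Z}\bigl(f(\theta_x\eta)-f(\eta)\bigr).$$ **The process.** Let $\Omega_f$ be the countable set of configurations with finitely many $2$'s. For $n\in\mathbb N$ let $S_n(t)$ be the semigroup of the (minimal) continuous-time Markov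 chain on $\Omega_f$ with the following jumps: from $\xi$, for each $x$ with $\xi(x)=2$, to $a_x\xi$ at rate $\alpha$ and to $\theta_x\xi$ at rate $1$; for each $x\in[-n,n]$ with $\xi(x)=1$, to $\theta_x\xi$ at rate $1+\alpha$. The law of the sand-flip process at time $t$ started from $\eta\in\Omega$ is the unique probability measure $P_\eta(\eta_t\in\cdot)$ on $\Omega$ with $$\int g(\zeta)\,P_\eta(\eta_t\in d\zeta)=\sup_{n\in\mathbb N}\ \sup_{\xi\in\Omega_f,\ \xi\le\eta}S_n(t)g(\xi)$$ for every coordinatewise nondecreasing $g:\Omega\to\mathbb R$ that depends on finitely many coordinates, and $S(t)f(\eta)=\int f(\zeta)\,P_\eta(\eta_t\in d\zeta)$. **Decent configurations and $N$-local functions.** Let $\Omega'$ be the set of $\eta\in\Omega$ with infinitely many $1$'s both to the right and to the left of the origin. For $\eta\in\Omega'$ let $(X_i(\eta))_{i\in\mathbb Z}$ be the increasing enumeration of $\{x:\eta(x)=1\}$ with $X_0(\eta)=\min\{x\ge0:\eta(x)=1\}$, and let $I_i(\eta)=(X_{i-1}(\eta),X_i(\eta)]$. A configuration $\eta\in\Omega'$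 is *decent* if $$a(\eta)=\limsup_{n\to\infty}\frac1{2n}\sum_{i=-n}^{n}|X_i(\eta)-X_{i-1}(\eta)|<\infty .$$ A function $f:\Omega\to\mathbb R$ is *$N$-local* if, for $\eta\in\Omega'$, $f(\eta)$ is a function of the restriction of $\eta$ to $\bigcup_{j=-N}^{N}I_j(\eta)$. **Proposition.** Let $f:\Omega\to\mathbb R$ be bounded and $N$-local for some $N\in\mathbb N$, and let $\eta$ be decent. Then for every $n\ge0$ the sums defining $L(L^nf)$ converge absolutely on $\Omega'$, and for all $0\le t<1/[4(1+\alpha)\,e\,a(\eta)]$ the series $\sum_{n=0}^\infty t^n(L^nf)(\eta)/n!$ converges absolutely, $f$ is integrable with respect to $P_\eta(\eta_t\in\cdot)$, and $$\sum_{n=0}^\infty\frac{t^n}{n!}(L^nf)(\eta)=S(t)f(\eta).$$ In particular $$\lim_{t\downarrow0}\frac{S(t)f(\eta)-f(\eta)}t=Lf(\eta),$$ i.e. $L$ is the pointwise generator of the process. -/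

import Mathlib

open MeasureTheory Filter Topology
open scoped ENNReal

namespace SandFlip

noncomputable section

/-- Configurations `η ∈ {1,2}^ℤ`. The two heights are encoded by `Bool`:
`false` is height one (inactive), `true` is height two (active), and `false ≤ true`.
The order, the product `σ`-algebra and so on are the ones of the product `ℤ → Bool`. -/
abbrev Config : Type := ℤ → Bool

/-! ### Spin flips and sandpile additions -/

/-- The flip `θ_x`: change the height at `x` and nothing else. -/
def flip (x : ℤ) (η : Config) : Config := Function.update η x (!(η x))

/-- The first site of height one strictly to the right of `x`
(meaningful when there is one). -/
def nextOne (η : Config) (x : ℤ) : ℤ := sInf {z : ℤ | x < z ∧ η z = false}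

/-- The first site of height one strictly to the left of `x`
(meaningful when there is one). -/
def prevOne (η : Config) (x : ℤ) : ℤ := sSup {z : ℤ | z < x ∧ η z = false}

open Classical in
/-- `x⁺_η`, with value `∞` if there is no site of height one to the right of `x`. -/
def rightEnd (η : Config) (x : ℤ) : WithTop ℤ :=
  if ∃ z : ℤ, x < z ∧ η z = false then ((nextOne η x : ℤ) : WithTop ℤ) else ⊤

open Classical in
/-- `x⁻_η`, with value `-∞` if there is no site of height one to the left of `x`. -/
def leftEnd (η : Config) (x : ℤ) : WithBot ℤ :=
  if ∃ z : ℤ, z < x ∧ η z = false then ((prevOne η x : ℤ) : WithBot ℤ) else ⊥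

open Classical in
/-- The infinite-volume addition operator `a_x`. If `x` is inactive it becomes active. If `x` is
active, all sites `y` with `x⁻ ≤ y ≤ x⁺` get height two, except that, when both `x⁻` and `x⁺` are
finite, the mirror site `x⁺ + x⁻ - x` gets height one; all other sites are unchanged. -/
def addOp (x : ℤ) (η : Config) : Config := fun y =>
  if η x = false then
    if y = x then true else η y
  else if ∃ l r : ℤ, leftEnd η x = (l : WithBot ℤ) ∧ rightEnd η x = (r : WithTop ℤ) ∧
      y = r + l - x then
    false
  else if leftEnd η x ≤ (y : WithBot ℤ) ∧ (y : WithTop ℤ) ≤ rightEnd η x then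
    true
  else η y

/-- The formal generator
`L f(η) = α ∑_x (f(a_x η) - f(η)) + ∑_x (f(θ_x η) - f(η))`. -/
def generator (α : ℝ) (f : Config → ℝ) : Config → ℝ := fun η =>
  α * (∑' x : ℤ, (f (addOp x η) - f η)) + ∑' x : ℤ, (f (flip x η) - f η)

/-! ### Decent configurations and `N`-local functions -/

/-- `Ω'`: infinitely many ones both to the right and to the left of the origin. -/
def bothSided : Set Config :=
  {η | {x : ℤ | 0 ≤ x ∧ η x = false}.Infinite ∧ {x : ℤ | x < 0 ∧ η x = false}.Infinite}

/-- The increasing enumeration `X_i(η)`, `i ∈ ℤ`, of the sites of height one of `η ∈ Ω'`,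
normalised by `X_0 = min {x ≥ 0 : η(x) = 1}` (the first one strictly to the right of `-1`), so
that `X_{-1} = max {x < 0 : η(x) = 1}`. -/
def onePos (η : Config) : ℤ → ℤ
  | Int.ofNat n => (nextOne η)^[n + 1] (-1)
  | Int.negSucc n => (prevOne η)^[n + 1] 0

/-- `⋃_{j=-N}^N I_j(η)` with `I_j = (X_{j-1}(η), X_j(η)]`. -/
def window (N : ℕ) (η : Config) : Set ℤ :=
  ⋃ j ∈ Set.Icc (-(N : ℤ)) (N : ℤ), Set.Ioc (onePos η (j - 1)) (onePos η j)

/-- `f` is `N`-local: on `Ω'` its value is a function of the restriction of `η` to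
`⋃_{j=-N}^N I_j(η)`. -/
def IsNLocal (N : ℕ) (f : Config → ℝ) : Prop :=
  ∀ η ∈ bothSided, ∀ ξ ∈ bothSided, window N η = window N ξ →
    (∀ x ∈ window N η, η x = ξ x) → f η = f ξ

/-- `a(η) = limsup_n (1/2n) ∑_{i=-n}^n |X_i(η) - X_{i-1}(η)|`, with values in `[0,∞]`. -/
def meanGap (η : Config) : ℝ≥0∞ :=
  limsup (fun n : ℕ =>
    (∑ i ∈ Finset.Icc (-(n : ℤ)) (n : ℤ),
      ENNReal.ofReal (|onePos η i - onePos η (i - 1)| : ℤ)) / (2 * (n : ℝ≥0∞))) atTop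

/-- Decent configurations. -/
def decent : Set Config := {η | η ∈ bothSided ∧ meanGap η < ∞}

/-! ### Minimal transition function of a countable Markov chain -/

open Classical in
/-- Iteration towards the minimal nonnegative solution of the backward integral equation
`p_t(i,j) = δ_{ij} e^{-q_i t} + ∫_0^t e^{-q_i s} ∑_l q(i,l) p_{t-s}(l,j) ds`, `q_i = ∑_l q(i,l)`.
The `k`-th iterate is the probability to go from `i` to `j` in time `t` with less than `k` jumps. -/
def transIter {E : Type} (q : E → E → ℝ≥0∞) : ℕ → ℝ → E → E → ℝ≥0∞
  | 0, _, _, _ => 0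
  | k + 1, t, i, j =>
      (if i = j then ENNReal.ofReal (Real.exp (-((∑' l, q i l).toReal * t))) else 0) +
      ∫⁻ s in Set.Ioc (0 : ℝ) t, ENNReal.ofReal (Real.exp (-((∑' l, q i l).toReal * s))) *
        ∑' l, q i l * transIter q k (t - s) l j

/-- The transition function of the (minimal) continuous-time Markov chain with jump rates `q`. -/
def trans {E : Type} (q : E → E → ℝ≥0∞) (t : ℝ) (i j : E) : ℝ≥0∞ := ⨆ k, transIter q k t i j

/-! ### The sand-flip process -/

/-- `Ω_f`: configurations with finitely many sites of height two. -/
abbrev FinConfig : Type := {ξ : Config // {x : ℤ | ξ x = true}.Finite}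

open Classical in
/-- Jump rates on `Ω_f` for avalanches (rate `α`) and deaths (rate one) at all active sites, and
births (rate `1 + α`) at the inactive sites of `[-n,n]`. -/
def rate (α : ℝ) (n : ℕ) (ξ ζ : FinConfig) : ℝ≥0∞ :=
  ∑' x : ℤ,
    if ξ.1 x = true then
      (if addOp x ξ.1 = ζ.1 then ENNReal.ofReal α else 0) + (if flip x ξ.1 = ζ.1 then 1 else 0)
    else if x ∈ Set.Icc (-(n : ℤ)) (n : ℤ) then
      (if flip x ξ.1 = ζ.1 then ENNReal.ofReal (1 + α) else 0)
    else 0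

/-- The semigroup `S_n(t)` of the chain on `Ω_f` with births in `[-n,n]`. -/
def finSemigroup (α : ℝ) (n : ℕ) (t : ℝ) (f : Config → ℝ) (ξ : FinConfig) : ℝ :=
  ∑' ζ : FinConfig, (trans (rate α n) t ξ ζ).toReal * f ζ.1

/-- Local functions: those that depend on finitely many coordinates. -/
def IsLocal (f : Config → ℝ) : Prop :=
  ∃ F : Finset ℤ, ∀ η ξ : Config, (∀ x ∈ F, η x = ξ x) → f η = f ξ

/-- `μ` is the law at time `t` of the sand-flip process started from `η`: for monotone local `f`,
`∫ f dμ = sup_n sup_{ξ ∈ Ω_f, ξ ≤ η} S_n(t) f(ξ)`. -/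
structure IsLaw (α t : ℝ) (η : Config) (μ : Measure Config) : Prop where
  prob : IsProbabilityMeasure μ
  isLUB : ∀ f : Config → ℝ, IsLocal f → Monotone f →
    IsLUB {r : ℝ | ∃ (n : ℕ) (ξ : FinConfig), ξ.1 ≤ η ∧ r = finSemigroup α n t f ξ}
      (∫ ζ, f ζ ∂μ)

/-- There is at most one such law. -/
theorem IsLaw.unique {α t : ℝ} {η : Config} {μ ν : Measure Config}
    (hμ : IsLaw α t η μ) (hν : IsLaw α t η ν) : μ = ν := by
  classical
  have := hμ.prob
  have := hν.prob
  let A : Finset ℤ → Set Config := fun F => {ζ | ∀ x ∈ F, ζ x = true}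
  have hA : ∀ F, MeasurableSet (A F) := by
    intro F
    have : A F = ⋂ x ∈ F, (fun ζ : Config => ζ x) ⁻¹' {true} := by
      ext ζ; simp [A]
    rw [this]
    exact Finset.measurableSet_biInter F
      (fun x _ => measurable_pi_apply x (measurableSet_singleton true))
  have hgen : (MeasurableSpace.pi : MeasurableSpace Config)
      = MeasurableSpace.generateFrom (Set.range A) := by
    apply le_antisymm
    · refine iSup_le fun x => ?_
      rw [← measurable_iff_comap_le]
      refine @measurable_to_bool Config (MeasurableSpace.generateFrom (Set.range A)) _ ?_
      refine MeasurableSpace.measurableSet_generateFrom ⟨{x}, ?_⟩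
      ext ζ; simp [A]
    · refine MeasurableSpace.generateFrom_le ?_
      rintro _ ⟨F, rfl⟩
      exact hA F
  refine ext_of_generate_finite (Set.range A) hgen ?_ ?_ (by simp)
  · rintro _ ⟨F, rfl⟩ _ ⟨G, rfl⟩ _
    refine ⟨F ∪ G, ?_⟩
    ext ζ
    simp only [A, Finset.mem_union, Set.mem_ofPred_eq, Set.mem_inter_iff]
    constructor
    · intro h
      exact ⟨fun x hx => h x (Or.inl hx), fun x hx => h x (Or.inr hx)⟩
    · rintro ⟨h1, h2⟩ x (hx | hx)
      exacts [h1 x hx, h2 x hx]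
  · rintro _ ⟨F, rfl⟩
    have hloc : IsLocal ((A F).indicator 1) := by
      refine ⟨F, fun ζ ξ h => ?_⟩
      have : ζ ∈ A F ↔ ξ ∈ A F := by
        constructor
        · intro h1 x hx; rw [← h x hx]; exact h1 x hx
        · intro h1 x hx; rw [h x hx]; exact h1 x hx
      by_cases h1 : ζ ∈ A F
      · simp [Set.indicator, h1, this.1 h1]
      · rw [Set.indicator_of_notMem h1, Set.indicator_of_notMem (fun h2 => h1 (this.2 h2))]
    have hmono : Monotone ((A F).indicator (1 : Config → ℝ)) := by
      intro ζ ξ h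
      by_cases h1 : ζ ∈ A F
      · have h2 : ξ ∈ A F := by
          intro x hx
          have h3 := h x
          rw [h1 x hx] at h3
          exact top_le_iff.1 h3
        simp [Set.indicator, h1, h2]
      · rw [Set.indicator_of_notMem h1]
        exact Set.indicator_nonneg (fun _ _ => zero_le_one) _
    have h := (hμ.isLUB _ hloc hmono).unique (hν.isLUB _ hloc hmono)
    rw [integral_indicator_one (hA F), integral_indicator_one (hA F)] at h
    exact (measureReal_eq_measureReal_iff).1 h

open Classical in
/-- The law at time `t` of the sand-flip process started from `η`
(with value `0` should no such law exist). -/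
def law (α t : ℝ) (η : Config) : Measure Config :=
  if h : ∃ μ, IsLaw α t η μ then h.choose else 0

/-- The semigroup `S(t) f(η) = E_η f(η_t)` of the sand-flip process. -/
def semigroup (α t : ℝ) (f : Config → ℝ) (η : Config) : ℝ := ∫ ζ, f ζ ∂(law α t η)

end

end SandFlip

/-! The proof rests on counting sites of height one ("ones"). On `Ω'`, an avalanche or a flip
removes, on balance, at most one of them from any interval (`ones_le_addOp`, `ones_le_flip`), and an
avalanche does not act across one (`addOp_apply_of_lt`). Hence, if `f` is determined by every box
with more than `N` ones on either side of the origin, then `L f` is determined by every box with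
more than `N + 1`, and `L^k f` by every box with more than `N + k` (`LocalN.boxGen`,
`LocalN.iterate`). At a decent `η` such a box has length about `2 a k`, each application of `L`
costs a factor `2 (1 + α)` times that length, and `k^k ≤ e^k k!`. So `|L^k f(η)| ≤ const * k! * (4
(1 + α) e a)^k` for every `a` above the mean gap (`abs_iterate_le`, `exists_span_pow_le`). Lowering
a configuration only adds ones, so the same bound holds for all configurations of `Ω'` below `η`,
and for births restricted to any set.

On finite configurations `S_n(t) f` and the exponential series of the restricted generator both
solve the backward equation and grow at most exponentially in the number of active sites. The jump
rates are unbounded, but an exponential Lyapunov function yields a maximum principle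
(`maximum_principle`), hence uniqueness, and the two coincide for small `t`
(`finSemigroup_eq_expSeries`). For `f = 1` this excludes explosion. The same principle on ordered
pairs gives monotonicity in the starting point and in the birth box (`finSemigroup_mono`), once
avalanches are indexed by the site that they leave inactive.

Now start the chain with births in `[-m, m]` from `η` cut off outside `[-m, m]`. Each coefficient of
its series is eventually `L^k f(η)`, and the common bound dominates, so the series converge
(`tendsto_finSemigroup_cut`). Compactness provides a limit law, and monotonicity identifies it with
the law of the process (`exists_isLaw`). This law charges only `Ω'` (`ae_mem_bothSided`), where an
`N`-local `f` is a limit of local functions. That gives the series formula for `f`, and its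
derivative at zero is `L f(η)`. -/

namespace SandFlip

noncomputable section

/-! ### Avalanches -/

/-- `l < x < r` are consecutive sites of height one around the active site `x`. -/
structure IsGap (η : Config) (x l r : ℤ) : Prop where
  left_lt : l < x
  lt_right : x < r
  left : η l = false
  right : η r = false
  active : ∀ z, l < z → z < r → η z = true

theorem IsGap.self {η : Config} {x l r : ℤ} (h : IsGap η x l r) : η x = true :=
  h.active x h.left_lt h.lt_right

theorem addOp_of_false {η : Config} {x : ℤ} (h : η x = false) :
    addOp x η = Function.update η x true := by
  funext y
  simp [addOp, h, Function.update_apply]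

theorem addOp_eq_flip {η : Config} {x : ℤ} (h : η x = false) : addOp x η = flip x η := by
  rw [addOp_of_false h, flip, h]; rfl

theorem IsGap.rightEnd {η : Config} {x l r : ℤ} (h : IsGap η x l r) :
    rightEnd η x = (r : WithTop ℤ) := by
  have h1 : IsLeast {z : ℤ | x < z ∧ η z = false} r := by
    refine ⟨⟨h.lt_right, h.right⟩, fun z hz => ?_⟩
    by_contra hlt
    have := h.active z (h.left_lt.trans hz.1) (not_le.1 hlt)
    rw [hz.2] at this
    exact absurd this (by simp)
  rw [SandFlip.rightEnd, if_pos ⟨r, h.lt_right, h.right⟩, nextOne, h1.csInf_eq]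

theorem IsGap.leftEnd {η : Config} {x l r : ℤ} (h : IsGap η x l r) :
    leftEnd η x = (l : WithBot ℤ) := by
  have h1 : IsGreatest {z : ℤ | z < x ∧ η z = false} l := by
    refine ⟨⟨h.left_lt, h.left⟩, fun z hz => ?_⟩
    by_contra hlt
    have := h.active z (not_le.1 hlt) (hz.1.trans h.lt_right)
    rw [hz.2] at this
    exact absurd this (by simp)
  rw [SandFlip.leftEnd, if_pos ⟨l, h.left_lt, h.left⟩, prevOne, h1.csSup_eq]

theorem IsGap.addOp_apply {η : Config} {x l r : ℤ} (h : IsGap η x l r) (y : ℤ) :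
    addOp x η y = if y = r + l - x then false else if y = l ∨ y = r then true else η y := by
  have hx := h.self
  have h1 := h.left_lt
  have h2 := h.lt_right
  rw [addOp, h.leftEnd, h.rightEnd, hx]
  simp only [Bool.true_eq_false, if_false, WithBot.coe_inj, WithTop.coe_inj, WithBot.coe_le_coe,
    WithTop.coe_le_coe]
  by_cases hy : y = r + l - x
  · rw [if_pos ⟨l, r, rfl, rfl, hy⟩, if_pos hy]
  · rw [if_neg (fun ⟨l', r', e1, e2, e3⟩ => hy (by
      rw [WithBot.coe_inj] at e1; rw [WithTop.coe_inj] at e2; omega)), if_neg hy]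
    by_cases hy2 : y = l ∨ y = r
    · rw [if_pos hy2, if_pos]; omega
    · rw [if_neg hy2]
      split_ifs with h3
      · exact (h.active y (by omega) (by omega)).symm
      · rfl

theorem exists_isGap {η : Config} (hη : η ∈ bothSided) {x : ℤ} (hx : η x = true) :
    ∃ l r, IsGap η x l r := by
  have hR : ∃ z, x < z ∧ η z = false := by
    by_contra hcon
    push Not at hcon
    refine hη.1 ((Set.finite_Icc 0 x).subset fun z hz => ?_)
    refine ⟨hz.1, not_lt.1 fun h => ?_⟩
    exact hcon z h hz.2
  have hL : ∃ z, z < x ∧ η z = false := by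
    by_contra hcon
    push Not at hcon
    refine hη.2 ((Set.finite_Icc x 0).subset fun z hz => ?_)
    refine ⟨not_lt.1 fun h => ?_, hz.1.le⟩
    exact hcon z h hz.2
  obtain ⟨r, ⟨hr1, hr2⟩, hr3⟩ := Int.exists_least_of_bdd (P := fun z => x < z ∧ η z = false)
    ⟨x, fun z hz => hz.1.le⟩ hR
  obtain ⟨l, ⟨hl1, hl2⟩, hl3⟩ := Int.exists_greatest_of_bdd (P := fun z => z < x ∧ η z = false)
    ⟨x, fun z hz => hz.1.le⟩ hL
  refine ⟨l, r, hl1, hr1, hl2, hr2, fun z h1 h2 => ?_⟩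
  by_contra h3
  have h3 : η z = false := by simpa using h3
  rcases lt_trichotomy z x with h | h | h
  · have := hl3 z ⟨h, h3⟩; omega
  · subst h; rw [hx] at h3; exact absurd h3 (by simp)
  · have := hr3 z ⟨h, h3⟩; omega

theorem IsGap.le_left {η : Config} {x l r y : ℤ} (h : IsGap η x l r) (hy : η y = false)
    (hyx : y ≤ x) : y ≤ l := by
  by_contra hlt
  have := h.active y (by omega) (by have := h.lt_right; omega)
  rw [hy] at this
  exact absurd this (by simp)

theorem IsGap.right_le {η : Config} {x l r y : ℤ} (h : IsGap η x l r) (hy : η y = false)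
    (hyx : x ≤ y) : r ≤ y := by
  by_contra hlt
  have := h.active y (by have := h.left_lt; omega) (by omega)
  rw [hy] at this
  exact absurd this (by simp)

/-- An avalanche or addition at `x` does not cross a site of height one. -/
theorem addOp_apply_of_lt {η : Config} (hη : η ∈ bothSided) {x y z : ℤ} (hyx : y < x)
    (hy : η y = false) (hz : z < y) : addOp x η z = η z := by
  cases hx : η x
  · rw [addOp_of_false hx, Function.update_of_ne (by omega)]
  · obtain ⟨l, r, h⟩ := exists_isGap hη hx
    have h1 := h.le_left hy hyx.le
    have h2 := h.left_lt
    have h3 := h.lt_right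
    rw [h.addOp_apply, if_neg (by omega), if_neg (by omega)]

theorem addOp_apply_of_gt {η : Config} (hη : η ∈ bothSided) {x y z : ℤ} (hyx : x < y)
    (hy : η y = false) (hz : y < z) : addOp x η z = η z := by
  cases hx : η x
  · rw [addOp_of_false hx, Function.update_of_ne (by omega)]
  · obtain ⟨l, r, h⟩ := exists_isGap hη hx
    have h1 := h.right_le hy hyx.le
    have h2 := h.left_lt
    have h3 := h.lt_right
    rw [h.addOp_apply, if_neg (by omega), if_neg (by omega)]

/-- Both ends of the box have height one, so the gap around an active site of the box lies in the
box, and the box alone decides the avalanche. -/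
theorem addOp_congr {η ξ : Config} (hη : η ∈ bothSided) {a b x : ℤ}
    (ha : η a = false) (hb : η b = false) (hx : x ∈ Set.Icc a b)
    (hag : ∀ z ∈ Set.Icc a b, η z = ξ z) : ∀ z ∈ Set.Icc a b, addOp x η z = addOp x ξ z := by
  intro z hz
  cases hx1 : η x
  · have hx2 : ξ x = false := by rw [← hag x hx, hx1]
    rw [addOp_of_false hx1, addOp_of_false hx2, Function.update_apply, Function.update_apply,
      hag z hz]
  · obtain ⟨l, r, h⟩ := exists_isGap hη hx1
    have h1 := h.le_left ha hx.1
    have h2 := h.right_le hb hx.2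
    have h3 := h.left_lt
    have h4 := h.lt_right
    have h' : IsGap ξ x l r := by
      refine ⟨h3, h4, ?_, ?_, fun z hz1 hz2 => ?_⟩
      · rw [← hag l ⟨h1, by omega⟩, h.left]
      · rw [← hag r ⟨by omega, h2⟩, h.right]
      · rw [← hag z ⟨by omega, by omega⟩, h.active z hz1 hz2]
    rw [h.addOp_apply, h'.addOp_apply, hag z hz]

theorem flip_apply (x : ℤ) (η : Config) (y : ℤ) : flip x η y = if y = x then !(η x) else η y := by
  rw [flip, Function.update_apply]

/-! ### Moves preserve `Ω'` -/

theorem bothSided_of_finite_ne {η ξ : Config} (hη : η ∈ bothSided)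
    (h : {y | ξ y ≠ η y}.Finite) : ξ ∈ bothSided := by
  refine ⟨(hη.1.sdiff h).mono ?_, (hη.2.sdiff h).mono ?_⟩ <;>
  · rintro y ⟨⟨h1, h2⟩, h3⟩
    refine ⟨h1, ?_⟩
    have h3 : ξ y = η y := by simpa using h3
    rw [h3, h2]

theorem addOp_finite_ne {η : Config} (hη : η ∈ bothSided) (x : ℤ) :
    {y | addOp x η y ≠ η y}.Finite := by
  cases hx : η x
  · refine (Set.finite_singleton x).subset fun y hy => ?_
    by_contra hne
    exact hy (by rw [addOp_of_false hx, Function.update_of_ne hne])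
  · obtain ⟨l, r, h⟩ := exists_isGap hη hx
    refine (Set.finite_Icc l r).subset fun y hy => ?_
    by_contra hne
    rw [Set.mem_Icc] at hne
    have h3 := h.left_lt
    have h4 := h.lt_right
    exact hy (by rw [h.addOp_apply, if_neg (by omega), if_neg (by omega)])

theorem flip_finite_ne (η : Config) (x : ℤ) : {y | flip x η y ≠ η y}.Finite := by
  refine (Set.finite_singleton x).subset fun y hy => ?_
  by_contra hne
  exact hy (by rw [flip, Function.update_of_ne hne])

theorem addOp_mem_bothSided {η : Config} (hη : η ∈ bothSided) (x : ℤ) : addOp x η ∈ bothSided :=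
  bothSided_of_finite_ne hη (addOp_finite_ne hη x)

theorem flip_mem_bothSided {η : Config} (hη : η ∈ bothSided) (x : ℤ) : flip x η ∈ bothSided :=
  bothSided_of_finite_ne hη (flip_finite_ne η x)

/-! ### Counting sites of height one -/

/-- The number of sites of height one of `η` in `[a, b]`. -/
def ones (a b : ℤ) (η : Config) : ℕ := ((Finset.Icc a b).filter (fun y => η y = false)).card

theorem ones_congr {a b : ℤ} {η ξ : Config} (h : ∀ z ∈ Set.Icc a b, η z = ξ z) :
    ones a b η = ones a b ξ := by
  unfold ones
  congr 1
  refine Finset.filter_congr fun z hz => ?_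
  rw [h z (by simpa using hz)]

theorem ones_mono {a b a' b' : ℤ} {η ξ : Config} (ha : a' ≤ a) (hb : b ≤ b') (h : ξ ≤ η) :
    ones a b η ≤ ones a' b' ξ := by
  refine Finset.card_le_card fun z hz => ?_
  simp only [Finset.mem_filter, Finset.mem_Icc] at hz ⊢
  refine ⟨⟨by omega, by omega⟩, ?_⟩
  have := h z
  rw [hz.2] at this
  exact le_bot_iff.1 this

/-- In an avalanche the two ends of the gap become active and the mirror site becomes inactive. If
both ends lie in `[a, b]`, so does the mirror site, which compensates for one of them; otherwise at
most one end is lost. -/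
theorem ones_le_addOp {η : Config} (hη : η ∈ bothSided) (x a b : ℤ) :
    ones a b η ≤ ones a b (addOp x η) + 1 := by
  unfold ones
  cases hx : η x
  · rw [addOp_of_false hx]
    refine (Finset.card_le_card (t := insert x _) fun z hz => ?_).trans (Finset.card_insert_le x _)
    simp only [Finset.mem_insert, Finset.mem_filter, Function.update_apply] at hz ⊢
    by_cases hzx : z = x
    · exact Or.inl hzx
    · rw [if_neg hzx]; exact Or.inr hz
  · obtain ⟨l, r, h⟩ := exists_isGap hη hx
    have h3 := h.left_lt
    have h4 := h.lt_right
    have key : ∀ z, z ∈ Finset.Icc a b → η z = false → z ≠ l → z ≠ r →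
        addOp x η z = false ∧ z ≠ r + l - x := by
      intro z _ hz h1 h2
      have h5 : z ≠ r + l - x := by
        rintro rfl
        rw [h.active _ (by omega) (by omega)] at hz
        exact absurd hz (by simp)
      refine ⟨?_, h5⟩
      rw [h.addOp_apply, if_neg h5, if_neg (by tauto), hz]
    by_cases hl : l ∈ Finset.Icc a b
    · by_cases hr : r ∈ Finset.Icc a b
      · have hm : r + l - x ∈ (Finset.Icc a b).filter (fun y => addOp x η y = false) := by
          simp only [Finset.mem_filter, Finset.mem_Icc] at *
          exact ⟨⟨by omega, by omega⟩, by rw [h.addOp_apply, if_pos rfl]⟩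
        have hsub : (Finset.Icc a b).filter (fun y => η y = false) ⊆ insert l (insert r
            (((Finset.Icc a b).filter (fun y => addOp x η y = false)).erase (r + l - x))) := by
          intro z hz
          rw [Finset.mem_filter] at hz
          simp only [Finset.mem_insert, Finset.mem_erase, Finset.mem_filter]
          by_cases h1 : z = l
          · exact Or.inl h1
          by_cases h2 : z = r
          · exact Or.inr (Or.inl h2)
          have := key z hz.1 hz.2 h1 h2
          exact Or.inr (Or.inr ⟨this.2, hz.1, this.1⟩)
        have h5 := Finset.card_le_card hsub
        have h6 := Finset.card_insert_le l (insert r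
            (((Finset.Icc a b).filter (fun y => addOp x η y = false)).erase (r + l - x)))
        have h7 := Finset.card_insert_le r
            (((Finset.Icc a b).filter (fun y => addOp x η y = false)).erase (r + l - x))
        have h8 := Finset.card_erase_add_one hm
        omega
      · refine (Finset.card_le_card (t := insert l _) fun z hz => ?_).trans
          (Finset.card_insert_le l _)
        rw [Finset.mem_filter] at hz
        simp only [Finset.mem_insert, Finset.mem_filter]
        by_cases h1 : z = l
        · exact Or.inl h1
        exact Or.inr ⟨hz.1, (key z hz.1 hz.2 h1 (by rintro rfl; exact hr hz.1)).1⟩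
    · refine (Finset.card_le_card (t := insert r _) fun z hz => ?_).trans
        (Finset.card_insert_le r _)
      rw [Finset.mem_filter] at hz
      simp only [Finset.mem_insert, Finset.mem_filter]
      by_cases h1 : z = r
      · exact Or.inl h1
      exact Or.inr ⟨hz.1, (key z hz.1 hz.2 (by rintro rfl; exact hl hz.1) h1).1⟩

theorem ones_le_flip (η : Config) (x a b : ℤ) : ones a b η ≤ ones a b (flip x η) + 1 := by
  unfold ones
  refine (Finset.card_le_card (t := insert x _) fun z hz => ?_).trans (Finset.card_insert_le x _)
  simp only [Finset.mem_insert, Finset.mem_filter, flip_apply] at hz ⊢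
  by_cases hzx : z = x
  · exact Or.inl hzx
  · rw [if_neg hzx]; exact Or.inr hz

theorem exists_last_one {a b : ℤ} {η : Config} (h : 0 < ones a b η) :
    ∃ y ∈ Set.Icc a b, η y = false ∧ ones a y η = ones a b η ∧
      ones a (y - 1) η + 1 = ones a b η := by
  have hne := Finset.card_pos.1 h
  have hm := Finset.max'_mem _ hne
  set y := Finset.max' _ hne with hy
  have hmax : ∀ z, z ∈ (Finset.Icc a b).filter (fun y => η y = false) → z ≤ y :=
    fun z hz => Finset.le_max' _ z hz
  clear_value y
  simp only [Finset.mem_filter, Finset.mem_Icc] at hm hmax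
  refine ⟨y, hm.1, hm.2, ?_, ?_⟩
  · unfold ones
    congr 1
    ext z
    simp only [Finset.mem_filter, Finset.mem_Icc]
    refine ⟨fun hz => ⟨⟨hz.1.1, by omega⟩, hz.2⟩, fun hz => ⟨⟨hz.1.1, hmax z hz⟩, hz.2⟩⟩
  · unfold ones
    rw [← Finset.card_insert_of_notMem (a := y) (by simp)]
    congr 1
    ext z
    simp only [Finset.mem_insert, Finset.mem_filter, Finset.mem_Icc]
    constructor
    · rintro (rfl | hz)
      · exact hm
      · exact ⟨⟨hz.1.1, by omega⟩, hz.2⟩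
    · intro hz
      have := hmax z hz
      by_cases hzy : z = y
      · exact Or.inl hzy
      · exact Or.inr ⟨⟨hz.1.1, by omega⟩, hz.2⟩

theorem exists_first_one {a b : ℤ} {η : Config} (h : 0 < ones a b η) :
    ∃ y ∈ Set.Icc a b, η y = false ∧ ones y b η = ones a b η ∧
      ones (y + 1) b η + 1 = ones a b η := by
  have hne := Finset.card_pos.1 h
  have hm := Finset.min'_mem _ hne
  set y := Finset.min' _ hne with hy
  have hmin : ∀ z, z ∈ (Finset.Icc a b).filter (fun y => η y = false) → y ≤ z :=
    fun z hz => Finset.min'_le _ z hz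
  clear_value y
  simp only [Finset.mem_filter, Finset.mem_Icc] at hm hmin
  refine ⟨y, hm.1, hm.2, ?_, ?_⟩
  · unfold ones
    congr 1
    ext z
    simp only [Finset.mem_filter, Finset.mem_Icc]
    refine ⟨fun hz => ⟨⟨by omega, hz.1.2⟩, hz.2⟩, fun hz => ⟨⟨hmin z hz, hz.1.2⟩, hz.2⟩⟩
  · unfold ones
    rw [← Finset.card_insert_of_notMem (a := y) (by simp)]
    congr 1
    ext z
    simp only [Finset.mem_insert, Finset.mem_filter, Finset.mem_Icc]
    constructor
    · rintro (rfl | hz)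
      · exact hm
      · exact ⟨⟨by omega, hz.1.2⟩, hz.2⟩
    · intro hz
      have := hmin z hz
      by_cases hzy : z = y
      · exact Or.inl hzy
      · exact Or.inr ⟨⟨by omega, hz.1.2⟩, hz.2⟩

/-- `[a, b]` contains more than `N` sites of height one on either side of the origin. -/
def Enough (N : ℕ) (a b : ℤ) (η : Config) : Prop := N < ones 0 b η ∧ N < ones a (-1) η

theorem Enough.mono {N : ℕ} {a b a' b' : ℤ} {η ξ : Config} (h : Enough N a b η) (ha : a' ≤ a)
    (hb : b ≤ b') (hle : ξ ≤ η) : Enough N a' b' ξ :=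
  ⟨h.1.trans_le (ones_mono le_rfl hb hle), h.2.trans_le (ones_mono ha le_rfl hle)⟩

theorem Enough.weaken {N N' : ℕ} {a b : ℤ} {η : Config} (h : Enough N a b η) (hN : N' ≤ N) :
    Enough N' a b η := ⟨hN.trans_lt h.1, hN.trans_lt h.2⟩

theorem ones_le (a b : ℤ) (η : Config) : ones a b η ≤ (b + 1 - a).toNat := by
  rw [← Int.card_Icc]; exact Finset.card_filter_le _ _

theorem Enough.le {N : ℕ} {a b : ℤ} {η : Config} (h : Enough N a b η) :
    a ≤ -(N : ℤ) - 1 ∧ (N : ℤ) ≤ b := by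
  have h1 := h.1.trans_le (ones_le _ _ _)
  have h2 := h.2.trans_le (ones_le _ _ _)
  omega

theorem Enough.congr {N : ℕ} {a b : ℤ} {η ξ : Config} (h : Enough N a b η)
    (hag : ∀ z ∈ Set.Icc a b, η z = ξ z) : Enough N a b ξ := by
  have := h.le
  unfold Enough
  rw [← ones_congr (η := η) (ξ := ξ), ← ones_congr (η := η) (ξ := ξ)]
  · exact h
  · exact fun z hz => hag z ⟨hz.1, by have := hz.2; omega⟩
  · exact fun z hz => hag z ⟨by have := hz.1; omega, hz.2⟩

theorem Enough.addOp {N : ℕ} {a b : ℤ} {η : Config} (hη : η ∈ bothSided)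
    (h : Enough (N + 1) a b η) (x : ℤ) : Enough N a b (addOp x η) := by
  have h1 := ones_le_addOp hη x 0 b
  have h2 := ones_le_addOp hη x a (-1)
  have h3 := h.1
  have h4 := h.2
  exact ⟨by omega, by omega⟩

theorem Enough.flip {N : ℕ} {a b : ℤ} {η : Config}
    (h : Enough (N + 1) a b η) (x : ℤ) : Enough N a b (flip x η) := by
  have h1 := ones_le_flip η x 0 b
  have h2 := ones_le_flip η x a (-1)
  have h3 := h.1
  have h4 := h.2
  exact ⟨by omega, by omega⟩

/-- The box is cut down to its outermost ones, across which no avalanche acts. A move from outside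
may still change the nearer end, but nothing beyond it; the last clause therefore gives up one end,
at the price of a single one. -/
theorem Enough.shrink {N : ℕ} {a b : ℤ} {η : Config} (h : Enough N a b η) :
    ∃ a' b', a ≤ a' ∧ b' ≤ b ∧ η a' = false ∧ η b' = false ∧ a' < 0 ∧ 0 ≤ b' ∧ Enough N a' b' η ∧
      (∀ M, N = M + 1 → Enough M (a' + 1) b' η ∧ Enough M a' (b' - 1) η) := by
  obtain ⟨b', hb1, hb2, hb3, hb4⟩ := exists_last_one (h.1.trans_le' (Nat.zero_le _))
  obtain ⟨a', ha1, ha2, ha3, ha4⟩ := exists_first_one (h.2.trans_le' (Nat.zero_le _))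
  have h1 := h.1
  have h2 := h.2
  refine ⟨a', b', ha1.1, hb1.2, ha2, hb2, by have := ha1.2; omega, hb1.1,
    ⟨by omega, by omega⟩, fun M hM => ⟨⟨by omega, by omega⟩, ⟨by omega, by omega⟩⟩⟩

theorem exists_card_le_filter {s : Set ℤ} (hs : s.Infinite) (n : ℕ) :
    ∃ K : ℕ, ∃ F : Finset ℤ, n < F.card ∧ (∀ z ∈ F, z ∈ s ∧ -(K : ℤ) ≤ z ∧ z ≤ K) := by
  obtain ⟨F, hF, hc⟩ := hs.exists_subset_card_eq (n + 1)
  refine ⟨F.sup Int.natAbs, F, by omega, fun z hz => ⟨hF hz, ?_⟩⟩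
  have := Finset.le_sup (f := Int.natAbs) hz
  omega

theorem exists_enough {η : Config} (hη : η ∈ bothSided) (N : ℕ) :
    ∃ K : ℕ, Enough N (-(K : ℤ)) K η := by
  obtain ⟨K, F, h1, h2⟩ := exists_card_le_filter hη.1 N
  obtain ⟨K', F', h1', h2'⟩ := exists_card_le_filter hη.2 N
  refine ⟨max K K', h1.trans_le (Finset.card_le_card fun z hz => ?_),
    h1'.trans_le (Finset.card_le_card fun z hz => ?_)⟩
  · obtain ⟨h3, h4, h5⟩ := h2 z hz
    simp only [Finset.mem_filter, Finset.mem_Icc]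
    exact ⟨⟨h3.1, by push_cast; omega⟩, h3.2⟩
  · obtain ⟨h3, h4, h5⟩ := h2' z hz
    simp only [Finset.mem_filter, Finset.mem_Icc]
    have := h3.1
    exact ⟨⟨by push_cast; omega, by omega⟩, h3.2⟩

theorem mem_bothSided_of_enough {η : Config} (h : ∀ N, ∃ a b, Enough N a b η) :
    η ∈ bothSided := by
  constructor
  · intro hfin
    obtain ⟨a, b, h1, h2⟩ := h hfin.toFinset.card
    refine absurd h1 (not_lt.2 (Finset.card_le_card fun z hz => ?_))
    simp only [Finset.mem_filter, Finset.mem_Icc, Set.Finite.mem_toFinset] at hz ⊢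
    exact ⟨hz.1.1, hz.2⟩
  · intro hfin
    obtain ⟨a, b, h1, h2⟩ := h hfin.toFinset.card
    refine absurd h2 (not_lt.2 (Finset.card_le_card fun z hz => ?_))
    simp only [Finset.mem_filter, Finset.mem_Icc, Set.Finite.mem_toFinset] at hz ⊢
    exact ⟨by omega, hz.2⟩

/-! ### Local functions and the generator with restricted births -/

/-- The value of `f` on `Ω'` is determined by the configuration on any box with more than `N`
sites of height one on either side of the origin. -/
def LocalN (N : ℕ) (f : Config → ℝ) : Prop :=
  ∀ η ∈ bothSided, ∀ ξ ∈ bothSided, ∀ a b, Enough N a b η → (∀ z ∈ Set.Icc a b, η z = ξ z) →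
    f η = f ξ

open Classical in
/-- The indicator that the site `x` may change when births happen in `B` only. -/
def siteWeight (B : Set ℤ) (η : Config) (x : ℤ) : ℝ :=
  if η x = true ∨ x ∈ B then 1 else 0

/-- The generator with births in `B` only. -/
def boxGen (α : ℝ) (B : Set ℤ) (f : Config → ℝ) : Config → ℝ := fun η =>
  α * (∑' x : ℤ, siteWeight B η x * (f (addOp x η) - f η)) +
    ∑' x : ℤ, siteWeight B η x * (f (flip x η) - f η)

theorem boxGen_univ (α : ℝ) : boxGen α Set.univ = generator α := by
  funext f η
  simp [boxGen, generator, siteWeight]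

open Classical in
theorem siteWeight_congr {B B' : Set ℤ} {η ξ : Config} {x : ℤ} (h : η x = ξ x)
    (hB : x ∈ B ↔ x ∈ B') : siteWeight B η x = siteWeight B' ξ x :=
  if_congr (by rw [h, hB]) rfl rfl

theorem siteWeight_nonneg (B : Set ℤ) (η : Config) (x : ℤ) : 0 ≤ siteWeight B η x := by
  unfold siteWeight; split_ifs <;> simp

theorem siteWeight_le_one (B : Set ℤ) (η : Config) (x : ℤ) : siteWeight B η x ≤ 1 := by
  unfold siteWeight; split_ifs <;> simp

theorem LocalN.apply_eq_of_notMem {N : ℕ} {f : Config → ℝ} (hf : LocalN N f) {η : Config}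
    (hη : η ∈ bothSided) {a b : ℤ} (ha : η a = false) (hb : η b = false)
    (h1 : Enough N (a + 1) b η) (h2 : Enough N a (b - 1) η)
    {x : ℤ} (hx : x ∉ Set.Icc a b) : f (addOp x η) = f η ∧ f (flip x η) = f η := by
  rw [Set.mem_Icc, not_and_or, not_le, not_le] at hx
  have hA := addOp_mem_bothSided hη x
  have hF := flip_mem_bothSided hη x
  rcases hx with hx | hx
  · refine ⟨(hf η hη _ hA _ _ h1 fun z hz => ?_).symm, (hf η hη _ hF _ _ h1 fun z hz => ?_).symm⟩
    · rw [addOp_apply_of_gt hη hx ha (by have := hz.1; omega)]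
    · rw [flip_apply, if_neg (by have := hz.1; omega)]
  · refine ⟨(hf η hη _ hA _ _ h2 fun z hz => ?_).symm, (hf η hη _ hF _ _ h2 fun z hz => ?_).symm⟩
    · rw [addOp_apply_of_lt hη hx hb (by have := hz.2; omega)]
    · rw [flip_apply, if_neg (by have := hz.2; omega)]

theorem boxGen_eq_sum_of_eq {α : ℝ} {B : Set ℤ} {f : Config → ℝ} {η : Config} {F : Finset ℤ}
    (h : ∀ x ∉ F, f (addOp x η) = f η ∧ f (flip x η) = f η) :
    boxGen α B f η = ∑ x ∈ F, siteWeight B η x *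
      (α * (f (addOp x η) - f η) + (f (flip x η) - f η)) := by
  rw [boxGen, tsum_eq_sum (s := F), tsum_eq_sum (s := F), Finset.mul_sum, ← Finset.sum_add_distrib]
  · exact Finset.sum_congr rfl fun x _ => by ring
  · intro x hx; rw [(h x hx).2, sub_self, mul_zero]
  · intro x hx; rw [(h x hx).1, sub_self, mul_zero]

theorem LocalN.apply_eq_of_notMem_box {N : ℕ} {f : Config → ℝ} (hf : LocalN N f) {η : Config}
    (hη : η ∈ bothSided) {a b : ℤ} (h : Enough (N + 1) a b η) {x : ℤ}
    (hx : x ∉ Finset.Icc a b) : f (addOp x η) = f η ∧ f (flip x η) = f η := by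
  obtain ⟨a', b', h1, h2, h3, h4, _, _, _, h6⟩ := h.shrink
  refine hf.apply_eq_of_notMem hη h3 h4 (h6 N rfl).1 (h6 N rfl).2 fun h7 => hx ?_
  rw [Finset.mem_Icc]
  exact ⟨h1.trans h7.1, h7.2.trans h2⟩

theorem LocalN.boxGen_eq_sum {N : ℕ} {f : Config → ℝ} (hf : LocalN N f) (α : ℝ) (B : Set ℤ)
    {η : Config} (hη : η ∈ bothSided) {a b : ℤ} (h : Enough (N + 1) a b η) :
    boxGen α B f η = ∑ x ∈ Finset.Icc a b, siteWeight B η x *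
      (α * (f (addOp x η) - f η) + (f (flip x η) - f η)) :=
  boxGen_eq_sum_of_eq fun _ hx => hf.apply_eq_of_notMem_box hη h hx

/-- The extra one on each side pays for the one that a move may destroy. In a box with inactive
ends, moves at inner sites depend on the box only, and moves at outer sites leave `f` unchanged, so
the generator is a finite sum that the box determines. -/
theorem LocalN.boxGen {N : ℕ} {f : Config → ℝ} (hf : LocalN N f) (α : ℝ) (B : Set ℤ) :
    LocalN (N + 1) (boxGen α B f) := by
  intro η hη ξ hξ a b hE hag
  obtain ⟨a', b', h1, h2, h3, h4, _, _, h5, _⟩ := hE.shrink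
  have hag' : ∀ z ∈ Set.Icc a' b', η z = ξ z := fun z hz => hag z ⟨h1.trans hz.1, hz.2.trans h2⟩
  rw [hf.boxGen_eq_sum α B hη h5, hf.boxGen_eq_sum α B hξ (h5.congr hag')]
  refine Finset.sum_congr rfl fun x hx => ?_
  rw [Finset.mem_Icc] at hx
  rw [siteWeight_congr (hag' x hx) Iff.rfl,
    hf η hη ξ hξ a' b' (h5.weaken (Nat.le_succ N)) hag',
    hf (addOp x η) (addOp_mem_bothSided hη x) (addOp x ξ) (addOp_mem_bothSided hξ x) a' b'
      (h5.addOp hη x) (addOp_congr hη h3 h4 hx hag'),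
    hf (flip x η) (flip_mem_bothSided hη x) (flip x ξ) (flip_mem_bothSided hξ x) a' b'
      (h5.flip x) (fun z hz => by rw [flip_apply, flip_apply, hag' z hz, hag' x hx])]

theorem LocalN.iterate {N : ℕ} {f : Config → ℝ} (hf : LocalN N f) (α : ℝ) (B : Set ℤ) (k : ℕ) :
    LocalN (N + k) ((SandFlip.boxGen α B)^[k] f) := by
  induction k with
  | zero => exact hf
  | succ k ih => rw [Function.iterate_succ_apply']; exact ih.boxGen α B

/-- Comparison of the iterates of two generators inside a box. -/
theorem iterate_eq_on_box (α : ℝ) {B B' : Set ℤ} {a b : ℤ}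
    (hB : ∀ x ∈ Set.Icc a b, (x ∈ B ↔ x ∈ B')) (k : ℕ) :
    ∀ {N : ℕ} {f g : Config → ℝ}, LocalN N f → LocalN N g →
    (∀ ζ ∈ bothSided, Enough N a b ζ → f ζ = g ζ) →
    ∀ ζ ∈ bothSided, Enough (N + k) a b ζ → (boxGen α B)^[k] f ζ = (boxGen α B')^[k] g ζ := by
  induction k with
  | zero => exact fun _ _ h => h
  | succ k ih =>
    intro N f g hf hg h ζ hζ hE
    -- The innermost application is peeled off: the induction hypothesis is used for `boxGen α B f`
    -- and `boxGen α B' g`, with `N + 1` in place of `N` and the same box.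
    rw [Function.iterate_succ_apply, Function.iterate_succ_apply]
    refine ih (hf.boxGen α B) (hg.boxGen α B') (fun ξ hξ hEξ => ?_) ζ hζ
      (by rwa [Nat.add_assoc, Nat.add_comm 1])
    rw [hf.boxGen_eq_sum α B hξ hEξ, hg.boxGen_eq_sum α B' hξ hEξ]
    refine Finset.sum_congr rfl fun x hx => ?_
    rw [Finset.mem_Icc] at hx
    rw [siteWeight_congr rfl (hB x hx), h ξ hξ (hEξ.weaken (Nat.le_succ N)),
      h _ (addOp_mem_bothSided hξ x) (hEξ.addOp hξ x), h _ (flip_mem_bothSided hξ x) (hEξ.flip x)]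

/-- One box serves all `k` applications, because each move uses up at most one of the `N + k` ones
in reserve. An application sums over the `b + 1 - a` sites of the box terms of size at most `2 (1 +
α)` times the previous bound. -/
theorem abs_iterate_le {α : ℝ} (hα : 0 ≤ α) (B : Set ℤ) {a b : ℤ} (k : ℕ) :
    ∀ {N : ℕ} {f : Config → ℝ} {C : ℝ}, LocalN N f →
    (∀ ζ ∈ bothSided, Enough N a b ζ → |f ζ| ≤ C) →
    ∀ ζ ∈ bothSided, Enough (N + k) a b ζ →
      |(boxGen α B)^[k] f ζ| ≤ C * (2 * (1 + α) * (b + 1 - a)) ^ k := by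
  induction k with
  | zero => intro N f C _ h ζ hζ hE; simpa using h ζ hζ hE
  | succ k ih =>
    intro N f C hf h ζ hζ hE
    rw [Function.iterate_succ_apply]
    refine (ih (C := C * (2 * (1 + α) * (b + 1 - a))) (hf.boxGen α B) (fun ξ hξ hEξ => ?_) ζ hζ
      (by rwa [Nat.add_assoc, Nat.add_comm 1])).trans_eq (by ring)
    rw [hf.boxGen_eq_sum α B hξ hEξ]
    have hle := hEξ.le
    have hcard : ((Finset.Icc a b).card : ℝ) = b + 1 - a := by
      rw [Int.card_Icc, ← Int.cast_natCast, Int.toNat_of_nonneg (by omega)]; push_cast; ring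
    refine (Finset.abs_sum_le_sum_abs _ _).trans ?_
    refine (Finset.sum_le_card_nsmul _ _ (2 * (1 + α) * C) fun x hx => ?_).trans_eq ?_
    · have h1 := h ξ hξ (hEξ.weaken (Nat.le_succ N))
      have h2 := h _ (addOp_mem_bothSided hξ x) (hEξ.addOp hξ x)
      have h3 := h _ (flip_mem_bothSided hξ x) (hEξ.flip x)
      have h4 : |f (SandFlip.addOp x ξ) - f ξ| ≤ 2 * C := (abs_sub _ _).trans (by linarith)
      have h5 : |f (SandFlip.flip x ξ) - f ξ| ≤ 2 * C := (abs_sub _ _).trans (by linarith)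
      rw [abs_mul, abs_of_nonneg (siteWeight_nonneg _ _ _)]
      refine (mul_le_of_le_one_left (abs_nonneg _) (siteWeight_le_one _ _ _)).trans ?_
      refine (abs_add_le _ _).trans ?_
      rw [abs_mul, abs_of_nonneg hα]
      nlinarith [mul_le_mul_of_nonneg_left h4 hα]
    · rw [nsmul_eq_mul, hcard]; ring

theorem LocalN.summable {N : ℕ} {f : Config → ℝ} (hf : LocalN N f) {η : Config}
    (hη : η ∈ bothSided) : Summable (fun x => f (SandFlip.addOp x η) - f η) ∧
      Summable (fun x => f (SandFlip.flip x η) - f η) := by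
  obtain ⟨K, hK⟩ := exists_enough hη (N + 1)
  constructor
  · refine summable_of_ne_finset_zero (s := Finset.Icc (-(K : ℤ)) K) fun x hx => ?_
    rw [(hf.apply_eq_of_notMem_box hη hK hx).1, sub_self]
  · refine summable_of_ne_finset_zero (s := Finset.Icc (-(K : ℤ)) K) fun x hx => ?_
    rw [(hf.apply_eq_of_notMem_box hη hK hx).2, sub_self]

/-! ### The enumeration of the sites of height one -/

theorem nextOne_eq {η : Config} {x y : ℤ} (hxy : x < y) (hy : η y = false)
    (h : ∀ z, x < z → z < y → η z = true) : nextOne η x = y := by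
  refine IsLeast.csInf_eq ⟨⟨hxy, hy⟩, fun z hz => ?_⟩
  by_contra hlt
  have := h z hz.1 (not_le.1 hlt)
  rw [hz.2] at this
  exact absurd this (by simp)

theorem prevOne_eq {η : Config} {x y : ℤ} (hxy : y < x) (hy : η y = false)
    (h : ∀ z, y < z → z < x → η z = true) : prevOne η x = y := by
  refine IsGreatest.csSup_eq ⟨⟨hxy, hy⟩, fun z hz => ?_⟩
  by_contra hlt
  have := h z (not_le.1 hlt) hz.1
  rw [hz.2] at this
  exact absurd this (by simp)

theorem nextOne_spec {η : Config} (hη : η ∈ bothSided) (x : ℤ) :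
    x < nextOne η x ∧ η (nextOne η x) = false ∧ ∀ z, x < z → z < nextOne η x → η z = true := by
  have hR : ∃ z, x < z ∧ η z = false := by
    by_contra hcon
    push Not at hcon
    refine hη.1 ((Set.finite_Icc 0 x).subset fun z hz => ?_)
    exact ⟨hz.1, not_lt.1 fun h => hcon z h hz.2⟩
  obtain ⟨r, ⟨hr1, hr2⟩, hr3⟩ := Int.exists_least_of_bdd (P := fun z => x < z ∧ η z = false)
    ⟨x, fun z hz => hz.1.le⟩ hR
  have h : ∀ z, x < z → z < r → η z = true := by
    intro z h1 h2
    by_contra h3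
    exact absurd (hr3 z ⟨h1, by simpa using h3⟩) (not_le.2 h2)
  rw [nextOne_eq hr1 hr2 h]
  exact ⟨hr1, hr2, h⟩

theorem prevOne_spec {η : Config} (hη : η ∈ bothSided) (x : ℤ) :
    prevOne η x < x ∧ η (prevOne η x) = false ∧ ∀ z, prevOne η x < z → z < x → η z = true := by
  have hL : ∃ z, z < x ∧ η z = false := by
    by_contra hcon
    push Not at hcon
    refine hη.2 ((Set.finite_Icc x 0).subset fun z hz => ?_)
    exact ⟨not_lt.1 fun h => hcon z h hz.2, hz.1.le⟩
  obtain ⟨l, ⟨hl1, hl2⟩, hl3⟩ := Int.exists_greatest_of_bdd (P := fun z => z < x ∧ η z = false)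
    ⟨x, fun z hz => hz.1.le⟩ hL
  have h : ∀ z, l < z → z < x → η z = true := by
    intro z h1 h2
    by_contra h3
    exact absurd (hl3 z ⟨h2, by simpa using h3⟩) (not_le.2 h1)
  rw [prevOne_eq hl1 hl2 h]
  exact ⟨hl1, hl2, h⟩

theorem ones_eq_of_active_right {η : Config} {a b c : ℤ} (hbc : b ≤ c)
    (h : ∀ z, b < z → z ≤ c → η z = true) : ones a c η = ones a b η := by
  unfold ones
  congr 1
  ext z
  simp only [Finset.mem_filter, Finset.mem_Icc]
  refine ⟨fun hz => ⟨⟨hz.1.1, ?_⟩, hz.2⟩, fun hz => ⟨⟨hz.1.1, hz.1.2.trans hbc⟩, hz.2⟩⟩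
  by_contra h1
  have := h z (not_le.1 h1) hz.1.2
  rw [hz.2] at this
  exact absurd this (by simp)

theorem ones_eq_of_active_left {η : Config} {a b c : ℤ} (hab : a ≤ b)
    (h : ∀ z, a ≤ z → z < b → η z = true) : ones a c η = ones b c η := by
  unfold ones
  congr 1
  ext z
  simp only [Finset.mem_filter, Finset.mem_Icc]
  refine ⟨fun hz => ⟨⟨?_, hz.1.2⟩, hz.2⟩, fun hz => ⟨⟨hab.trans hz.1.1, hz.1.2⟩, hz.2⟩⟩
  by_contra h1
  have := h z hz.1.1 (not_le.1 h1)
  rw [hz.2] at this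
  exact absurd this (by simp)

theorem ones_right_succ {η : Config} {a b : ℤ} (hab : a ≤ b) (hb : η b = false) :
    ones a b η = ones a (b - 1) η + 1 := by
  unfold ones
  rw [← Finset.card_insert_of_notMem (a := b) (by simp)]
  congr 1
  ext z
  simp only [Finset.mem_insert, Finset.mem_filter, Finset.mem_Icc]
  constructor
  · intro hz
    by_cases hzb : z = b
    · exact Or.inl hzb
    · exact Or.inr ⟨⟨hz.1.1, by omega⟩, hz.2⟩
  · rintro (rfl | hz)
    · exact ⟨⟨hab, le_rfl⟩, hb⟩
    · exact ⟨⟨hz.1.1, by omega⟩, hz.2⟩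

theorem ones_left_succ {η : Config} {a b : ℤ} (hab : a ≤ b) (ha : η a = false) :
    ones a b η = ones (a + 1) b η + 1 := by
  unfold ones
  rw [← Finset.card_insert_of_notMem (a := a) (by simp)]
  congr 1
  ext z
  simp only [Finset.mem_insert, Finset.mem_filter, Finset.mem_Icc]
  constructor
  · intro hz
    by_cases hzb : z = a
    · exact Or.inl hzb
    · exact Or.inr ⟨⟨by omega, hz.1.2⟩, hz.2⟩
  · rintro (rfl | hz)
    · exact ⟨⟨le_rfl, hab⟩, ha⟩
    · exact ⟨⟨by omega, hz.1.2⟩, hz.2⟩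

theorem onePos_natCast_succ (η : Config) (n : ℕ) :
    onePos η ((n : ℤ) + 1) = nextOne η (onePos η n) := by
  change (nextOne η)^[n + 1 + 1] (-1) = nextOne η ((nextOne η)^[n + 1] (-1))
  rw [Function.iterate_succ_apply']

theorem onePos_negSucc_succ (η : Config) (n : ℕ) :
    onePos η (-(n : ℤ) - 1 - 1) = prevOne η (onePos η (-(n : ℤ) - 1)) := by
  have h1 : -(n : ℤ) - 1 - 1 = Int.negSucc (n + 1) := by omega
  have h2 : -(n : ℤ) - 1 = Int.negSucc n := by omega
  rw [h1, h2]
  change (prevOne η)^[n + 1 + 1] 0 = prevOne η ((prevOne η)^[n + 1] 0)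
  rw [Function.iterate_succ_apply']

theorem onePos_zero (η : Config) : onePos η 0 = nextOne η (-1) := rfl

theorem onePos_neg_one (η : Config) : onePos η (-1) = prevOne η 0 := rfl

theorem onePos_nat_spec {η : Config} (hη : η ∈ bothSided) (n : ℕ) :
    0 ≤ onePos η n ∧ η (onePos η n) = false ∧ ones 0 (onePos η n) η = n + 1 := by
  induction n with
  | zero =>
    obtain ⟨h1, h2, h3⟩ := nextOne_spec hη (-1)
    rw [Nat.cast_zero, onePos_zero]
    refine ⟨by omega, h2, ?_⟩
    rw [ones_right_succ (by omega) h2, ones_eq_of_active_right (b := -1) (by omega)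
      fun z hz1 hz2 => h3 z hz1 (by omega)]
    simp [ones]
  | succ n ih =>
    obtain ⟨h1, h2, h3⟩ := nextOne_spec hη (onePos η n)
    rw [Nat.cast_succ, onePos_natCast_succ]
    refine ⟨by omega, h2, ?_⟩
    rw [ones_right_succ (by omega) h2, ones_eq_of_active_right (b := onePos η n) (by omega)
      fun z hz1 hz2 => h3 z hz1 (by omega), ih.2.2]

theorem onePos_neg_spec {η : Config} (hη : η ∈ bothSided) (n : ℕ) :
    onePos η (-(n : ℤ) - 1) < 0 ∧ η (onePos η (-(n : ℤ) - 1)) = false ∧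
      ones (onePos η (-(n : ℤ) - 1)) (-1) η = n + 1 := by
  induction n with
  | zero =>
    obtain ⟨h1, h2, h3⟩ := prevOne_spec hη 0
    simp only [Nat.cast_zero, neg_zero, zero_sub, onePos_neg_one]
    refine ⟨by omega, h2, ?_⟩
    rw [ones_left_succ (by omega) h2, ones_eq_of_active_left (b := 0) (by omega)
      fun z hz1 hz2 => h3 z (by omega) hz2]
    simp [ones]
  | succ n ih =>
    obtain ⟨h1, h2, h3⟩ := prevOne_spec hη (onePos η (-(n : ℤ) - 1))
    have he : -((n + 1 : ℕ) : ℤ) - 1 = -(n : ℤ) - 1 - 1 := by push_cast; ring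
    rw [he, onePos_negSucc_succ]
    refine ⟨by omega, h2, ?_⟩
    rw [ones_left_succ (by omega) h2, ones_eq_of_active_left (b := onePos η (-(n : ℤ) - 1))
      (by omega) fun z hz1 hz2 => h3 z (by omega) hz2, ih.2.2]

theorem enough_onePos {η : Config} (hη : η ∈ bothSided) (k : ℕ) :
    Enough k (onePos η (-(k : ℤ) - 1)) (onePos η k) η := by
  have h1 := (onePos_nat_spec hη k).2.2
  have h2 := (onePos_neg_spec hη k).2.2
  exact ⟨by omega, by omega⟩

theorem onePos_sub_one_lt {η : Config} (hη : η ∈ bothSided) (i : ℤ) :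
    onePos η (i - 1) < onePos η i := by
  rcases lt_trichotomy i 0 with h | h | h
  · obtain ⟨n, rfl⟩ : ∃ n : ℕ, i = -(n : ℤ) - 1 := ⟨(-i - 1).toNat, by omega⟩
    rw [onePos_negSucc_succ]
    exact (prevOne_spec hη _).1
  · subst h
    have h1 := (onePos_nat_spec hη 0).1
    have h2 := (onePos_neg_spec hη 0).1
    simp only [Nat.cast_zero, neg_zero] at h1 h2
    omega
  · obtain ⟨n, rfl⟩ : ∃ n : ℕ, i = (n : ℤ) + 1 := ⟨(i - 1).toNat, by omega⟩
    rw [onePos_natCast_succ, add_sub_cancel_right]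
    exact (nextOne_spec hη _).1

/-- If `X_n` were beyond `b`, the interval `[0, b]` would hold at most `n` ones. So the recursion
that leads to `X_n` reads only sites of `[0, b]`. -/
theorem onePos_nat_congr {η ξ : Config} (hη : η ∈ bothSided) {b : ℤ}
    (hag : ∀ z ∈ Set.Icc 0 b, η z = ξ z) (n : ℕ) (h : n < ones 0 b η) :
    onePos η n ≤ b ∧ onePos ξ n = onePos η n := by
  have hle : onePos η n ≤ b := by
    by_contra hlt
    obtain ⟨h1, h2, h3⟩ := onePos_nat_spec hη n
    rw [ones_right_succ h1 h2] at h3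
    have := ones_mono (a := 0) (a' := 0) (b := b) (b' := onePos η n - 1) le_rfl (by omega)
      (le_refl η)
    omega
  refine ⟨hle, ?_⟩
  induction n with
  | zero =>
    obtain ⟨h1, h2, h3⟩ := nextOne_spec hη (-1)
    simp only [Nat.cast_zero, onePos_zero] at hle ⊢
    refine nextOne_eq h1 ?_ fun z hz1 hz2 => ?_
    · rw [← hag _ ⟨by omega, hle⟩, h2]
    · rw [← hag z ⟨by omega, by omega⟩, h3 z hz1 hz2]
  | succ n ih =>
    obtain ⟨h1, h2, h3⟩ := nextOne_spec hη (onePos η n)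
    have h4 := (onePos_nat_spec hη n).1
    rw [Nat.cast_succ, onePos_natCast_succ] at hle
    rw [Nat.cast_succ, onePos_natCast_succ, onePos_natCast_succ, ih (by omega) (by omega)]
    refine nextOne_eq h1 ?_ fun z hz1 hz2 => ?_
    · rw [← hag _ ⟨by omega, hle⟩, h2]
    · rw [← hag z ⟨by omega, by omega⟩, h3 z hz1 hz2]

theorem onePos_neg_congr {η ξ : Config} (hη : η ∈ bothSided) {a : ℤ}
    (hag : ∀ z ∈ Set.Icc a (-1), η z = ξ z) (n : ℕ) (h : n < ones a (-1) η) :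
    a ≤ onePos η (-(n : ℤ) - 1) ∧ onePos ξ (-(n : ℤ) - 1) = onePos η (-(n : ℤ) - 1) := by
  have hle : a ≤ onePos η (-(n : ℤ) - 1) := by
    by_contra hlt
    obtain ⟨h1, h2, h3⟩ := onePos_neg_spec hη n
    rw [ones_left_succ (by omega) h2] at h3
    have := ones_mono (a' := onePos η (-(n : ℤ) - 1) + 1) (a := a) (b := -1) (b' := -1)
      (by omega) le_rfl (le_refl η)
    omega
  refine ⟨hle, ?_⟩
  induction n with
  | zero =>
    obtain ⟨h1, h2, h3⟩ := prevOne_spec hη 0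
    simp only [Nat.cast_zero, neg_zero, zero_sub, onePos_neg_one] at hle ⊢
    refine prevOne_eq h1 ?_ fun z hz1 hz2 => ?_
    · rw [← hag _ ⟨hle, by omega⟩, h2]
    · rw [← hag z ⟨by omega, by omega⟩, h3 z hz1 hz2]
  | succ n ih =>
    obtain ⟨h1, h2, h3⟩ := prevOne_spec hη (onePos η (-(n : ℤ) - 1))
    have h4 := (onePos_neg_spec hη n).1
    have he : -((n + 1 : ℕ) : ℤ) - 1 = -(n : ℤ) - 1 - 1 := by push_cast; ring
    rw [he, onePos_negSucc_succ] at hle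
    rw [he, onePos_negSucc_succ, onePos_negSucc_succ, ih (by omega) (by omega)]
    refine prevOne_eq h1 ?_ fun z hz1 hz2 => ?_
    · rw [← hag _ ⟨hle, by omega⟩, h2]
    · rw [← hag z ⟨by omega, by omega⟩, h3 z hz1 hz2]

/-- A box with more than `N` ones on either side contains `X_{-N-1}, ..., X_N` and determines them,
hence it contains and determines the window. Fixed boxes, unlike windows, can be compared across
moves. -/
theorem IsNLocal.localN {N : ℕ} {f : Config → ℝ} (hf : IsNLocal N f) : LocalN N f := by
  intro η hη ξ hξ a b hE hag
  have hle := hE.le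
  have key : ∀ i : ℤ, -(N : ℤ) - 1 ≤ i → i ≤ N →
      a ≤ onePos η i ∧ onePos η i ≤ b ∧ onePos ξ i = onePos η i := by
    intro i h1 h2
    rcases lt_or_ge i 0 with h | h
    · obtain ⟨n, rfl⟩ : ∃ n : ℕ, i = -(n : ℤ) - 1 := ⟨(-i - 1).toNat, by omega⟩
      have h3 := onePos_neg_congr hη (ξ := ξ) (a := a)
        (fun z hz => hag z ⟨hz.1, by have := hz.2; omega⟩) n (by have := hE.2; omega)
      have h4 := (onePos_neg_spec hη n).1
      exact ⟨h3.1, by omega, h3.2⟩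
    · obtain ⟨n, rfl⟩ : ∃ n : ℕ, i = (n : ℤ) := ⟨i.toNat, by omega⟩
      have h3 := onePos_nat_congr hη (ξ := ξ) (b := b)
        (fun z hz => hag z ⟨by have := hz.1; omega, hz.2⟩) n (by have := hE.1; omega)
      have h4 := (onePos_nat_spec hη n).1
      exact ⟨by omega, h3.1, h3.2⟩
  refine hf η hη ξ hξ ?_ fun x hx => ?_
  · unfold window
    refine Set.iUnion₂_congr fun j hj => ?_
    rw [Set.mem_Icc] at hj
    rw [(key j (by omega) hj.2).2.2, (key (j - 1) (by omega) (by omega)).2.2]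
  · simp only [window, Set.mem_iUnion] at hx
    obtain ⟨j, hj, hx⟩ := hx
    rw [Set.mem_Icc] at hj
    have h1 := (key j (by omega) hj.2).2.1
    have h2 := (key (j - 1) (by omega) (by omega)).1
    exact hag x ⟨by have := hx.1; omega, by have := hx.2; omega⟩

/-! ### The mean gap -/

/-- The length of the window of `2 k + 1` gaps around the origin. -/
def span (η : Config) (k : ℕ) : ℤ := onePos η k - onePos η (-(k : ℤ) - 1)

/-- The sum telescopes to `X_n - X_{-n-1}`. -/
theorem sum_gap {η : Config} (hη : η ∈ bothSided) (n : ℕ) :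
    ∑ i ∈ Finset.Icc (-(n : ℤ)) (n : ℤ),
      ENNReal.ofReal (|onePos η i - onePos η (i - 1)| : ℤ) = ENNReal.ofReal (span η n) := by
  have habs : ∀ i, (|onePos η i - onePos η (i - 1)| : ℤ) = onePos η i - onePos η (i - 1) :=
    fun i => abs_of_nonneg (by have := onePos_sub_one_lt hη i; omega)
  have hpos : ∀ i, (0 : ℝ) ≤ ((onePos η i - onePos η (i - 1) : ℤ) : ℝ) := fun i => by
    have := onePos_sub_one_lt hη i
    exact_mod_cast (by omega : (0 : ℤ) ≤ onePos η i - onePos η (i - 1))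
  simp_rw [habs]
  rw [← ENNReal.ofReal_sum_of_nonneg fun i _ => hpos i]
  congr 1
  rw [← Int.cast_sum]
  congr 1
  induction n with
  | zero => simp [span]
  | succ n ih =>
    have : Finset.Icc (-((n + 1 : ℕ) : ℤ)) ((n + 1 : ℕ) : ℤ) =
        insert ((n : ℤ) + 1) (insert (-(n : ℤ) - 1) (Finset.Icc (-(n : ℤ)) n)) := by
      ext z
      simp only [Finset.mem_Icc, Finset.mem_insert]
      push_cast
      omega
    rw [this, Finset.sum_insert, Finset.sum_insert, ih]
    · simp only [span]
      push_cast
      rw [show -((n : ℤ) + 1) - 1 = -(n : ℤ) - 1 - 1 by ring,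
        show (n : ℤ) + 1 - 1 = n by ring]
      ring
    · simp
    · simp; omega

theorem meanGap_eq {η : Config} (hη : η ∈ bothSided) :
    meanGap η = limsup (fun n : ℕ => ENNReal.ofReal (span η n) / (2 * (n : ℝ≥0∞))) atTop := by
  simp only [meanGap, sum_gap hη]

/-- Gaps have length at least one. Consequently the time horizon at `η` is no longer than the
horizon `1 / (4 (1 + α) e)` that is available on finite configurations. -/
theorem one_le_meanGap {η : Config} (hη : η ∈ bothSided) : 1 ≤ meanGap η := by
  rw [meanGap_eq hη]
  refine le_limsup_of_frequently_le (Eventually.frequently ?_)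
  filter_upwards [eventually_ge_atTop 1] with n hn
  have h := (enough_onePos hη n).le
  have h0 : (2 * (n : ℝ≥0∞)) ≠ 0 := by simp; omega
  have h1 : (2 * (n : ℝ≥0∞)) ≠ ∞ := ENNReal.mul_ne_top (by simp) (by simp)
  rw [ENNReal.le_div_iff_mul_le (Or.inl h0) (Or.inl h1), one_mul]
  have h2 : (2 * (n : ℝ≥0∞)) = ENNReal.ofReal ((2 * n : ℤ) : ℝ) := by
    push_cast
    rw [ENNReal.ofReal_mul (by norm_num)]
    simp
  rw [h2]
  refine ENNReal.ofReal_le_ofReal ?_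
  exact_mod_cast (by unfold span; omega : (2 * n : ℤ) ≤ span η n)

theorem eventually_span_le {η : Config} (hη : η ∈ decent) {a : ℝ} (ha : (meanGap η).toReal < a) :
    ∀ᶠ k : ℕ in atTop, (span η k : ℝ) + 1 ≤ 2 * a * k := by
  -- The intermediate `b` leaves a slack `2 (a - b) k`, which absorbs the `+ 1` for large `k`.
  obtain ⟨b, hb1, hb2⟩ := exists_between ha
  have hb0 : 0 ≤ b := ENNReal.toReal_nonneg.trans hb1.le
  have hlt : meanGap η < ENNReal.ofReal b := (ENNReal.lt_ofReal_iff_toReal_lt hη.2.ne).2 hb1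
  rw [meanGap_eq hη.1] at hlt
  have hbig : ∀ᶠ k : ℕ in atTop, 1 / (2 * (a - b)) ≤ (k : ℝ) :=
    tendsto_natCast_atTop_atTop.eventually_ge_atTop _
  filter_upwards [eventually_lt_of_limsup_lt hlt, eventually_ge_atTop 1, hbig] with k hk hk1 hk2
  have h0 : (2 * (k : ℝ≥0∞)) ≠ 0 := by simp; omega
  have h1 : (2 * (k : ℝ≥0∞)) ≠ ∞ := ENNReal.mul_ne_top (by simp) (by simp)
  rw [ENNReal.div_lt_iff (Or.inl h0) (Or.inl h1)] at hk
  have h2 : (2 * (k : ℝ≥0∞)) = ENNReal.ofReal (2 * (k : ℝ)) := by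
    rw [ENNReal.ofReal_mul (by norm_num)]; simp
  rw [h2, ← ENNReal.ofReal_mul hb0] at hk
  have h3 := (ENNReal.ofReal_lt_ofReal_iff_of_nonneg (by
    have h := (enough_onePos hη.1 k).le
    exact_mod_cast (by unfold span; omega : (0 : ℤ) ≤ span η k))).1 hk
  rw [div_le_iff₀ (by linarith)] at hk2
  nlinarith

/-! ### Minimal chains with finitely many jumps from each state -/

section Chain

variable {E : Type} {q : E → E → ℝ≥0∞}

theorem tsum_iSup_of_monotone {f : ℕ → E → ℝ≥0∞} (hf : ∀ j, Monotone fun k => f k j) :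
    ∑' j, ⨆ k, f k j = ⨆ k, ∑' j, f k j := by
  simp_rw [ENNReal.tsum_eq_iSup_sum]
  rw [iSup_comm]
  refine iSup_congr fun s => ?_
  exact ENNReal.finsetSum_iSup_of_monotone hf

theorem transIter_mono (t : ℝ) (i j : E) : Monotone fun k => transIter q k t i j := by
  refine monotone_nat_of_le_succ fun k => ?_
  induction k generalizing t i with
  | zero => exact zero_le
  | succ k ih =>
    rw [transIter, transIter]
    gcongr with s l
    exact ih _ _

theorem measurable_transIter [Countable E] (k : ℕ) (i j : E) :
    Measurable fun t => transIter q k t i j := by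
  induction k generalizing i with
  | zero => exact measurable_const
  | succ k ih =>
    simp only [transIter]
    refine Measurable.add ?_ ?_
    · split_ifs
      · fun_prop
      · exact measurable_const
    · have hset : MeasurableSet {p : ℝ × ℝ | 0 < p.2 ∧ p.2 ≤ p.1} :=
        (measurableSet_lt measurable_const measurable_snd).inter
          (measurableSet_le measurable_snd measurable_fst)
      have hfun : Measurable fun p : ℝ × ℝ =>
          ENNReal.ofReal (Real.exp (-((∑' l, q i l).toReal * p.2))) *
            ∑' l, q i l * transIter q k (p.1 - p.2) l j := by
        refine Measurable.mul (by fun_prop) (Measurable.tsum fun l => ?_)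
        exact ((ih l).comp (measurable_fst.sub measurable_snd)).const_mul _
      have := (hfun.indicator hset).lintegral_prod_right' (ν := volume)
      convert this using 2 with t
      rw [← lintegral_indicator measurableSet_Ioc]
      rfl

theorem measurable_trans [Countable E] (i j : E) : Measurable fun t => trans q t i j :=
  Measurable.iSup fun k => measurable_transIter k i j

theorem tsum_transIter_succ [Countable E] (g : E → ℝ≥0∞) (k : ℕ) (t : ℝ) (i : E) :
    ∑' j, transIter q (k + 1) t i j * g j =
      ENNReal.ofReal (Real.exp (-((∑' l, q i l).toReal * t))) * g i +
      ∫⁻ s in Set.Ioc (0 : ℝ) t, ENNReal.ofReal (Real.exp (-((∑' l, q i l).toReal * s))) *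
        ∑' l, q i l * ∑' j, transIter q k (t - s) l j * g j := by
  simp only [transIter, add_mul]
  have hm : ∀ j, Measurable fun s => ∑' l, q i l * transIter q k (t - s) l j := fun j =>
    Measurable.tsum fun l =>
      ((measurable_transIter k l j).comp (measurable_const.sub measurable_id)).const_mul _
  have hm' : ∀ j, Measurable fun s =>
      ENNReal.ofReal (Real.exp (-((∑' l, q i l).toReal * s))) *
        ∑' l, q i l * transIter q k (t - s) l j := fun j =>
    Measurable.mul (by fun_prop) (hm j)
  rw [ENNReal.tsum_add, tsum_eq_single i fun j hj => by simp [hj.symm], if_pos rfl]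
  congr 1
  simp_rw [← lintegral_mul_const _ (hm' _)]
  rw [← lintegral_tsum fun j => ((hm' j).mul_const _).aemeasurable]
  refine lintegral_congr fun s => ?_
  simp_rw [mul_assoc, ENNReal.tsum_mul_left, ← ENNReal.tsum_mul_right]
  congr 1
  rw [ENNReal.tsum_comm]
  simp_rw [mul_assoc, ENNReal.tsum_mul_left]

theorem tsum_trans [Countable E] (g : E → ℝ≥0∞) (t : ℝ) (i : E) :
    ∑' j, trans q t i j * g j = ⨆ k, ∑' j, transIter q k t i j * g j := by
  simp_rw [trans, ENNReal.iSup_mul]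
  exact tsum_iSup_of_monotone fun j k k' h => mul_le_mul_left (transIter_mono t i j h) _

/-- The backward equation. -/
theorem tsum_trans_eq [Countable E] (g : E → ℝ≥0∞) (t : ℝ) (i : E) :
    ∑' j, trans q t i j * g j =
      ENNReal.ofReal (Real.exp (-((∑' l, q i l).toReal * t))) * g i +
      ∫⁻ s in Set.Ioc (0 : ℝ) t, ENNReal.ofReal (Real.exp (-((∑' l, q i l).toReal * s))) *
        ∑' l, q i l * ∑' j, trans q (t - s) l j * g j := by
  have hmono : ∀ s l, Monotone fun k => ∑' j, transIter q k s l j * g j := fun s l k k' h =>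
    ENNReal.tsum_le_tsum fun j => mul_le_mul_left (transIter_mono s l j h) _
  -- Dropping the zeroth iterate puts all others in the form `k + 1`, to which the recursion
  -- applies; monotone convergence does the rest.
  rw [tsum_trans, ← (hmono t i).iSup_nat_add 1]
  simp_rw [tsum_transIter_succ]
  rw [← ENNReal.add_iSup, ← lintegral_iSup]
  · congr 1
    refine lintegral_congr fun s => ?_
    simp_rw [← ENNReal.mul_iSup, tsum_trans, ENNReal.mul_iSup (a := q i _)]
    congr 1
    exact (tsum_iSup_of_monotone (f := fun k l => q i l * ∑' j, transIter q k (t - s) l j * g j)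
      fun l k k' h => mul_le_mul_right (hmono _ l h) _).symm
  · intro k
    refine Measurable.mul (by fun_prop) (Measurable.tsum fun l => Measurable.const_mul ?_ _)
    exact Measurable.tsum fun j =>
      ((measurable_transIter k l j).comp (measurable_const.sub measurable_id)).mul_const _
  · intro k k' h s
    dsimp only
    gcongr with l j
    exact transIter_mono _ _ _ h

/-- The probability of a first jump, at rate `Λ`, by time `t`. Together with the probability of no
jump it makes one, which keeps the bound `C` in the induction of `tsum_trans_le`. -/
theorem lintegral_exp_neg {Λ t : ℝ} (ht : 0 ≤ t) (hΛ : 0 ≤ Λ) :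
    ∫⁻ s in Set.Ioc (0 : ℝ) t, ENNReal.ofReal (Real.exp (-(Λ * s))) * ENNReal.ofReal Λ =
      ENNReal.ofReal (1 - Real.exp (-(Λ * t))) := by
  simp_rw [← ENNReal.ofReal_mul (Real.exp_nonneg _)]
  have hder : ∀ s ∈ Set.uIcc 0 t, HasDerivAt (fun s => -Real.exp (-(Λ * s)))
      (Real.exp (-(Λ * s)) * Λ) s := fun s _ => by
    simpa using (((hasDerivAt_id s).const_mul Λ).fun_neg.exp).fun_neg
  have hcont : Continuous fun s => Real.exp (-(Λ * s)) * Λ := by fun_prop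
  rw [← ofReal_integral_eq_lintegral_ofReal, ← intervalIntegral.integral_of_le ht,
    intervalIntegral.integral_eq_sub_of_hasDerivAt hder (hcont.intervalIntegrable _ _)]
  · congr 1; simp; ring
  · exact (hcont.integrableOn_Icc (a := 0) (b := t)).mono_set Set.Ioc_subset_Icc_self
  · exact Eventually.of_forall fun s => mul_nonneg (Real.exp_nonneg _) hΛ

theorem tsum_trans_le [Countable E] (hq : ∀ i, ∑' l, q i l ≠ ∞) {g : E → ℝ≥0∞} {C : ℝ≥0∞}
    (hg : ∀ j, g j ≤ C) {t : ℝ} (ht : 0 ≤ t) (i : E) : ∑' j, trans q t i j * g j ≤ C := by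
  rw [tsum_trans]
  refine iSup_le fun k => ?_
  induction k generalizing t i with
  | zero => simp [transIter]
  | succ k ih =>
    rw [tsum_transIter_succ]
    set Λ := (∑' l, q i l).toReal with hΛ
    have hΛ0 : 0 ≤ Λ := ENNReal.toReal_nonneg
    have hle : Real.exp (-(Λ * t)) ≤ 1 := Real.exp_le_one_iff.2 (by nlinarith)
    calc _ ≤ ENNReal.ofReal (Real.exp (-(Λ * t))) * C +
        ∫⁻ s in Set.Ioc (0 : ℝ) t, (ENNReal.ofReal (Real.exp (-(Λ * s))) * ENNReal.ofReal Λ) * C := by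
          refine add_le_add (mul_le_mul_right (hg i) _) (setLIntegral_mono' measurableSet_Ioc
            fun s hs => ?_)
          rw [mul_assoc]
          refine mul_le_mul_right ?_ _
          rw [hΛ, ENNReal.ofReal_toReal (hq i), ← ENNReal.tsum_mul_right]
          exact ENNReal.tsum_le_tsum fun l => mul_le_mul_right (ih (sub_nonneg.2 hs.2) l) _
      _ = C := by
          rw [lintegral_mul_const _ (by fun_prop), lintegral_exp_neg ht hΛ0, ← add_mul,
            ← ENNReal.ofReal_add (Real.exp_nonneg _) (by linarith)]
          simp

/-! ### The backward differential equation -/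

variable {ι : Type} {S : E → Finset ι} {c : E → ι → ℝ} {T : E → ι → E}

/-- For nonnegative `g` everything can be computed in `[0, ∞]`. The substitution `y = t - s` turns
the integral equation into `u t i = e^{-Λ t} (g i + ∫_0^t e^{Λ y} ∑_x c i x * u y (T i x) dy)`. The
integrand is bounded and measurable, so each `u` is continuous in time; then the finite sum in the
integrand is continuous, and `u` is differentiable. -/
theorem chain_nonneg_spec [Countable E] (hc : ∀ i x, 0 ≤ c i x)
    (hQ : ∀ i (φ : E → ℝ≥0∞), ∑' l, q i l * φ l = ∑ x ∈ S i, ENNReal.ofReal (c i x) * φ (T i x))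
    {g : E → ℝ} {C : ℝ} (hg0 : ∀ j, 0 ≤ g j) (hgC : ∀ j, g j ≤ C) (u : ℝ → E → ℝ)
    (hu : ∀ t i, u t i = (∑' j, trans q t i j * ENNReal.ofReal (g j)).toReal) (i : E) :
    (∀ t, 0 ≤ t → u t i ≤ C) ∧ u 0 i = g i ∧ ContinuousOn (fun t => u t i) (Set.Ici 0) ∧
      ∀ t, 0 < t →
        HasDerivAt (fun t => u t i) (∑ x ∈ S i, c i x * (u t (T i x) - u t i)) t := by
  have hq1 : ∀ i, ∑' l, q i l = ENNReal.ofReal (∑ x ∈ S i, c i x) := fun i => by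
    rw [ENNReal.ofReal_sum_of_nonneg fun x _ => hc i x]
    simpa using hQ i 1
  have hq : ∀ i, ∑' l, q i l ≠ ∞ := fun i => by rw [hq1]; exact ENNReal.ofReal_ne_top
  have hC : 0 ≤ C := (hg0 i).trans (hgC i)
  have hUle : ∀ t, 0 ≤ t → ∀ i, ∑' j, trans q t i j * ENNReal.ofReal (g j) ≤ ENNReal.ofReal C :=
    fun t ht i => tsum_trans_le hq (fun j => ENNReal.ofReal_le_ofReal (hgC j)) ht i
  have hUu : ∀ t, 0 ≤ t → ∀ i,
      ∑' j, trans q t i j * ENNReal.ofReal (g j) = ENNReal.ofReal (u t i) := fun t ht i => by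
    rw [hu, ENNReal.ofReal_toReal ((hUle t ht i).trans_lt ENNReal.ofReal_lt_top).ne]
  have hu0 : ∀ t i, 0 ≤ u t i := fun t i => by rw [hu]; exact ENNReal.toReal_nonneg
  have huC : ∀ t, 0 ≤ t → ∀ i, u t i ≤ C := fun t ht i => by
    rw [hu]; exact ENNReal.toReal_le_of_le_ofReal hC (hUle t ht i)
  have humeas : ∀ i, Measurable fun t => u t i := fun i => by
    simp_rw [hu]
    exact (Measurable.tsum fun j => (measurable_trans i j).mul_const _).ennreal_toReal
  have main : ∀ i, ∃ h : ℝ → ℝ, (∀ a b, IntervalIntegrable h volume a b) ∧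
      (∀ y, 0 ≤ y → h y = Real.exp ((∑ x ∈ S i, c i x) * y) * ∑ x ∈ S i, c i x * u y (T i x)) ∧
      ∀ t, 0 ≤ t → u t i = Real.exp (-((∑ x ∈ S i, c i x) * t)) * (g i + ∫ y in 0..t, h y) := by
    intro i
    set Λ := ∑ x ∈ S i, c i x with hΛ
    have hΛ0 : 0 ≤ Λ := Finset.sum_nonneg fun x _ => hc i x
    -- The bound on `u` holds at nonnegative times only; `max y 0` makes the sum bounded on the
    -- whole line.
    have hwm : Measurable fun y => ∑ x ∈ S i, c i x * u (max y 0) (T i x) :=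
      Finset.measurable_sum _ fun x _ =>
        ((humeas _).comp (measurable_id.max measurable_const)).const_mul _
    have hw0 : ∀ y, 0 ≤ ∑ x ∈ S i, c i x * u (max y 0) (T i x) := fun y =>
      Finset.sum_nonneg fun x _ => mul_nonneg (hc i x) (hu0 _ _)
    have hwC : ∀ y, ∑ x ∈ S i, c i x * u (max y 0) (T i x) ≤ Λ * C := fun y => by
      rw [hΛ, Finset.sum_mul]
      exact Finset.sum_le_sum fun x _ =>
        mul_le_mul_of_nonneg_left (huC _ (le_max_right _ _) _) (hc i x)
    have hint : ∀ (e : ℝ → ℝ), Continuous e → ∀ a b, IntervalIntegrable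
        (fun y => e y * ∑ x ∈ S i, c i x * u (max y 0) (T i x)) volume a b := by
      intro e he a b
      have h1 : IntervalIntegrable (fun y => e y * (Λ * C)) volume a b :=
        (he.mul continuous_const).intervalIntegrable _ _
      refine h1.mono_fun (he.measurable.mul hwm).aestronglyMeasurable
        (Eventually.of_forall fun y => ?_)
      dsimp only
      rw [norm_mul, norm_mul, Real.norm_of_nonneg (hw0 y), Real.norm_of_nonneg (mul_nonneg hΛ0 hC)]
      exact mul_le_mul_of_nonneg_left (hwC y) (norm_nonneg _)
    refine ⟨fun y => Real.exp (Λ * y) * ∑ x ∈ S i, c i x * u (max y 0) (T i x),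
      hint _ (by fun_prop), fun y hy => by simp only [max_eq_left hy], fun t ht => ?_⟩
    have hΛ' : (∑' l, q i l).toReal = Λ := by rw [hq1, ENNReal.toReal_ofReal hΛ0]
    have h1 : ∑' j, trans q t i j * ENNReal.ofReal (g j) =
        ENNReal.ofReal (Real.exp (-(Λ * t)) * g i) + ∫⁻ s in Set.Ioc (0 : ℝ) t,
          ENNReal.ofReal (Real.exp (-(Λ * s)) *
            ∑ x ∈ S i, c i x * u (max (t - s) 0) (T i x)) := by
      rw [tsum_trans_eq, hΛ', ENNReal.ofReal_mul (Real.exp_nonneg _)]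
      congr 1
      refine setLIntegral_congr_fun measurableSet_Ioc fun s hs => ?_
      rw [hQ, ENNReal.ofReal_mul (Real.exp_nonneg _),
        ENNReal.ofReal_sum_of_nonneg fun x _ => mul_nonneg (hc i x) (hu0 _ _),
        max_eq_left (sub_nonneg.2 hs.2)]
      congr 1
      refine Finset.sum_congr rfl fun x _ => ?_
      rw [hUu _ (sub_nonneg.2 hs.2), ENNReal.ofReal_mul (hc i x)]
    have hii : IntervalIntegrable (fun s => Real.exp (-(Λ * s)) *
            ∑ x ∈ S i, c i x * u (max (t - s) 0) (T i x)) volume 0 t := by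
      have := (hint (fun y => Real.exp (-(Λ * (t - y)))) (by fun_prop) t 0).comp_sub_left t
      simpa using this
    rw [hu, h1, ← ofReal_integral_eq_lintegral_ofReal, ← intervalIntegral.integral_of_le ht,
      ENNReal.toReal_add ENNReal.ofReal_ne_top ENNReal.ofReal_ne_top, ENNReal.toReal_ofReal,
      ENNReal.toReal_ofReal, mul_add]
    · congr 1
      have h2 := intervalIntegral.integral_comp_sub_left (a := 0) (b := t)
        (fun y => Real.exp (-(Λ * (t - y))) * ∑ x ∈ S i, c i x * u (max y 0) (T i x)) t
      simp only [sub_sub_cancel, sub_self, sub_zero] at h2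
      rw [h2, ← intervalIntegral.integral_const_mul]
      refine intervalIntegral.integral_congr fun y _ => ?_
      rw [← mul_assoc, ← Real.exp_add]
      congr 2
      ring
    · exact intervalIntegral.integral_nonneg ht fun s _ =>
        mul_nonneg (Real.exp_nonneg _) (hw0 _)
    · exact mul_nonneg (Real.exp_nonneg _) (hg0 i)
    · exact (intervalIntegrable_iff_integrableOn_Ioc_of_le ht).1 hii
    · exact Eventually.of_forall fun s => mul_nonneg (Real.exp_nonneg _) (hw0 _)
  have hcont : ∀ i, ContinuousOn (fun t => u t i) (Set.Ici 0) := by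
    intro i
    obtain ⟨h, h1, -, h3⟩ := main i
    refine ContinuousOn.congr (Continuous.continuousOn ?_) fun t ht => h3 t ht
    have := intervalIntegral.continuous_primitive h1 0
    fun_prop
  refine ⟨fun t ht => huC t ht i, ?_, hcont i, fun t ht => ?_⟩
  · obtain ⟨h, -, -, h3⟩ := main i
    rw [h3 0 le_rfl]; simp
  · obtain ⟨h, h1, h2, h3⟩ := main i
    set Λ := ∑ x ∈ S i, c i x with hΛ
    have hcs : ContinuousOn
        (fun y => Real.exp (Λ * y) * ∑ x ∈ S i, c i x * u y (T i x)) (Set.Ici 0) := by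
      refine ContinuousOn.mul (by fun_prop) (continuousOn_finsetSum _ fun x _ => ?_)
      exact continuousOn_const.mul (hcont _)
    have hcon : ContinuousOn h (Set.Ioi 0) :=
      (hcs.mono Set.Ioi_subset_Ici_self).congr fun y hy => h2 y (le_of_lt hy)
    have hint : HasDerivAt (fun t => ∫ y in 0..t, h y) (h t) t :=
      intervalIntegral.integral_hasDerivAt_right (h1 0 t)
        (hcon.stronglyMeasurableAtFilter isOpen_Ioi t ht) (hcon.continuousAt (Ioi_mem_nhds ht))
    have hexp : HasDerivAt (fun t => Real.exp (-(Λ * t))) (Real.exp (-(Λ * t)) * (-Λ)) t := by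
      have := ((hasDerivAt_id t).const_mul Λ).fun_neg.exp
      simpa using this
    have hprod := hexp.mul (hint.const_add (g i))
    refine (hprod.congr_of_eventuallyEq ?_).congr_deriv ?_
    · filter_upwards [Ioi_mem_nhds ht] with s hs
      exact h3 s (le_of_lt hs)
    · rw [h2 t ht.le]
      have h4 : ∑ x ∈ S i, c i x * (u t (T i x) - u t i) =
          ∑ x ∈ S i, c i x * u t (T i x) - Λ * u t i := by
        rw [hΛ, Finset.sum_mul, ← Finset.sum_sub_distrib]
        exact Finset.sum_congr rfl fun x _ => by ring
      rw [h4, h3 t ht.le, ← mul_assoc (Real.exp (-(Λ * t))) (Real.exp _), ← Real.exp_add]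
      simp
      ring

/-- The semigroup of the minimal chain applied to a bounded function solves the backward
differential equation. -/
theorem chain_spec [Countable E] (hc : ∀ i x, 0 ≤ c i x)
    (hQ : ∀ i (φ : E → ℝ≥0∞), ∑' l, q i l * φ l = ∑ x ∈ S i, ENNReal.ofReal (c i x) * φ (T i x))
    {g : E → ℝ} {C : ℝ} (hgC : ∀ j, |g j| ≤ C) (u : ℝ → E → ℝ)
    (hu : ∀ t i, u t i = ∑' j, (trans q t i j).toReal * g j) (i : E) :
    (∀ t, 0 ≤ t → |u t i| ≤ 3 * C) ∧ u 0 i = g i ∧ ContinuousOn (fun t => u t i) (Set.Ici 0) ∧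
      ∀ t, 0 < t →
        HasDerivAt (fun t => u t i) (∑ x ∈ S i, c i x * (u t (T i x) - u t i)) t := by
  have hC : 0 ≤ C := (abs_nonneg _).trans (hgC i)
  have hq : ∀ i, ∑' l, q i l ≠ ∞ := fun i => by
    have := hQ i 1
    simp only [Pi.one_apply, mul_one] at this
    rw [this]
    exact (ENNReal.sum_lt_top.2 fun _ _ => ENNReal.ofReal_lt_top).ne
  have hle : ∀ t, 0 ≤ t → ∀ i, ∑' j, trans q t i j ≤ 1 := fun t ht i => by
    simpa using tsum_trans_le hq (g := 1) (C := 1) (fun _ => le_rfl) ht i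
  have hne : ∀ t, 0 ≤ t → ∀ i j, trans q t i j ≠ ∞ := fun t ht i j =>
    ((ENNReal.le_tsum j).trans (hle t ht i)).trans_lt ENNReal.one_lt_top |>.ne
  have hsum : ∀ t, 0 ≤ t → ∀ i, Summable fun j => (trans q t i j).toReal := fun t ht i =>
    ENNReal.summable_toReal ((hle t ht i).trans_lt ENNReal.one_lt_top).ne
  -- Decomposition `g = (g + C) - C`. The second part stays a semigroup term, since the total mass
  -- is not yet known to be one.
  let u1 : ℝ → E → ℝ := fun t i => (∑' j, trans q t i j * ENNReal.ofReal (g j + C)).toReal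
  let u2 : ℝ → E → ℝ := fun t i => (∑' j, trans q t i j * ENNReal.ofReal C).toReal
  have hgsum : ∀ t, 0 ≤ t → ∀ i, Summable fun j => (trans q t i j).toReal * g j :=
    fun t ht i => ((hsum t ht i).mul_right C).of_norm_bounded fun j => by
      rw [norm_mul, Real.norm_of_nonneg ENNReal.toReal_nonneg]
      exact mul_le_mul_of_nonneg_left (hgC j) ENNReal.toReal_nonneg
  have heq : ∀ t, 0 ≤ t → ∀ i, u t i = u1 t i - u2 t i := by
    intro t ht i
    simp only [u1, u2]
    rw [ENNReal.tsum_toReal_eq fun j => ENNReal.mul_ne_top (hne t ht i j) ENNReal.ofReal_ne_top,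
      ENNReal.tsum_toReal_eq fun j => ENNReal.mul_ne_top (hne t ht i j) ENNReal.ofReal_ne_top]
    have hg' : ∀ j, 0 ≤ g j + C := fun j => by have := neg_le_of_abs_le (hgC j); linarith
    simp_rw [ENNReal.toReal_mul, ENNReal.toReal_ofReal hC, ENNReal.toReal_ofReal (hg' _)]
    rw [hu, ← Summable.tsum_sub]
    · exact tsum_congr fun j => by ring
    · simpa only [mul_add] using (hgsum t ht i).add ((hsum t ht i).mul_right C)
    · exact (hsum t ht i).mul_right C
  have hs1 := fun i => chain_nonneg_spec hc hQ (g := fun j => g j + C) (C := 2 * C)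
    (fun j => by have := neg_le_of_abs_le (hgC j); linarith)
    (fun j => by have := le_of_abs_le (hgC j); linarith) u1 (fun _ _ => rfl) i
  have hs2 := fun i => chain_nonneg_spec hc hQ (g := fun _ => C) (C := C)
    (fun j => hC) (fun j => le_rfl) u2 (fun _ _ => rfl) i
  obtain ⟨h1, h2, h3, h4⟩ := hs1 i
  obtain ⟨h1', h2', h3', h4'⟩ := hs2 i
  refine ⟨fun t ht => ?_, ?_, ?_, fun t ht => ?_⟩
  · have e1 : 0 ≤ u1 t i := ENNReal.toReal_nonneg
    have e2 : 0 ≤ u2 t i := ENNReal.toReal_nonneg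
    have e3 := h1 t ht
    have e4 := h1' t ht
    rw [heq t ht, abs_le]
    constructor <;> linarith
  · rw [heq 0 le_rfl, h2, h2']; ring
  · exact (h3.sub h3').congr fun t ht => heq t ht i
  · refine (((h4 t ht).sub (h4' t ht)).congr_of_eventuallyEq ?_).congr_deriv ?_
    · filter_upwards [Ioi_mem_nhds ht] with s hs
      exact heq s (le_of_lt hs) i
    · rw [← Finset.sum_sub_distrib]
      refine Finset.sum_congr rfl fun x _ => ?_
      rw [heq t ht.le, heq t ht.le]
      ring

end Chain

/-! ### A maximum principle -/

/-- The Lyapunov function of the maximum principle. -/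
def lyap {E : Type} (M : E → ℕ) (c b t : ℝ) (i : E) : ℝ :=
  Real.exp (c * t + (9 / 8 + b * t) * M i)

theorem lyap_pos {E : Type} (M : E → ℕ) (c b t : ℝ) (i : E) : 0 < lyap M c b t i :=
  Real.exp_pos _

theorem hasDerivAt_lyap {E : Type} (M : E → ℕ) (c b t : ℝ) (i : E) :
    HasDerivAt (fun t => lyap M c b t i) ((c + b * M i) * lyap M c b t i) t := by
  have h1 : HasDerivAt (fun t : ℝ => c * t + (9 / 8 + b * t) * M i) (c + b * M i) t := by
    have := ((hasDerivAt_id t).const_mul c).fun_add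
      ((((hasDerivAt_id t).const_mul b).const_add (9 / 8)).mul_const (M i : ℝ))
    simpa using this
  exact h1.exp.congr_deriv (mul_comm _ _)

/-- Write `ψ` for `lyap` and suppose `D ≤ A ψ`. By `hstep`, `e^{q t} (D - A ψ)` is nonincreasing,
and `D 0 ≤ 0` then gives `D ≤ A (ψ t - e^{-q t} ψ 0)`. Where `M` stays below a threshold, the
subtracted term is at least `κ ψ t`, so `A` improves by the factor `1 - κ`; where `M` is large, `D ≤
ε ψ` by the growth bound, because the slope `9 / 8` in `ψ` exceeds the slope `1` in `hK`. Iteration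
leaves `D ≤ ε ψ` everywhere, and `ε` tends to zero. No supremum needs to be attained and `q` may be
unbounded. -/
theorem maximum_principle {E : Type} {M : E → ℕ} {q : E → ℝ} {q0 c b T K : ℝ}
    (hT : 0 ≤ T) (hq0 : 0 ≤ q0) (hc : 0 ≤ c) (hb : 0 ≤ b) (hq : ∀ i, q i ≤ q0 * (M i + 1))
    {D D' : ℝ → E → ℝ} (hcont : ∀ i, ContinuousOn (fun t => D t i) (Set.Icc 0 T))
    (hder : ∀ i, ∀ t ∈ Set.Ioo 0 T, HasDerivAt (fun t => D t i) (D' t i) t)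
    (h0 : ∀ i, D 0 i ≤ 0) (hK : ∀ i, ∀ t ∈ Set.Icc 0 T, D t i ≤ K * Real.exp (M i))
    (hstep : ∀ A, 0 ≤ A → ∀ t ∈ Set.Ioo 0 T, (∀ j, D t j ≤ A * lyap M c b t j) → ∀ i,
      D' t i - A * ((c + b * M i) * lyap M c b t i) + q i * (D t i - A * lyap M c b t i) ≤ 0) :
    ∀ i, ∀ t ∈ Set.Icc 0 T, D t i ≤ 0 := by
  wlog hK0 : 0 ≤ K generalizing K
  · exact this (K := 0) (fun i t ht => (hK i t ht).trans
      (mul_le_mul_of_nonneg_right (not_le.1 hK0).le (Real.exp_nonneg _))) le_rfl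
  have improve : ∀ A, 0 ≤ A → (∀ i, ∀ t ∈ Set.Icc 0 T, D t i ≤ A * lyap M c b t i) →
      ∀ i, ∀ t ∈ Set.Icc 0 T,
        D t i ≤ A * (lyap M c b t i - Real.exp (-(q i * t)) * lyap M c b 0 i) := by
    intro A hA h i t ht
    have hanti : AntitoneOn (fun s => Real.exp (q i * s) * (D s i - A * lyap M c b s i))
        (Set.Icc 0 T) := by
      have hd : ∀ s ∈ Set.Ioo 0 T, HasDerivAt
          (fun s => Real.exp (q i * s) * (D s i - A * lyap M c b s i))
          (Real.exp (q i * s) * q i * (D s i - A * lyap M c b s i) +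
            Real.exp (q i * s) * (D' s i - A * ((c + b * M i) * lyap M c b s i))) s := by
        intro s hs
        have h1 : HasDerivAt (fun s => Real.exp (q i * s)) (Real.exp (q i * s) * q i) s := by
          simpa using ((hasDerivAt_id s).const_mul (q i)).exp
        exact h1.fun_mul ((hder i s hs).fun_sub ((hasDerivAt_lyap M c b s i).const_mul A))
      refine antitoneOn_of_deriv_nonpos (convex_Icc _ _) ?_ ?_ ?_
      · refine ContinuousOn.mul (by fun_prop) ((hcont i).sub ?_)
        exact continuousOn_const.mul
          (fun s _ => (hasDerivAt_lyap M c b s i).continuousAt.continuousWithinAt)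
      · rw [interior_Icc]
        exact fun s hs => (hd s hs).differentiableAt.differentiableWithinAt
      · rw [interior_Icc]
        intro s hs
        rw [(hd s hs).deriv]
        have h2 := hstep A hA s hs (fun j => h j s (Set.Ioo_subset_Icc_self hs)) i
        have h3 := Real.exp_pos (q i * s)
        nlinarith
    have h1 := hanti (Set.left_mem_Icc.2 hT) ht ht.1
    simp only [mul_zero, Real.exp_zero, one_mul] at h1
    have h2 : Real.exp (q i * t) * (D t i - A * lyap M c b t i) ≤ - (A * lyap M c b 0 i) :=
      h1.trans (by have := h0 i; linarith)
    have h3 := mul_le_mul_of_nonneg_left h2 (Real.exp_nonneg (-(q i * t)))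
    rw [← mul_assoc, ← Real.exp_add, neg_add_cancel, Real.exp_zero, one_mul] at h3
    linarith
  have hexp_le : ∀ i, ∀ t ∈ Set.Icc 0 T, Real.exp (9 / 8 * M i) ≤ lyap M c b t i := by
    intro i t ht
    refine Real.exp_le_exp.2 ?_
    have h1 := mul_nonneg hc ht.1
    have h2 := mul_nonneg (mul_nonneg hb ht.1) (Nat.cast_nonneg (α := ℝ) (M i))
    nlinarith
  have hεκ : ∀ ε, 0 < ε → ∃ κ, 0 < κ ∧ κ ≤ 1 ∧ ∀ i, ∀ t ∈ Set.Icc 0 T,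
      D t i ≤ ε * lyap M c b t i ∨
        κ * lyap M c b t i ≤ Real.exp (-(q i * t)) * lyap M c b 0 i := by
    intro ε hε
    -- For `M i ≥ R` the surplus factor `exp (M i / 8)` is at least `K / ε`.
    obtain ⟨R, hR⟩ := exists_nat_ge (8 * (K / ε))
    -- A lower bound for `e^{-q t} ψ 0 / ψ t` over all `t ≤ T` and all states with `M i ≤ R`.
    refine ⟨Real.exp (-(q0 * (R + 1) * T + c * T + b * T * R)), Real.exp_pos _,
      Real.exp_le_one_iff.2 (neg_nonpos.2 (by positivity)), fun i t ht => ?_⟩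
    by_cases hi : R ≤ M i
    · left
      refine (hK i t ht).trans ?_
      have h1 : Real.exp (9 / 8 * M i) = Real.exp (M i / 8) * Real.exp (M i) := by
        rw [← Real.exp_add]; congr 1; ring
      have h2 : (R : ℝ) ≤ M i := Nat.cast_le.2 hi
      have h3 : K ≤ ε * Real.exp (M i / 8) := by
        have h4 := Real.add_one_le_exp ((M i : ℝ) / 8)
        have h5 : K / ε ≤ Real.exp (M i / 8) := by linarith
        rwa [div_le_iff₀' hε] at h5
      calc _ ≤ ε * Real.exp (M i / 8) * Real.exp (M i) :=
            mul_le_mul_of_nonneg_right h3 (Real.exp_nonneg _)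
        _ = ε * Real.exp (9 / 8 * M i) := by rw [h1, mul_assoc]
        _ ≤ _ := mul_le_mul_of_nonneg_left (hexp_le i t ht) hε.le
    · right
      have h2 : (M i : ℝ) ≤ R := Nat.cast_le.2 (not_le.1 hi).le
      have hM : (0 : ℝ) ≤ M i := Nat.cast_nonneg _
      rw [lyap, lyap, ← Real.exp_add, ← Real.exp_add]
      refine Real.exp_le_exp.2 ?_
      have e1 : q i * t ≤ q0 * (R + 1) * T :=
        (mul_le_mul_of_nonneg_right ((hq i).trans (mul_le_mul_of_nonneg_left (by linarith) hq0))
          ht.1).trans (mul_le_mul_of_nonneg_left ht.2 (by positivity))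
      have e2 : c * t ≤ c * T := mul_le_mul_of_nonneg_left ht.2 hc
      have e3 : b * t * M i ≤ b * T * R :=
        mul_le_mul (mul_le_mul_of_nonneg_left ht.2 hb) h2 hM (by positivity)
      nlinarith
  have hε : ∀ ε, 0 < ε → ∀ i, ∀ t ∈ Set.Icc 0 T, D t i ≤ ε * lyap M c b t i := by
    intro ε hε
    obtain ⟨κ, hκ0, hκ1, hκ⟩ := hεκ ε hε
    have hn : ∀ n : ℕ, ∀ i, ∀ t ∈ Set.Icc 0 T,
        D t i ≤ (ε + (1 - κ) ^ n * K) * lyap M c b t i := by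
      intro n
      have h1κ : 0 ≤ 1 - κ := sub_nonneg.2 hκ1
      induction n with
      | zero =>
        intro i t ht
        refine (hK i t ht).trans ?_
        rw [pow_zero, one_mul]
        refine mul_le_mul (by linarith) ((Real.exp_le_exp.2 ?_).trans (hexp_le i t ht))
          (Real.exp_nonneg _) (by positivity)
        have := Nat.cast_nonneg (α := ℝ) (M i)
        linarith
      | succ n ih =>
        intro i t ht
        have hl := lyap_pos M c b t i
        have hpow : 0 ≤ (1 - κ) ^ n * K := by positivity
        have hpow' : 0 ≤ (1 - κ) ^ (n + 1) * K := by positivity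
        rcases hκ i t ht with h | h
        · refine h.trans (mul_le_mul_of_nonneg_right (by linarith) hl.le)
        · refine (improve _ (by positivity) ih i t ht).trans ?_
          calc _ ≤ (ε + (1 - κ) ^ n * K) * ((1 - κ) * lyap M c b t i) :=
                mul_le_mul_of_nonneg_left (by linarith) (by positivity)
            _ = (ε * (1 - κ) + (1 - κ) ^ (n + 1) * K) * lyap M c b t i := by ring
            _ ≤ _ := mul_le_mul_of_nonneg_right (by nlinarith) hl.le
    intro i t ht
    have hlim : Tendsto (fun n : ℕ => (ε + (1 - κ) ^ n * K) * lyap M c b t i) atTop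
        (𝓝 ((ε + 0 * K) * lyap M c b t i)) :=
      (((tendsto_pow_atTop_nhds_zero_of_lt_one (by linarith) (by linarith)).mul_const K).const_add
        ε).mul_const _
    rw [zero_mul, add_zero] at hlim
    exact ge_of_tendsto' hlim fun n => hn n i t ht
  intro i t ht
  have hlim : Tendsto (fun ε => ε * lyap M c b t i) (𝓝[>] 0) (𝓝 (0 * lyap M c b t i)) :=
    (tendsto_id.mul_const _).mono_left nhdsWithin_le_nhds
  rw [zero_mul] at hlim
  exact ge_of_tendsto hlim (by filter_upwards [self_mem_nhdsWithin] with ε hε1 using hε ε hε1 i t ht)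

/-! ### The chain on finite configurations -/

theorem FinConfig.mem_bothSided (ξ : FinConfig) : ξ.1 ∈ bothSided := by
  have h0 : (fun _ => false : Config) ∈ bothSided := by
    constructor
    · exact (Set.Ici_infinite (0 : ℤ)).mono fun x hx => ⟨hx, rfl⟩
    · exact (Set.Iio_infinite (0 : ℤ)).mono fun x hx => ⟨hx, rfl⟩
  refine bothSided_of_finite_ne h0 (ξ.2.subset fun y hy => ?_)
  simpa using hy

theorem finite_active_of_finite_ne {η : Config} {ξ : FinConfig} (h : {y | η y ≠ ξ.1 y}.Finite) :
    {y | η y = true}.Finite := by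
  refine (h.union ξ.2).subset fun y hy => ?_
  by_cases h1 : η y = ξ.1 y
  · right; rw [Set.mem_ofPred_eq] at hy ⊢; rw [← h1, hy]
  · left; exact h1

/-- The addition operator on finite configurations. -/
def addFin (x : ℤ) (ξ : FinConfig) : FinConfig :=
  ⟨addOp x ξ.1, finite_active_of_finite_ne (addOp_finite_ne ξ.mem_bothSided x)⟩

/-- The flip on finite configurations. -/
def flipFin (x : ℤ) (ξ : FinConfig) : FinConfig :=
  ⟨flip x ξ.1, finite_active_of_finite_ne (flip_finite_ne ξ.1 x)⟩

/-- The finset of active sites. -/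
def actives (ξ : FinConfig) : Finset ℤ := ξ.2.toFinset

theorem mem_actives {ξ : FinConfig} {x : ℤ} : x ∈ actives ξ ↔ ξ.1 x = true := by
  simp [actives]

/-- The number of active sites. -/
def mass (ξ : FinConfig) : ℕ := (actives ξ).card

/-- The sites at which the chain with births in `[-n, n]` may jump. -/
def sites (n : ℕ) (ξ : FinConfig) : Finset ℤ :=
  actives ξ ∪ Finset.Icc (-(n : ℤ)) n

theorem mem_sites {n : ℕ} {ξ : FinConfig} {x : ℤ} :
    x ∈ sites n ξ ↔ ξ.1 x = true ∨ x ∈ Set.Icc (-(n : ℤ)) n := by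
  simp [sites, mem_actives]

instance : Countable FinConfig := by
  refine Function.Injective.countable (f := actives) fun ξ ζ h => Subtype.ext (funext fun x => ?_)
  have : ξ.1 x = true ↔ ζ.1 x = true := by rw [← mem_actives, ← mem_actives, h]
  exact Bool.eq_iff_iff.2 this

theorem card_sites_le (n : ℕ) (ξ : FinConfig) :
    ((sites n ξ).card : ℝ) ≤ (2 * n + 1) * (mass ξ + 1) := by
  have h : (sites n ξ).card ≤ mass ξ + (2 * n + 1) := by
    refine (Finset.card_union_le _ _).trans (Nat.add_le_add_left ?_ _)
    rw [Int.card_Icc]; omega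
  have h' : ((sites n ξ).card : ℝ) ≤ mass ξ + (2 * n + 1) := by exact_mod_cast h
  have h1 : (0 : ℝ) ≤ mass ξ := Nat.cast_nonneg _
  have h2 : (0 : ℝ) ≤ n := Nat.cast_nonneg _
  nlinarith [mul_nonneg h1 h2]

open Classical in
theorem tsum_ite_mul (ζ : FinConfig) (r : ℝ≥0∞) (φ : FinConfig → ℝ≥0∞) :
    ∑' l : FinConfig, (if ζ.1 = l.1 then r else 0) * φ l = r * φ ζ := by
  rw [tsum_eq_single ζ fun l hl => ?_, if_pos rfl]
  rw [if_neg (fun h => hl (Subtype.ext h.symm)), zero_mul]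

open Classical in
-- Jumps are indexed by a site and a `Bool`: `true` for the flip, `false` for the addition. At an
-- inactive site both have the same effect, so the birth rate `1 + α` splits into `1` and `α`, as at
-- an active site.
theorem tsum_rate_mul {α : ℝ} (hα : 0 ≤ α) (n : ℕ) (ξ : FinConfig) (φ : FinConfig → ℝ≥0∞) :
    ∑' l, rate α n ξ l * φ l = ∑ p ∈ sites n ξ ×ˢ (Finset.univ : Finset Bool),
      ENNReal.ofReal (if p.2 then 1 else α) * φ (if p.2 then flipFin p.1 ξ else addFin p.1 ξ) := by
  simp_rw [rate, ← ENNReal.tsum_mul_right]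
  rw [ENNReal.tsum_comm, tsum_eq_sum (s := sites n ξ), Finset.sum_product]
  · refine Finset.sum_congr rfl fun x hx => ?_
    rw [mem_sites] at hx
    simp only [Fintype.sum_bool, if_true, Bool.false_eq_true, if_false, ENNReal.ofReal_one, one_mul]
    have e1 : ∀ l : FinConfig, (addOp x ξ.1 = l.1) = ((addFin x ξ).1 = l.1) := fun _ => rfl
    have e2 : ∀ l : FinConfig, (flip x ξ.1 = l.1) = ((flipFin x ξ).1 = l.1) := fun _ => rfl
    by_cases h : ξ.1 x = true
    · simp_rw [if_pos h, add_mul, e1, e2]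
      rw [ENNReal.tsum_add, tsum_ite_mul, tsum_ite_mul, one_mul, add_comm]
    · simp_rw [if_neg h, if_pos (hx.resolve_left h), e2]
      rw [tsum_ite_mul, ENNReal.ofReal_add zero_le_one hα, add_mul, ENNReal.ofReal_one, one_mul]
      congr 3
      exact Subtype.ext (addOp_eq_flip (by simpa using h)).symm
  · intro x hx
    rw [mem_sites, not_or] at hx
    simp_rw [if_neg hx.1, if_neg hx.2]
    simp

/-- The generator of the chain on finite configurations with births in `[-n, n]`. -/
def finGen (α : ℝ) (n : ℕ) (h : FinConfig → ℝ) (ξ : FinConfig) : ℝ :=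
  ∑ x ∈ sites n ξ, (α * (h (addFin x ξ) - h ξ) + (h (flipFin x ξ) - h ξ))

theorem finSemigroup_spec {α : ℝ} (hα : 0 ≤ α) (n : ℕ) {g : Config → ℝ} {C : ℝ}
    (hg : ∀ ζ, |g ζ| ≤ C) (ξ : FinConfig) :
    (∀ t, 0 ≤ t → |finSemigroup α n t g ξ| ≤ 3 * C) ∧ finSemigroup α n 0 g ξ = g ξ.1 ∧
      ContinuousOn (fun t => finSemigroup α n t g ξ) (Set.Ici 0) ∧
      ∀ t, 0 < t → HasDerivAt (fun t => finSemigroup α n t g ξ)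
        (finGen α n (finSemigroup α n t g) ξ) t := by
  have := chain_spec (q := rate α n) (ι := ℤ × Bool)
    (S := fun ξ => sites n ξ ×ˢ (Finset.univ : Finset Bool))
    (c := fun _ p => if p.2 then 1 else α)
    (T := fun ξ p => if p.2 then flipFin p.1 ξ else addFin p.1 ξ)
    (fun i p => by split_ifs <;> simp [hα]) (tsum_rate_mul hα n) (g := fun ζ => g ζ.1)
    (fun ζ => hg ζ.1) (fun t ξ => finSemigroup α n t g ξ) (fun _ _ => rfl) ξ
  refine ⟨this.1, this.2.1, this.2.2.1, fun t ht => (this.2.2.2 t ht).congr_deriv ?_⟩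
  rw [Finset.sum_product]
  refine Finset.sum_congr rfl fun x _ => ?_
  simp
  ring

/-! ### Change of mass and the supersolution -/

theorem mass_addFin_le (x : ℤ) (ξ : FinConfig) : mass (addFin x ξ) ≤ mass ξ + 1 := by
  cases hx : ξ.1 x
  · refine (Finset.card_le_card (t := insert x (actives ξ)) fun y hy => ?_).trans
      (Finset.card_insert_le _ _)
    rw [mem_actives] at hy
    rw [Finset.mem_insert, mem_actives]
    by_cases hyx : y = x
    · exact Or.inl hyx
    · right; simpa [addFin, addOp_of_false hx, hyx] using hy
  · obtain ⟨l, r, h⟩ := exists_isGap ξ.mem_bothSided hx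
    have h1 := h.left_lt
    have h2 := h.lt_right
    have hm : r + l - x ∈ actives ξ := mem_actives.2 (h.active _ (by omega) (by omega))
    have hsub : actives (addFin x ξ) ⊆ insert l (insert r ((actives ξ).erase (r + l - x))) := by
      intro y hy
      rw [mem_actives] at hy
      change addOp x ξ.1 y = true at hy
      rw [h.addOp_apply] at hy
      simp only [Finset.mem_insert, Finset.mem_erase, mem_actives]
      by_cases e1 : y = r + l - x
      · rw [if_pos e1] at hy; exact absurd hy (by simp)
      · rw [if_neg e1] at hy
        by_cases e2 : y = l ∨ y = r
        · tauto
        · rw [if_neg e2] at hy; tauto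
    have e1 := Finset.card_le_card hsub
    have e2 := Finset.card_insert_le l (insert r ((actives ξ).erase (r + l - x)))
    have e3 := Finset.card_insert_le r ((actives ξ).erase (r + l - x))
    have e4 := Finset.card_erase_add_one hm
    unfold mass
    omega

theorem mass_flipFin_le (x : ℤ) (ξ : FinConfig) : mass (flipFin x ξ) ≤ mass ξ + 1 := by
  refine (Finset.card_le_card (t := insert x (actives ξ)) fun y hy => ?_).trans
    (Finset.card_insert_le _ _)
  rw [mem_actives] at hy
  rw [Finset.mem_insert, mem_actives]
  by_cases hyx : y = x
  · exact Or.inl hyx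
  · right; simpa [flipFin, flip_apply, hyx] using hy

theorem mass_flipFin_le_of_active {x : ℤ} {ξ : FinConfig} (hx : ξ.1 x = true) :
    mass (flipFin x ξ) ≤ mass ξ := by
  refine Finset.card_le_card fun y hy => ?_
  rw [mem_actives] at hy ⊢
  by_cases hyx : y = x
  · rw [hyx, hx]
  · simpa [flipFin, flip_apply, hyx] using hy

theorem lyap_le_of_mass_le {b c t : ℝ} (hb : 0 ≤ b * t) {ξ ζ : FinConfig} (h : mass ζ ≤ mass ξ) :
    lyap mass c b t ζ ≤ lyap mass c b t ξ := by
  refine Real.exp_le_exp.2 ?_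
  have : (mass ζ : ℝ) ≤ mass ξ := Nat.cast_le.2 h
  nlinarith

/-- The slope `9 / 8 + b t` is at most `3 / 2` as long as `b t ≤ 3 / 8`. One more active site thus
multiplies `lyap` by at most five, whence the constant `4 = 5 - 1` in `lyap_sub_le`. -/
theorem exp_three_halves_le : Real.exp (3 / 2) ≤ 5 := by
  have h1 := Real.exp_one_lt_d9
  have h2 : Real.exp (3 / 2) * Real.exp (3 / 2) = Real.exp 1 * Real.exp 1 * Real.exp 1 := by
    rw [← Real.exp_add, ← Real.exp_add, ← Real.exp_add]; norm_num
  have h3 := Real.exp_pos 1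
  have h4 := Real.exp_pos (3 / 2)
  have h5 : Real.exp 1 * Real.exp 1 ≤ 7.4 := by nlinarith
  nlinarith

theorem lyap_sub_le {b c t : ℝ} (hb : 0 ≤ b * t) (hb' : b * t ≤ 3 / 8) {ξ ζ : FinConfig}
    (h : mass ζ ≤ mass ξ + 1) :
    lyap mass c b t ζ - lyap mass c b t ξ ≤ 4 * lyap mass c b t ξ := by
  have h1 : lyap mass c b t ζ ≤ Real.exp (3 / 2) * lyap mass c b t ξ := by
    rw [lyap, lyap, ← Real.exp_add]
    refine Real.exp_le_exp.2 ?_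
    have : (mass ζ : ℝ) ≤ mass ξ + 1 := by exact_mod_cast h
    nlinarith
  have h2 := mul_le_mul_of_nonneg_right exp_three_halves_le (lyap_pos mass c b t ξ).le
  linarith

/-- The right side is the time derivative of `lyap`, which is therefore a supersolution. An active
site contributes at most `4 α ψ`, as its death does not raise the mass; each of the `2 n + 1`
possible birth sites adds at most `4 (1 + α) ψ`. This explains the choice of the two constants in
`lyap`. -/
theorem finGen_lyap_le {α : ℝ} (hα : 0 ≤ α) (n : ℕ) {t : ℝ} (ht : 0 ≤ t)
    (ht' : 4 * α * t ≤ 3 / 8) (ξ : FinConfig) :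
    finGen α n (lyap mass (4 * (1 + α) * (2 * n + 1)) (4 * α) t) ξ ≤
      (4 * (1 + α) * (2 * n + 1) + 4 * α * mass ξ) *
        lyap mass (4 * (1 + α) * (2 * n + 1)) (4 * α) t ξ := by
  set c := 4 * (1 + α) * (2 * (n : ℝ) + 1) with hc
  set ψ := lyap mass c (4 * α) t with hψ
  have hψ0 : 0 ≤ ψ ξ := (lyap_pos mass c (4 * α) t ξ).le
  have hb : 0 ≤ 4 * α * t := by positivity
  have hterm : ∀ x ∈ sites n ξ, α * (ψ (addFin x ξ) - ψ ξ) + (ψ (flipFin x ξ) - ψ ξ) ≤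
      (if x ∈ actives ξ then 4 * α * ψ ξ else 0) +
        (if x ∈ Finset.Icc (-(n : ℤ)) n then 4 * (1 + α) * ψ ξ else 0) := by
    intro x hx
    have h1 : ψ (addFin x ξ) - ψ ξ ≤ 4 * ψ ξ := lyap_sub_le hb ht' (mass_addFin_le x ξ)
    have h1' := mul_le_mul_of_nonneg_left h1 hα
    by_cases hact : ξ.1 x = true
    · rw [if_pos (mem_actives.2 hact)]
      have h2 : ψ (flipFin x ξ) ≤ ψ ξ := lyap_le_of_mass_le hb (mass_flipFin_le_of_active hact)
      have h3 : 0 ≤ if x ∈ Finset.Icc (-(n : ℤ)) n then 4 * (1 + α) * ψ ξ else 0 := by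
        split_ifs <;> positivity
      linarith
    · have h3 : x ∈ Finset.Icc (-(n : ℤ)) n := by
        rw [Finset.mem_Icc]; exact (mem_sites.1 hx).resolve_left hact
      rw [if_neg (fun h => hact (mem_actives.1 h)), if_pos h3]
      have h2 : ψ (flipFin x ξ) - ψ ξ ≤ 4 * ψ ξ := lyap_sub_le hb ht' (mass_flipFin_le x ξ)
      linarith
  refine (Finset.sum_le_sum hterm).trans_eq ?_
  rw [Finset.sum_add_distrib, Finset.sum_ite_mem, Finset.sum_ite_mem, Finset.sum_const,
    Finset.sum_const, Finset.inter_eq_right.2 (by exact Finset.subset_union_left),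
    Finset.inter_eq_right.2 (by exact Finset.subset_union_right), Int.card_Icc,
    nsmul_eq_mul, nsmul_eq_mul, show (n + 1 - -(n : ℤ)).toNat = 2 * n + 1 by omega]
  push_cast
  rw [hc]
  change (mass ξ : ℝ) * _ + _ = _
  ring

theorem finGen_sub (α : ℝ) (n : ℕ) (g h : FinConfig → ℝ) (ξ : FinConfig) :
    finGen α n (fun ζ => g ζ - h ζ) ξ = finGen α n g ξ - finGen α n h ξ := by
  simp only [finGen, ← Finset.sum_sub_distrib]
  exact Finset.sum_congr rfl fun x _ => by ring

theorem finGen_add (α : ℝ) (n : ℕ) (g h : FinConfig → ℝ) (ξ : FinConfig) :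
    finGen α n (fun ζ => g ζ + h ζ) ξ = finGen α n g ξ + finGen α n h ξ := by
  simp only [finGen, ← Finset.sum_add_distrib]
  exact Finset.sum_congr rfl fun x _ => by ring

theorem finGen_const_mul (α : ℝ) (n : ℕ) (A : ℝ) (h : FinConfig → ℝ) (ξ : FinConfig) :
    finGen α n (fun ζ => A * h ζ) ξ = A * finGen α n h ξ := by
  simp only [finGen, Finset.mul_sum]
  exact Finset.sum_congr rfl fun x _ => by ring

/-- Uniqueness for the backward equation among functions of exponential growth in the mass. -/
theorem le_zero_of_backward {α : ℝ} (hα : 0 ≤ α) (n : ℕ) {T K : ℝ} (hT : 0 ≤ T)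
    (hT' : 4 * α * T ≤ 3 / 8) {D : ℝ → FinConfig → ℝ}
    (hcont : ∀ ξ, ContinuousOn (fun t => D t ξ) (Set.Icc 0 T))
    (hder : ∀ ξ, ∀ t ∈ Set.Ioo 0 T, HasDerivAt (fun t => D t ξ) (finGen α n (D t) ξ) t)
    (h0 : ∀ ξ, D 0 ξ ≤ 0) (hK : ∀ ξ, ∀ t ∈ Set.Icc 0 T, D t ξ ≤ K * Real.exp (mass ξ)) :
    ∀ ξ, ∀ t ∈ Set.Icc 0 T, D t ξ ≤ 0 := by
  refine maximum_principle (M := mass) (q := fun ξ => (1 + α) * (sites n ξ).card)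
    (q0 := (1 + α) * (2 * n + 1)) (c := 4 * (1 + α) * (2 * n + 1)) (b := 4 * α) hT (by positivity)
    (by positivity) (by positivity) (fun ξ => ?_) hcont hder h0 hK ?_
  · rw [mul_assoc]
    exact mul_le_mul_of_nonneg_left (card_sites_le n ξ) (by positivity)
  · intro A hA t ht hle ξ
    have h1 := finGen_lyap_le hα n ht.1.le
      ((mul_le_mul_of_nonneg_left ht.2.le (by positivity)).trans hT') ξ
    set ψ := lyap mass (4 * (1 + α) * (2 * n + 1)) (4 * α) t
    -- Since `(1 + α) * card` is the total weight of the terms of `finGen`, the diagonal cancels;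
    -- only values of `D t - A ψ` after a jump remain, with nonnegative weights.
    have h2 : finGen α n (fun ζ => D t ζ - A * ψ ζ) ξ +
        (1 + α) * (sites n ξ).card * (D t ξ - A * ψ ξ) ≤ 0 := by
      rw [finGen, mul_comm (1 + α), mul_assoc, ← nsmul_eq_mul, ← Finset.sum_const,
        ← Finset.sum_add_distrib]
      refine Finset.sum_nonpos fun x _ => ?_
      have h3 := hle (addFin x ξ)
      have h4 := hle (flipFin x ξ)
      have h5 := mul_nonneg hα (sub_nonneg.2 h3)
      linarith
    rw [finGen_sub, finGen_const_mul] at h2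
    have h6 := mul_le_mul_of_nonneg_left h1 hA
    linarith

/-! ### Monotonicity of the chains -/

/-- The mirror image of an active site in its gap. -/
def mirror (η : Config) (x : ℤ) : ℤ :=
  if η x = true then nextOne η x + prevOne η x - x else x

theorem IsGap.mirror {η : Config} {x l r : ℤ} (h : IsGap η x l r) : mirror η x = r + l - x := by
  rw [SandFlip.mirror, if_pos h.self,
    nextOne_eq h.lt_right h.right fun z h1 h2 => h.active z (h.left_lt.trans h1) h2,
    prevOne_eq h.left_lt h.left fun z h1 h2 => h.active z h1 (h2.trans h.lt_right)]

theorem IsGap.isGap_mirror {η : Config} {x l r : ℤ} (h : IsGap η x l r) :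
    IsGap η (r + l - x) l r :=
  ⟨by have := h.lt_right; omega, by have := h.left_lt; omega, h.left, h.right, h.active⟩

theorem mirror_of_false {η : Config} {x : ℤ} (h : η x = false) : mirror η x = x := by
  rw [mirror, if_neg (by simp [h])]

theorem mirror_mirror {η : Config} (hη : η ∈ bothSided) (x : ℤ) : mirror η (mirror η x) = x := by
  cases hx : η x
  · rw [mirror_of_false hx, mirror_of_false hx]
  · obtain ⟨l, r, h⟩ := exists_isGap hη hx
    rw [h.mirror, h.isGap_mirror.mirror]; ring

theorem mirror_mem_sites {n : ℕ} {ξ : FinConfig} {x : ℤ} (hx : x ∈ sites n ξ) :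
    mirror ξ.1 x ∈ sites n ξ := by
  cases h : ξ.1 x
  · rwa [mirror_of_false h]
  · obtain ⟨l, r, h⟩ := exists_isGap ξ.mem_bothSided h
    rw [h.mirror, mem_sites]
    exact Or.inl h.isGap_mirror.self

/-- The avalanche that leaves the site `x` inactive. -/
def mirFin (x : ℤ) (ξ : FinConfig) : FinConfig := addFin (mirror ξ.1 x) ξ

/-- The mirror map is an involution of the jump sites. Indexing avalanches by the site left inactive
is what makes the coupling work: avalanches started at the same site of two ordered configurations
may leave different sites inactive and destroy the order. -/
theorem finGen_eq_mirror (α : ℝ) (n : ℕ) (h : FinConfig → ℝ) (ξ : FinConfig) :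
    finGen α n h ξ =
      ∑ x ∈ sites n ξ, (α * (h (mirFin x ξ) - h ξ) + (h (flipFin x ξ) - h ξ)) := by
  rw [finGen, Finset.sum_add_distrib, Finset.sum_add_distrib]
  congr 1
  refine Finset.sum_bij' (fun x _ => mirror ξ.1 x) (fun x _ => mirror ξ.1 x)
    (fun x hx => mirror_mem_sites hx) (fun x hx => mirror_mem_sites hx)
    (fun x _ => mirror_mirror ξ.mem_bothSided x) (fun x _ => mirror_mirror ξ.mem_bothSided x)
    fun x _ => ?_
  rw [mirFin, mirror_mirror ξ.mem_bothSided]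

theorem IsGap.mirFin_apply {ξ : FinConfig} {x l r : ℤ} (h : IsGap ξ.1 x l r) (y : ℤ) :
    (mirFin x ξ).1 y = if y = x then false else if y = l ∨ y = r then true else ξ.1 y := by
  change addOp (SandFlip.mirror ξ.1 x) ξ.1 y = _
  rw [h.mirror, h.isGap_mirror.addOp_apply, sub_sub_cancel]

theorem config_le_iff {η ξ : Config} : η ≤ ξ ↔ ∀ y, η y = true → ξ y = true :=
  forall_congr' fun _ => Bool.le_iff_imp

/-- The gap around `x` in the larger configuration contains the one in the smaller. Both
configurations lose the same site `x`, and the ends of the small gap, newly active below, are inner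
sites or ends of the large gap, hence active above. -/
theorem mirFin_le_mirFin {ξ ξ' : FinConfig} (h : ξ.1 ≤ ξ'.1) {x : ℤ} (hx : ξ.1 x = true) :
    (mirFin x ξ).1 ≤ (mirFin x ξ').1 := by
  rw [config_le_iff] at h
  obtain ⟨l, r, hg⟩ := exists_isGap ξ.mem_bothSided hx
  obtain ⟨l', r', hg'⟩ := exists_isGap ξ'.mem_bothSided (h x hx)
  have hinact : ∀ y, ξ'.1 y = false → ξ.1 y = false := fun y hy => by
    by_contra hne
    rw [h y (by simpa using hne)] at hy
    exact absurd hy (by simp)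
  have h1 := hg.le_left (hinact _ hg'.left) hg'.left_lt.le
  have h2 := hg.right_le (hinact _ hg'.right) hg'.lt_right.le
  have h3 := hg.left_lt
  have h4 := hg.lt_right
  rw [config_le_iff]
  intro y hy
  rw [hg.mirFin_apply] at hy
  rw [hg'.mirFin_apply]
  by_cases e1 : y = x
  · rw [if_pos e1] at hy; exact absurd hy (by simp)
  rw [if_neg e1] at hy ⊢
  by_cases e2 : y = l' ∨ y = r'
  · rw [if_pos e2]
  rw [if_neg e2]
  by_cases e3 : y = l ∨ y = r
  · exact hg'.active y (by omega) (by omega)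
  · rw [if_neg e3] at hy
    exact h y hy

theorem le_mirFin {ξ ξ' : FinConfig} (h : ξ.1 ≤ ξ'.1) {x : ℤ} (hx : ξ.1 x = false) :
    ξ.1 ≤ (mirFin x ξ').1 := by
  rw [config_le_iff] at h ⊢
  intro y hy
  cases hx' : ξ'.1 x
  · change addOp (mirror ξ'.1 x) ξ'.1 y = true
    rw [mirror_of_false hx', addOp_of_false hx', Function.update_apply]
    split_ifs
    · rfl
    · exact h y hy
  · obtain ⟨l', r', hg'⟩ := exists_isGap ξ'.mem_bothSided hx'
    rw [hg'.mirFin_apply]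
    split_ifs with e1 e2
    · rw [e1, hx] at hy; exact absurd hy (by simp)
    · rfl
    · exact h y hy

theorem flipFin_apply (x : ℤ) (ξ : FinConfig) (y : ℤ) :
    (flipFin x ξ).1 y = if y = x then !(ξ.1 x) else ξ.1 y :=
  flip_apply x ξ.1 y

theorem le_flipFin {ξ ξ' : FinConfig} (h : ξ.1 ≤ ξ'.1) {x : ℤ} (hx : ξ.1 x = false) :
    ξ.1 ≤ (flipFin x ξ').1 := by
  rw [config_le_iff] at h ⊢
  intro y hy
  rw [flipFin_apply]
  split_ifs with e1
  · rw [e1, hx] at hy; exact absurd hy (by simp)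
  · exact h y hy

theorem flipFin_le {ξ ξ' : FinConfig} (h : ξ.1 ≤ ξ'.1) {x : ℤ} (hx : ξ'.1 x = true) :
    (flipFin x ξ).1 ≤ ξ'.1 := by
  rw [config_le_iff] at h ⊢
  intro y hy
  rw [flipFin_apply] at hy
  split_ifs at hy with e1
  · rw [e1, hx]
  · exact h y hy

theorem flipFin_le_flipFin {ξ ξ' : FinConfig} (h : ξ.1 ≤ ξ'.1) {x : ℤ} (hx : ξ.1 x = ξ'.1 x) :
    (flipFin x ξ).1 ≤ (flipFin x ξ').1 := by
  rw [config_le_iff] at h ⊢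
  intro y hy
  rw [flipFin_apply] at hy ⊢
  split_ifs at hy ⊢ with e1
  · rw [← hx, hy]
  · exact h y hy

theorem mirFin_of_false {ξ : FinConfig} {x : ℤ} (hx : ξ.1 x = false) :
    mirFin x ξ = flipFin x ξ := by
  rw [mirFin, mirror_of_false hx]
  exact Subtype.ext (addOp_eq_flip hx)

theorem sites_subset {n n' : ℕ} (hn : n ≤ n') {ξ ξ' : FinConfig} (h : ξ.1 ≤ ξ'.1) :
    sites n ξ ⊆ sites n' ξ' := by
  intro x hx
  rw [mem_sites] at hx ⊢
  rcases hx with hx | hx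
  · exact Or.inl (config_le_iff.1 h x hx)
  · rw [Set.mem_Icc] at hx ⊢; right; omega

/-- An order-preserving coupling in generator form. At a site of equal heights where both chains may
jump, they jump together; elsewhere they jump separately, and each single jump keeps the order.
Separate jumps have joint rate up to `2 (1 + α)` per site, hence the factor two. -/
theorem finGen_sub_finGen_le {α : ℝ} (hα : 0 ≤ α) {n n' : ℕ} (hn : n ≤ n') {u y : FinConfig → ℝ}
    (huy : ∀ ζ ζ' : FinConfig, ζ.1 ≤ ζ'.1 → u ζ ≤ y ζ') {ξ ξ' : FinConfig} (h : ξ.1 ≤ ξ'.1) :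
    finGen α n u ξ - finGen α n' y ξ' + 2 * (1 + α) * (sites n' ξ').card * (u ξ - y ξ') ≤ 0 := by
  rw [finGen_eq_mirror, finGen_eq_mirror, ← Finset.inter_eq_right.2 (sites_subset hn h),
    ← Finset.sum_ite_mem, mul_comm (2 * (1 + α)), mul_assoc, ← nsmul_eq_mul, ← Finset.sum_const,
    ← Finset.sum_sub_distrib, ← Finset.sum_add_distrib]
  refine Finset.sum_nonpos fun x hx' => ?_
  have hw := huy _ _ h
  have hαw := mul_nonneg hα (sub_nonneg.2 hw)
  cases hx : ξ.1 x
  · have h1 := huy _ _ (le_mirFin h hx)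
    have h2 := huy _ _ (le_flipFin h hx)
    have h3 := mul_nonneg hα (sub_nonneg.2 h1)
    split_ifs with hs
    · rw [mirFin_of_false hx]
      cases hx2 : ξ'.1 x
      · rw [mirFin_of_false hx2]
        have h4 := huy _ _ (flipFin_le_flipFin h (hx.trans hx2.symm))
        have h5 := mul_nonneg hα (sub_nonneg.2 h4)
        linarith
      · have h4 := huy _ _ (flipFin_le h hx2)
        have h5 := mul_nonneg hα (sub_nonneg.2 h4)
        linarith
    · linarith
  · have hx2 := config_le_iff.1 h x hx
    rw [if_pos (mem_sites.2 (Or.inl hx))]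
    have h1 := huy _ _ (mirFin_le_mirFin h hx)
    have h2 := huy _ _ (flipFin_le_flipFin h (hx.trans hx2.symm))
    have h3 := mul_nonneg hα (sub_nonneg.2 h1)
    linarith

theorem finSemigroup_mono {α : ℝ} (hα : 0 ≤ α) {n n' : ℕ} (hn : n ≤ n') {g : Config → ℝ} {C : ℝ}
    (hg : ∀ ζ, |g ζ| ≤ C) (hmono : Monotone g) {T : ℝ} (hT : 0 ≤ T) (hT' : 4 * α * T ≤ 3 / 8)
    {ξ ξ' : FinConfig} (h : ξ.1 ≤ ξ'.1) : finSemigroup α n T g ξ ≤ finSemigroup α n' T g ξ' := by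
  have hC : 0 ≤ C := (abs_nonneg _).trans (hg ξ.1)
  -- The states are ordered pairs, and the Lyapunov function looks at the upper configuration. The
  -- constant `6 C` is the sum of the two bounds `3 C`.
  have key := maximum_principle (E := {p : FinConfig × FinConfig // p.1.1 ≤ p.2.1})
    (M := fun p => mass p.1.2) (q := fun p => 2 * (1 + α) * (sites n' p.1.2).card)
    (q0 := 2 * (1 + α) * (2 * n' + 1)) (c := 4 * (1 + α) * (2 * n' + 1)) (b := 4 * α) (K := 6 * C)
    (D := fun t p => finSemigroup α n t g p.1.1 - finSemigroup α n' t g p.1.2)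
    (D' := fun t p => finGen α n (finSemigroup α n t g) p.1.1 -
      finGen α n' (finSemigroup α n' t g) p.1.2)
    hT (by positivity) (by positivity) (by positivity) (fun p => ?_) (fun p => ?_) (fun p t ht => ?_)
    (fun p => ?_) (fun p t ht => ?_) ?_ ⟨(ξ, ξ'), h⟩ T ⟨hT, le_rfl⟩
  · exact sub_nonpos.1 key
  · rw [mul_assoc (2 * (1 + α))]
    exact mul_le_mul_of_nonneg_left (card_sites_le n' p.1.2) (by positivity)
  · exact ((finSemigroup_spec hα n hg p.1.1).2.2.1.sub
      (finSemigroup_spec hα n' hg p.1.2).2.2.1).mono fun t ht => ht.1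
  · exact ((finSemigroup_spec hα n hg p.1.1).2.2.2 t ht.1).fun_sub
      ((finSemigroup_spec hα n' hg p.1.2).2.2.2 t ht.1)
  · rw [(finSemigroup_spec hα n hg p.1.1).2.1, (finSemigroup_spec hα n' hg p.1.2).2.1]
    exact sub_nonpos.2 (hmono p.2)
  · have h1 := le_of_abs_le ((finSemigroup_spec hα n hg p.1.1).1 t ht.1)
    have h2 := neg_le_of_abs_le ((finSemigroup_spec hα n' hg p.1.2).1 t ht.1)
    have h3 := Real.one_le_exp (Nat.cast_nonneg (α := ℝ) (mass p.1.2))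
    nlinarith
  · intro A hA t ht hle p
    have h1 := finGen_lyap_le hα n' ht.1.le
      ((mul_le_mul_of_nonneg_left ht.2.le (by positivity)).trans hT') p.1.2
    have h2 := finGen_sub_finGen_le hα hn (u := finSemigroup α n t g)
      (y := fun ζ => finSemigroup α n' t g ζ +
        A * lyap mass (4 * (1 + α) * (2 * n' + 1)) (4 * α) t ζ)
      (fun ζ ζ' hζ => by
        have : finSemigroup α n t g ζ - finSemigroup α n' t g ζ' ≤
          A * lyap mass (4 * (1 + α) * (2 * n' + 1)) (4 * α) t ζ' := hle ⟨(ζ, ζ'), hζ⟩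
        linarith) p.2
    rw [finGen_add, finGen_const_mul] at h2
    have h3 := mul_le_mul_of_nonneg_left h1 hA
    have h4 : lyap (fun p : {p : FinConfig × FinConfig // p.1.1 ≤ p.2.1} => mass p.1.2)
      (4 * (1 + α) * (2 * n' + 1)) (4 * α) t p =
        lyap mass (4 * (1 + α) * (2 * n' + 1)) (4 * α) t p.1.2 := rfl
    rw [h4]
    linarith

/-! ### Exponential series -/

/-- The sum of `t ^ k c_k / k!`. -/
def expSeries (c : ℕ → ℝ) (t : ℝ) : ℝ := ∑' k : ℕ, t ^ k * c k / (k.factorial : ℝ)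

theorem abs_expSeries_term_le {c : ℕ → ℝ} {K ρ t : ℝ}
    (hc : ∀ k, |c k| ≤ K * k.factorial * ρ ^ k) (ht : 0 ≤ t) (k : ℕ) :
    |t ^ k * c k / (k.factorial : ℝ)| ≤ K * (t * ρ) ^ k := by
  have hk : (0 : ℝ) < k.factorial := Nat.cast_pos.2 k.factorial_pos
  rw [abs_div, abs_mul, abs_of_pos hk, abs_of_nonneg (pow_nonneg ht k), div_le_iff₀ hk, mul_pow]
  calc _ ≤ t ^ k * (K * k.factorial * ρ ^ k) :=
        mul_le_mul_of_nonneg_left (hc k) (pow_nonneg ht k)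
    _ = _ := by ring

theorem summable_geometric_mul {K ρ t : ℝ} (hρ : 0 ≤ ρ) (ht : 0 ≤ t) (htρ : t * ρ < 1) :
    Summable fun k : ℕ => K * (t * ρ) ^ k :=
  (summable_geometric_of_lt_one (mul_nonneg ht hρ) htρ).mul_left K

theorem summable_abs_expSeries {c : ℕ → ℝ} {K ρ t : ℝ}
    (hc : ∀ k, |c k| ≤ K * k.factorial * ρ ^ k) (hρ : 0 ≤ ρ) (ht : 0 ≤ t) (htρ : t * ρ < 1) :
    Summable fun k : ℕ => |t ^ k * c k / (k.factorial : ℝ)| :=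
  (summable_geometric_mul hρ ht htρ).of_nonneg_of_le (fun _ => abs_nonneg _)
    (abs_expSeries_term_le hc ht)

theorem abs_expSeries_le {c : ℕ → ℝ} {K ρ t : ℝ} (hc : ∀ k, |c k| ≤ K * k.factorial * ρ ^ k)
    (hρ : 0 ≤ ρ) (ht : 0 ≤ t) (htρ : t * ρ < 1) : |expSeries c t| ≤ K * (1 - t * ρ)⁻¹ := by
  rw [← Real.norm_eq_abs, ← tsum_geometric_of_lt_one (mul_nonneg ht hρ) htρ, ← tsum_mul_left]
  exact tsum_of_norm_bounded (summable_geometric_mul hρ ht htρ).hasSum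
    (abs_expSeries_term_le hc ht)

theorem expSeries_zero (c : ℕ → ℝ) : expSeries c 0 = c 0 := by
  rw [expSeries, tsum_eq_single 0 fun k hk => by simp [hk]]
  simp

/-- Termwise differentiation: for `|y| < r` with `r ρ < 1` the differentiated terms are dominated by
`K ρ k (r ρ)^{k-1}`. Cancelling `k` against `k!` shifts the coefficients by one. -/
theorem hasDerivAt_expSeries {c : ℕ → ℝ} {K ρ t : ℝ} (hc : ∀ k, |c k| ≤ K * k.factorial * ρ ^ k)
    (hρ : 0 ≤ ρ) (ht : |t| * ρ < 1) :
    HasDerivAt (expSeries c) (expSeries (fun k => c (k + 1)) t) t := by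
  obtain ⟨r, hr1, hr2⟩ : ∃ r, |t| < r ∧ r * ρ < 1 := by
    have h : ∀ᶠ r in 𝓝 |t|, r * ρ < 1 :=
      (continuous_mul_const ρ).continuousAt.eventually_lt_const ht
    obtain ⟨r, h1, h2⟩ := ((h.filter_mono nhdsWithin_le_nhds).and
      (self_mem_nhdsWithin : Set.Ioi |t| ∈ 𝓝[>] |t|)).exists
    exact ⟨r, h2, h1⟩
  have hr0 : 0 < r := (abs_nonneg t).trans_lt hr1
  have hx0 : 0 ≤ r * ρ := mul_nonneg hr0.le hρ
  have hsum : Summable fun k : ℕ => K * ρ * (k * (r * ρ) ^ (k - 1)) := by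
    refine Summable.mul_left _ ?_
    rw [← summable_nat_add_iff 1]
    have h1 := summable_pow_mul_geometric_of_norm_lt_one 1 (r := r * ρ)
      (by rwa [Real.norm_of_nonneg hx0])
    have h2 := summable_geometric_of_lt_one hx0 hr2
    refine (h1.add h2).congr fun k => ?_
    push_cast
    ring
  have hmem : ∀ y, y ∈ Metric.ball (0 : ℝ) r ↔ |y| < r := fun y => by simp
  have main := hasDerivAt_tsum_of_isPreconnected hsum Metric.isOpen_ball
    (convex_ball (0 : ℝ) r).isPreconnected
    (g := fun k y => y ^ k * c k / (k.factorial : ℝ))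
    (g' := fun k y => k * y ^ (k - 1) * c k / (k.factorial : ℝ)) (y₀ := 0) (y := t)
    (fun k y _ => ((hasDerivAt_pow k y).mul_const _).div_const _) (fun k y hy => ?_)
    (Metric.mem_ball_self hr0) (summable_of_ne_finset_zero (s := {0}) fun k hk => ?_)
    ((hmem t).2 hr1)
  · refine main.congr_deriv ?_
    have hs : Summable fun k : ℕ => (k : ℝ) * t ^ (k - 1) * c k / (k.factorial : ℝ) := by
      refine hsum.of_norm_bounded fun k => ?_
      have hk : (0 : ℝ) < k.factorial := Nat.cast_pos.2 k.factorial_pos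
      rw [Real.norm_eq_abs, abs_div, abs_mul, abs_mul, abs_of_pos hk, Nat.abs_cast, abs_pow,
        div_le_iff₀ hk]
      have h1 : |t| ^ (k - 1) ≤ r ^ (k - 1) := pow_le_pow_left₀ (abs_nonneg t) hr1.le _
      rcases k with _ | k
      · simp
      · rw [Nat.add_sub_cancel] at h1 ⊢
        calc _ ≤ ((k + 1 : ℕ) : ℝ) * r ^ k * (K * (k + 1).factorial * ρ ^ (k + 1)) := by
              refine mul_le_mul (mul_le_mul_of_nonneg_left h1 (by positivity)) (hc _)
                (abs_nonneg _) (by positivity)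
          _ = _ := by rw [mul_pow]; ring
    rw [hs.tsum_eq_zero_add, expSeries]
    simp only [Nat.cast_zero, zero_mul, zero_div, zero_add, Nat.add_sub_cancel]
    refine tsum_congr fun k => ?_
    rw [Nat.factorial_succ]
    push_cast
    field_simp
  · have hk : (0 : ℝ) < k.factorial := Nat.cast_pos.2 k.factorial_pos
    rw [hmem] at hy
    rw [Real.norm_eq_abs, abs_div, abs_mul, abs_mul, abs_of_pos hk, Nat.abs_cast, abs_pow,
      div_le_iff₀ hk]
    have h1 : |y| ^ (k - 1) ≤ r ^ (k - 1) := pow_le_pow_left₀ (abs_nonneg y) hy.le _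
    rcases k with _ | k
    · simp
    · rw [Nat.add_sub_cancel] at h1 ⊢
      calc _ ≤ ((k + 1 : ℕ) : ℝ) * r ^ k * (K * (k + 1).factorial * ρ ^ (k + 1)) := by
            refine mul_le_mul (mul_le_mul_of_nonneg_left h1 (by positivity)) (hc _)
              (abs_nonneg _) (by positivity)
        _ = _ := by rw [mul_pow]; ring
  · simp only [Finset.mem_singleton] at hk
    simp [hk]

/-! ### The series on finite configurations -/

theorem boxGen_finConfig (α : ℝ) (n : ℕ) (f : Config → ℝ) (ξ : FinConfig) :
    boxGen α (Set.Icc (-(n : ℤ)) n) f ξ.1 = finGen α n (fun ζ => f ζ.1) ξ := by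
  have hw : ∀ x, siteWeight (Set.Icc (-(n : ℤ)) n) ξ.1 x = if x ∈ sites n ξ then 1 else 0 := by
    intro x
    unfold siteWeight
    by_cases h : x ∈ sites n ξ
    · rw [if_pos h, if_pos (mem_sites.1 h)]
    · rw [if_neg h, if_neg (fun h1 => h (mem_sites.2 h1))]
  rw [boxGen, finGen, tsum_eq_sum (s := sites n ξ), tsum_eq_sum (s := sites n ξ), Finset.mul_sum,
    ← Finset.sum_add_distrib]
  · refine Finset.sum_congr rfl fun x hx => ?_
    rw [hw, if_pos hx, one_mul, one_mul]
    rfl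
  · intro x hx; rw [hw, if_neg hx, zero_mul]
  · intro x hx; rw [hw, if_neg hx, zero_mul]

/-- Each side of the box has `K + mass ξ + 1` sites, at most `mass ξ` of them active. -/
theorem enough_finConfig (K : ℕ) (ξ : FinConfig) :
    Enough K (-((K + mass ξ : ℕ) : ℤ) - 1) ((K + mass ξ : ℕ) : ℤ) ξ.1 := by
  have h : ∀ a b : ℤ, (b + 1 - a).toNat ≤ ones a b ξ.1 + mass ξ := by
    intro a b
    rw [← Int.card_Icc, ← Finset.card_filter_add_card_filter_not (fun y => ξ.1 y = false)]
    refine Nat.add_le_add_left (Finset.card_le_card fun y hy => ?_) _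
    rw [Finset.mem_filter] at hy
    exact mem_actives.2 (by simpa using hy.2)
  have h1 := h 0 ((K + mass ξ : ℕ) : ℤ)
  have h2 := h (-((K + mass ξ : ℕ) : ℤ) - 1) (-1)
  exact ⟨by omega, by omega⟩

/-- The box of `enough_finConfig` has `2 x` sites with `x = N + k + mass ξ + 1`, and `x^k ≤ k! e^x`.
The outcome grows like `exp (mass ξ)`, as the maximum principle allows, and the geometric rate does
not depend on `ξ`. -/
theorem abs_iterate_finConfig_le {α : ℝ} (hα : 0 ≤ α) (n : ℕ) {N : ℕ} {f : Config → ℝ} {C : ℝ}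
    (hf : LocalN N f) (hC : ∀ ζ, |f ζ| ≤ C) (ξ : FinConfig) (k : ℕ) :
    |(boxGen α (Set.Icc (-(n : ℤ)) n))^[k] f ξ.1| ≤
      C * Real.exp (N + 1 + mass ξ) * k.factorial * (4 * (1 + α) * Real.exp 1) ^ k := by
  have h := abs_iterate_le hα (Set.Icc (-(n : ℤ)) n) k hf (fun ζ _ _ => hC ζ) ξ.1
    ξ.mem_bothSided (enough_finConfig (N + k) ξ)
  have hC0 : 0 ≤ C := (abs_nonneg _).trans (hC ξ.1)
  have hk : (0 : ℝ) < k.factorial := Nat.cast_pos.2 k.factorial_pos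
  have h1 := Real.pow_div_factorial_le_exp ((N : ℝ) + k + mass ξ + 1) (by positivity) k
  rw [div_le_iff₀ hk] at h1
  calc _ ≤ C * ((4 * (1 + α)) ^ k * ((N : ℝ) + k + mass ξ + 1) ^ k) := by
        refine h.trans_eq ?_
        rw [← mul_pow]
        push_cast
        ring
    _ ≤ C * ((4 * (1 + α)) ^ k * (Real.exp ((N : ℝ) + k + mass ξ + 1) * k.factorial)) := by gcongr
    _ = _ := by
        rw [show (N : ℝ) + k + mass ξ + 1 = (N + 1 + mass ξ) + k * 1 by ring, Real.exp_add,
          Real.exp_nat_mul, mul_pow (4 * (1 + α))]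
        ring

theorem finGen_expSeries {α : ℝ} (n : ℕ) {c : FinConfig → ℕ → ℝ} {t : ℝ}
    (hs : ∀ ζ, Summable fun k : ℕ => t ^ k * c ζ k / (k.factorial : ℝ)) (ξ : FinConfig) :
    finGen α n (fun ζ => expSeries (c ζ) t) ξ =
      expSeries (fun k => finGen α n (fun ζ => c ζ k) ξ) t := by
  have h : HasSum (fun k : ℕ => ∑ x ∈ sites n ξ,
      (α * (t ^ k * c (addFin x ξ) k / (k.factorial : ℝ) - t ^ k * c ξ k / (k.factorial : ℝ)) +
        (t ^ k * c (flipFin x ξ) k / (k.factorial : ℝ) - t ^ k * c ξ k / (k.factorial : ℝ))))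
      (finGen α n (fun ζ => expSeries (c ζ) t) ξ) :=
    hasSum_sum fun x _ => (((hs _).hasSum.sub (hs _).hasSum).mul_left α).add
      ((hs _).hasSum.sub (hs _).hasSum)
  rw [← h.tsum_eq, expSeries]
  refine tsum_congr fun k => ?_
  rw [finGen, Finset.mul_sum, Finset.sum_div]
  exact Finset.sum_congr rfl fun x _ => by ring

/-- On finite configurations the semigroup is given by the exponential series. -/
theorem finSemigroup_eq_expSeries {α : ℝ} (hα : 0 ≤ α) (n : ℕ) {N : ℕ} {f : Config → ℝ} {C : ℝ}
    (hf : LocalN N f) (hC : ∀ ζ, |f ζ| ≤ C) {T : ℝ} (hT : 0 ≤ T)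
    (hT' : T * (4 * (1 + α) * Real.exp 1) < 1) (ξ : FinConfig) :
    finSemigroup α n T f ξ =
      expSeries (fun k => (boxGen α (Set.Icc (-(n : ℤ)) n))^[k] f ξ.1) T := by
  set B := Set.Icc (-(n : ℤ)) (n : ℤ) with hB
  set ρ := 4 * (1 + α) * Real.exp 1 with hρ
  have hρ0 : 0 ≤ ρ := by positivity
  have hC0 : 0 ≤ C := (abs_nonneg _).trans (hC ξ.1)
  -- Because `e > 8 / 3`, the horizon of the series lies within the horizon of the Lyapunov
  -- function.
  have h38 : 4 * α * T ≤ 3 / 8 := by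
    have h1 := Real.exp_one_gt_d9
    have h2 : T * (4 * (1 + α)) * (8 / 3) ≤ T * (4 * (1 + α)) * Real.exp 1 :=
      mul_le_mul_of_nonneg_left (by linarith) (by positivity)
    rw [hρ] at hT'
    nlinarith
  set c : FinConfig → ℕ → ℝ := fun ζ k => (boxGen α B)^[k] f ζ.1 with hc
  have hbd : ∀ ζ k, |c ζ k| ≤ C * Real.exp (N + 1 + mass ζ) * k.factorial * ρ ^ k :=
    fun ζ k => abs_iterate_finConfig_le hα n hf hC ζ k
  have htρ : ∀ t ∈ Set.Icc 0 T, t * ρ < 1 := fun t ht =>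
    (mul_le_mul_of_nonneg_right ht.2 hρ0).trans_lt hT'
  have hder : ∀ ζ, ∀ t ∈ Set.Icc 0 T, HasDerivAt (fun t => expSeries (c ζ) t)
      (finGen α n (fun ζ => expSeries (c ζ) t) ζ) t := by
    intro ζ t ht
    refine (hasDerivAt_expSeries (hbd ζ) hρ0 ?_).congr_deriv ?_
    · rw [abs_of_nonneg ht.1]; exact htρ t ht
    · rw [finGen_expSeries]
      · congr 1
        funext k
        simp only [hc, Function.iterate_succ_apply']
        exact boxGen_finConfig α n _ ζ
      · exact fun ζ => (summable_abs_expSeries (hbd ζ) hρ0 ht.1 (htρ t ht)).of_abs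
  have hgrow : ∀ ζ, ∀ t ∈ Set.Icc 0 T, |expSeries (c ζ) t - finSemigroup α n t f ζ| ≤
      (C * Real.exp (N + 1) * (1 - T * ρ)⁻¹ + 3 * C) * Real.exp (mass ζ) := by
    intro ζ t ht
    have h1 := abs_expSeries_le (hbd ζ) hρ0 ht.1 (htρ t ht)
    have h2 := (finSemigroup_spec hα n hC ζ).1 t ht.1
    have h3 : (1 - t * ρ)⁻¹ ≤ (1 - T * ρ)⁻¹ :=
      inv_anti₀ (by linarith) (by nlinarith [mul_le_mul_of_nonneg_right ht.2 hρ0])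
    have h4 := Real.one_le_exp (Nat.cast_nonneg (α := ℝ) (mass ζ))
    have h5 : C * Real.exp (N + 1 + mass ζ) * (1 - t * ρ)⁻¹ ≤
        C * Real.exp (N + 1 + mass ζ) * (1 - T * ρ)⁻¹ :=
      mul_le_mul_of_nonneg_left h3 (by positivity)
    rw [Real.exp_add] at h1 h5
    have h6 : 3 * C ≤ 3 * C * Real.exp (mass ζ) := le_mul_of_one_le_right (by positivity) h4
    refine (abs_sub _ _).trans ?_
    linarith
  have hcont : ∀ ζ, ContinuousOn (fun t => expSeries (c ζ) t) (Set.Icc 0 T) := fun ζ t ht =>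
    (hder ζ t ht).continuousAt.continuousWithinAt
  have hcont' : ∀ ζ, ContinuousOn (fun t => finSemigroup α n t f ζ) (Set.Icc 0 T) := fun ζ =>
    (finSemigroup_spec hα n hC ζ).2.2.1.mono Set.Icc_subset_Ici_self
  have h0 : ∀ ζ, expSeries (c ζ) 0 = finSemigroup α n 0 f ζ := fun ζ => by
    rw [expSeries_zero, (finSemigroup_spec hα n hC ζ).2.1]; rfl
  have hmem : T ∈ Set.Icc 0 T := ⟨hT, le_rfl⟩
  refine le_antisymm (sub_nonpos.1 ?_) (sub_nonpos.1 ?_)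
  · refine le_zero_of_backward hα n hT h38
      (D := fun t ζ => finSemigroup α n t f ζ - expSeries (c ζ) t)
      (fun ζ => (hcont' ζ).sub (hcont ζ)) (fun ζ t ht => ?_) (fun ζ => ?_)
      (fun ζ t ht => (le_abs_self _).trans ((abs_sub_comm _ _).trans_le (hgrow ζ t ht))) ξ T hmem
    · rw [finGen_sub]
      exact ((finSemigroup_spec hα n hC ζ).2.2.2 t ht.1).fun_sub
        (hder ζ t (Set.Ioo_subset_Icc_self ht))
    · rw [h0, sub_self]
  · refine le_zero_of_backward hα n hT h38
      (D := fun t ζ => expSeries (c ζ) t - finSemigroup α n t f ζ)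
      (fun ζ => (hcont ζ).sub (hcont' ζ)) (fun ζ t ht => ?_) (fun ζ => ?_)
      (fun ζ t ht => (le_abs_self _).trans (hgrow ζ t ht)) ξ T hmem
    · rw [finGen_sub]
      exact (hder ζ t (Set.Ioo_subset_Icc_self ht)).fun_sub
        ((finSemigroup_spec hα n hC ζ).2.2.2 t ht.1)
    · rw [h0, sub_self]

/-! ### Growth of the iterates at decent configurations -/

theorem exists_span_pow_le {α : ℝ} (hα : 0 ≤ α) {η : Config} (hη : η ∈ decent) {a : ℝ}
    (ha : (meanGap η).toReal < a) (N : ℕ) :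
    ∃ K : ℝ, 0 ≤ K ∧ ∀ k : ℕ, (2 * (1 + α) * ((span η (N + k) : ℝ) + 1)) ^ k ≤
      K * k.factorial * (4 * (1 + α) * Real.exp 1 * a) ^ k := by
  have ha0 : 0 < a := ENNReal.toReal_nonneg.trans_lt ha
  have hspan : ∀ k, (0 : ℝ) ≤ span η k := fun k => by
    have := (enough_onePos hη.1 k).le
    exact_mod_cast (by unfold span; omega : (0 : ℤ) ≤ span η k)
  have hρ : 0 < 4 * (1 + α) * Real.exp 1 * a := by positivity
  have hev : ∀ᶠ k : ℕ in atTop, (2 * (1 + α) * ((span η (N + k) : ℝ) + 1)) ^ k /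
      (k.factorial * (4 * (1 + α) * Real.exp 1 * a) ^ k) ≤ Real.exp N := by
    have h1 := (tendsto_add_atTop_nat N).eventually (eventually_span_le hη ha)
    filter_upwards [h1] with k hk
    rw [add_comm k N] at hk
    have hfac : (0 : ℝ) < k.factorial := Nat.cast_pos.2 k.factorial_pos
    rw [div_le_iff₀ (by positivity)]
    -- The inequality `(N + k)^k ≤ k! e^{N + k}` is the source of `e` in the radius of convergence.
    have h2 := Real.pow_div_factorial_le_exp ((N + k : ℕ) : ℝ) (by positivity) k
    rw [div_le_iff₀ hfac] at h2
    calc _ ≤ (2 * (1 + α) * (2 * a * ((N + k : ℕ) : ℝ))) ^ k := by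
          have := hspan (N + k)
          gcongr
      _ = (4 * (1 + α) * a) ^ k * ((N + k : ℕ) : ℝ) ^ k := by rw [← mul_pow]; ring
      _ ≤ (4 * (1 + α) * a) ^ k * (Real.exp ((N + k : ℕ) : ℝ) * k.factorial) := by gcongr
      _ = _ := by
          rw [Nat.cast_add, Real.exp_add, ← mul_one (k : ℝ), Real.exp_nat_mul,
            show 4 * (1 + α) * Real.exp 1 * a = 4 * (1 + α) * a * Real.exp 1 by ring,
            mul_pow (4 * (1 + α) * a) (Real.exp 1)]
          ring
  -- The finitely many exceptional `k` are absorbed into the constant.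
  obtain ⟨K, hK⟩ := (isBoundedUnder_of_eventually_le hev).bddAbove_range
  refine ⟨max K 0, le_max_right _ _, fun k => ?_⟩
  have hfac : (0 : ℝ) < k.factorial := Nat.cast_pos.2 k.factorial_pos
  have h1 := (hK ⟨k, rfl⟩).trans (le_max_left K 0)
  rw [div_le_iff₀ (by positivity)] at h1
  rwa [mul_assoc (max K 0)]

/-- Uniform bound for all generators and all configurations below `η`. -/
theorem abs_iterate_le_of_le {α : ℝ} (hα : 0 ≤ α) {η ζ : Config} (hη : η ∈ bothSided)
    (hζ : ζ ∈ bothSided) (hle : ζ ≤ η) (B : Set ℤ) {N : ℕ} {f : Config → ℝ} {C K ρ : ℝ}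
    (hf : LocalN N f) (hC : ∀ ζ, |f ζ| ≤ C)
    (hK : ∀ k : ℕ, (2 * (1 + α) * ((span η (N + k) : ℝ) + 1)) ^ k ≤ K * k.factorial * ρ ^ k)
    (k : ℕ) : |(boxGen α B)^[k] f ζ| ≤ C * K * k.factorial * ρ ^ k := by
  have hC0 : 0 ≤ C := (abs_nonneg _).trans (hC ζ)
  have h := abs_iterate_le hα B k hf (fun ζ _ _ => hC ζ) ζ hζ
    ((enough_onePos hη (N + k)).mono le_rfl le_rfl hle)
  refine h.trans ((mul_le_mul_of_nonneg_left ?_ hC0).trans_eq (by ring)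
    (b := C * (K * k.factorial * ρ ^ k)))
  refine (hK k).trans' (le_of_eq ?_)
  rw [span]
  push_cast
  ring

/-! ### Cut-off configurations -/

/-- The configuration that agrees with `η` on `[-m, m]` and has height one elsewhere. -/
def cut (m : ℕ) (η : Config) : FinConfig :=
  ⟨fun x => decide (-(m : ℤ) ≤ x ∧ x ≤ m) && η x, (Set.finite_Icc (-(m : ℤ)) m).subset fun x hx => by
    simp only [Set.mem_ofPred_eq, Bool.and_eq_true, decide_eq_true_eq] at hx
    exact hx.1⟩

theorem cut_apply {m : ℕ} {η : Config} {x : ℤ} (hx : x ∈ Set.Icc (-(m : ℤ)) m) :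
    (cut m η).1 x = η x := by
  have hx' : -(m : ℤ) ≤ x ∧ x ≤ m := hx
  simp [cut, hx']

theorem cut_apply_eq_true {m : ℕ} {η : Config} {x : ℤ} :
    (cut m η).1 x = true ↔ x ∈ Set.Icc (-(m : ℤ)) m ∧ η x = true := by
  simp [cut, and_assoc]

theorem cut_le (m : ℕ) (η : Config) : (cut m η).1 ≤ η :=
  config_le_iff.2 fun _ hy => (cut_apply_eq_true.1 hy).2

theorem cut_mono {m m' : ℕ} (h : m ≤ m') (η : Config) : (cut m η).1 ≤ (cut m' η).1 := by
  refine config_le_iff.2 fun y hy => ?_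
  rw [cut_apply_eq_true, Set.mem_Icc] at hy ⊢
  exact ⟨by omega, hy.2⟩

theorem exists_le_cut {η : Config} (ξ : FinConfig) (h : ξ.1 ≤ η) : ∃ m, ∀ m', m ≤ m' →
    ξ.1 ≤ (cut m' η).1 := by
  refine ⟨(actives ξ).sup Int.natAbs, fun m' hm => config_le_iff.2 fun y hy => ?_⟩
  have := Finset.le_sup (f := Int.natAbs) (mem_actives.2 hy)
  rw [cut_apply_eq_true, Set.mem_Icc]
  exact ⟨by omega, config_le_iff.1 h y hy⟩

/-! ### Convergence of the chains -/

theorem tendsto_finSemigroup_cut {α : ℝ} (hα : 0 ≤ α) {η : Config} (hη : η ∈ bothSided) {N : ℕ}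
    {f : Config → ℝ} {C K ρ T : ℝ} (hf : LocalN N f) (hC : ∀ ζ, |f ζ| ≤ C)
    (hK : ∀ k : ℕ, (2 * (1 + α) * ((span η (N + k) : ℝ) + 1)) ^ k ≤ K * k.factorial * ρ ^ k)
    (hρ : 0 ≤ ρ) (hT : 0 ≤ T) (hT' : T * (4 * (1 + α) * Real.exp 1) < 1) (hTρ : T * ρ < 1) :
    Tendsto (fun m => finSemigroup α m T f (cut m η)) atTop
      (𝓝 (expSeries (fun k => (generator α)^[k] f η) T)) := by
  simp_rw [finSemigroup_eq_expSeries hα _ hf hC hT hT', expSeries, ← boxGen_univ]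
  refine tendsto_tsum_of_dominated_convergence (summable_geometric_mul (K := C * K) hρ hT hTρ)
    (fun k => ?_) (Eventually.of_forall fun m k => ?_)
  -- As soon as `[-m, m]` holds more than `N + k` ones of `η` on either side, the `k`-th coefficient
  -- feels neither the cut-off nor the restriction of births.
  · refine tendsto_const_nhds.congr' ?_
    obtain ⟨R, hR⟩ := exists_enough hη (N + k)
    filter_upwards [eventually_ge_atTop R] with m hm
    have hag : ∀ z ∈ Set.Icc (-(m : ℤ)) m, η z = (cut m η).1 z := fun z hz => (cut_apply hz).symm
    have hE : Enough (N + k) (-(m : ℤ)) m η := hR.mono (by omega) (by omega) le_rfl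
    rw [(hf.iterate α Set.univ k) η hη (cut m η).1 (cut m η).mem_bothSided _ _ hE hag,
      iterate_eq_on_box α (B := Set.univ) (B' := Set.Icc (-(m : ℤ)) m) (a := -(m : ℤ)) (b := m)
        (fun x hx => ⟨fun _ => hx, fun _ => trivial⟩) k hf hf (fun _ _ _ => rfl) _
        (cut m η).mem_bothSided (hE.congr hag)]
  · exact abs_expSeries_term_le (abs_iterate_le_of_le hα hη (cut m η).mem_bothSided (cut_le m η) _
      hf hC hK) hT k

/-! ### Local functions -/

theorem IsLocal.continuous {f : Config → ℝ} (hf : IsLocal f) : Continuous f := by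
  classical
  obtain ⟨F, hF⟩ := hf
  let h : (F → Bool) → ℝ := fun w => f fun x => if hx : x ∈ F then w ⟨x, hx⟩ else false
  have : f = h ∘ fun η x => η x.1 := by
    funext η
    exact hF _ _ fun x hx => by simp [hx]
  rw [this]
  exact continuous_of_discreteTopology.comp (by fun_prop)

theorem IsLocal.exists_localN {f : Config → ℝ} (hf : IsLocal f) : ∃ N, LocalN N f := by
  obtain ⟨F, hF⟩ := hf
  refine ⟨F.sup Int.natAbs, fun η _ ξ _ a b hE hag => hF _ _ fun x hx => hag x ?_⟩
  have h1 := Finset.le_sup (f := Int.natAbs) hx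
  have h2 := hE.le
  exact ⟨by omega, by omega⟩

theorem abs_le_of_monotone {f : Config → ℝ} (hf : Monotone f) (ζ : Config) :
    |f ζ| ≤ max |f ⊥| |f ⊤| := by
  have h1 := hf (bot_le (a := ζ))
  have h2 := hf (le_top (a := ζ))
  exact abs_le_max_abs_abs h1 h2

/-! ### The laws of the chains and the law of the process -/

theorem boxGen_const (α : ℝ) (B : Set ℤ) (r : ℝ) : boxGen α B (fun _ => r) = fun _ => 0 := by
  funext η
  simp [boxGen]

theorem iterate_boxGen_zero (α : ℝ) (B : Set ℤ) (k : ℕ) :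
    (boxGen α B)^[k] (fun _ => 0) = fun _ => 0 :=
  Function.iterate_fixed (boxGen_const α B 0) k

theorem localN_const (N : ℕ) (r : ℝ) : LocalN N fun _ => r := fun _ _ _ _ _ _ _ _ => rfl

/-- The law of the chain at time `t`. -/
def chainLaw (α : ℝ) (n : ℕ) (t : ℝ) (ξ : FinConfig) : Measure Config :=
  Measure.sum fun ζ : FinConfig => trans (rate α n) t ξ ζ • Measure.dirac ζ.1

/-- Absence of explosion: for the constant function one, only the zeroth term of the exponential
series survives, so the total mass is one. -/
theorem isProbabilityMeasure_chainLaw {α : ℝ} (hα : 0 ≤ α) (n : ℕ) {T : ℝ} (hT : 0 ≤ T)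
    (hT' : T * (4 * (1 + α) * Real.exp 1) < 1) (ξ : FinConfig) :
    IsProbabilityMeasure (chainLaw α n T ξ) := by
  have h := finSemigroup_eq_expSeries hα n (localN_const 0 1) (C := 1) (fun _ => by simp) hT hT' ξ
  rw [expSeries, tsum_eq_single 0 fun k hk => ?_] at h
  · have hq : ∀ i, ∑' l, rate α n i l ≠ ∞ := fun i => by
      have := tsum_rate_mul hα n i 1
      simp only [Pi.one_apply, mul_one] at this
      rw [this]
      exact (ENNReal.sum_lt_top.2 fun _ _ => ENNReal.ofReal_lt_top).ne
    have hle : ∑' ζ, trans (rate α n) T ξ ζ ≤ 1 := by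
      simpa using tsum_trans_le hq (g := 1) (C := 1) (fun _ => le_rfl) hT ξ
    have hne : ∑' ζ, trans (rate α n) T ξ ζ ≠ ∞ := (hle.trans_lt ENNReal.one_lt_top).ne
    constructor
    rw [chainLaw, Measure.sum_apply _ MeasurableSet.univ]
    simp only [Measure.smul_apply, measure_univ, smul_eq_mul, mul_one]
    rw [← ENNReal.toReal_eq_one_iff, ENNReal.tsum_toReal_eq fun ζ => ENNReal.ne_top_of_tsum_ne_top hne ζ]
    simpa [finSemigroup] using h
  · obtain ⟨j, rfl⟩ := Nat.exists_eq_succ_of_ne_zero hk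
    rw [Function.iterate_succ_apply, boxGen_const, iterate_boxGen_zero]
    simp

theorem integral_chainLaw {α : ℝ} {n : ℕ} {T : ℝ} {ξ : FinConfig}
    [IsProbabilityMeasure (chainLaw α n T ξ)] {f : Config → ℝ} (hf : Measurable f) {C : ℝ}
    (hC : ∀ ζ, |f ζ| ≤ C) : ∫ ζ, f ζ ∂(chainLaw α n T ξ) = finSemigroup α n T f ξ := by
  have hint : Integrable f (chainLaw α n T ξ) :=
    Integrable.of_bound hf.aestronglyMeasurable C (Eventually.of_forall hC)
  rw [chainLaw, integral_sum_measure hint, finSemigroup]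
  refine tsum_congr fun ζ => ?_
  rw [integral_smul_measure, integral_dirac, smul_eq_mul]

/-- `Config` is compact, so the laws of the cut-off chains have a cluster point, whose integrals of
local functions are the limits already computed. Every pair of a birth box and a starting point
below `η` is dominated by a member of the diagonal sequence, so for monotone functions the limit is
the supremum. -/
theorem exists_isLaw {α : ℝ} (hα : 0 ≤ α) {η : Config} (hη : η ∈ decent) {a : ℝ}
    (ha : (meanGap η).toReal < a) {T : ℝ} (hT : 0 ≤ T)
    (hTa : T * (4 * (1 + α) * Real.exp 1 * a) < 1) :
    ∃ μ, IsLaw α T η μ ∧ ∀ g : Config → ℝ, IsLocal g → ∀ C, (∀ ζ, |g ζ| ≤ C) →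
      ∫ ζ, g ζ ∂μ = expSeries (fun k => (generator α)^[k] g η) T := by
  have ha1 : 1 ≤ a := by
    refine le_trans ?_ ha.le
    have := ENNReal.toReal_mono hη.2.ne (one_le_meanGap hη.1)
    simpa using this
  have hρ0 : 0 ≤ 4 * (1 + α) * Real.exp 1 * a := by positivity
  have hT' : T * (4 * (1 + α) * Real.exp 1) < 1 := by
    refine (mul_le_mul_of_nonneg_left ?_ hT).trans_lt hTa
    exact le_mul_of_one_le_right (by positivity) ha1
  have h38 : 4 * α * T ≤ 3 / 8 := by
    have h1 := Real.exp_one_gt_d9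
    have h2 : T * (4 * (1 + α)) * (8 / 3) ≤ T * (4 * (1 + α)) * Real.exp 1 :=
      mul_le_mul_of_nonneg_left (by linarith) (by positivity)
    nlinarith
  have hconv : ∀ g : Config → ℝ, IsLocal g → ∀ C, (∀ ζ, |g ζ| ≤ C) →
      Tendsto (fun m => finSemigroup α m T g (cut m η)) atTop
        (𝓝 (expSeries (fun k => (generator α)^[k] g η) T)) := by
    intro g hg C hC
    obtain ⟨N, hN⟩ := hg.exists_localN
    obtain ⟨K, _, hK⟩ := exists_span_pow_le hα hη ha N
    exact tendsto_finSemigroup_cut hα hη.1 hN hC hK hρ0 hT hT' hTa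
  have hprob : ∀ m, IsProbabilityMeasure (chainLaw α m T (cut m η)) := fun m =>
    isProbabilityMeasure_chainLaw hα m hT hT' _
  let ν : ℕ → ProbabilityMeasure Config := fun m => ⟨chainLaw α m T (cut m η), hprob m⟩
  obtain ⟨μ, hμ⟩ := exists_clusterPt_of_compactSpace (map ν atTop)
  have hint : ∀ g : Config → ℝ, IsLocal g → ∀ C, (∀ ζ, |g ζ| ≤ C) →
      ∫ ζ, g ζ ∂(μ : Measure Config) = expSeries (fun k => (generator α)^[k] g η) T := by
    intro g hg C hC
    have hcont := ProbabilityMeasure.continuous_integral_boundedContinuousFunction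
      (BoundedContinuousFunction.mkOfCompact ⟨g, hg.continuous⟩)
    have h1 := MapClusterPt.tendsto_comp (hcont.tendsto μ) hμ
    have h2 : Tendsto ((fun μ : ProbabilityMeasure Config => ∫ ζ,
        (BoundedContinuousFunction.mkOfCompact ⟨g, hg.continuous⟩) ζ ∂(μ : Measure Config)) ∘ ν) atTop
        (𝓝 (expSeries (fun k => (generator α)^[k] g η) T)) :=
      (hconv g hg C hC).congr fun m =>
        (@integral_chainLaw α m T _ (hprob m) g hg.continuous.measurable C hC).symm
    have h3 : ClusterPt _ (𝓝 (expSeries (fun k => (generator α)^[k] g η) T)) := ClusterPt.mono h1 h2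
    exact @eq_of_nhds_neBot _ _ _ _ _ h3
  refine ⟨μ, ⟨inferInstance, fun g hg hmono => ?_⟩, hint⟩
  have hC := abs_le_of_monotone hmono
  rw [hint g hg _ hC]
  have hseq : Monotone fun m => finSemigroup α m T g (cut m η) := fun m m' h =>
    finSemigroup_mono hα h hC hmono hT h38 (cut_mono h η)
  have hlub := isLUB_of_tendsto_atTop hseq (hconv g hg _ hC)
  constructor
  · rintro _ ⟨n, ξ, hξ, rfl⟩
    obtain ⟨m, hm⟩ := exists_le_cut ξ hξ
    exact (finSemigroup_mono hα (le_max_left n m) hC hmono hT h38 (hm _ (le_max_right n m))).trans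
      (hlub.1 ⟨max n m, rfl⟩)
  · intro r hr
    refine hlub.2 ?_
    rintro _ ⟨m, rfl⟩
    exact hr ⟨m, cut m η, cut_le m η, rfl⟩

/-- On local functions the law is given by the exponential series. -/
theorem law_spec {α : ℝ} (hα : 0 ≤ α) {η : Config} (hη : η ∈ decent) {a : ℝ}
    (ha : (meanGap η).toReal < a) {T : ℝ} (hT : 0 ≤ T)
    (hTa : T * (4 * (1 + α) * Real.exp 1 * a) < 1) :
    IsProbabilityMeasure (law α T η) ∧ ∀ g : Config → ℝ, IsLocal g → ∀ C, (∀ ζ, |g ζ| ≤ C) →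
      ∫ ζ, g ζ ∂(law α T η) = expSeries (fun k => (generator α)^[k] g η) T := by
  obtain ⟨μ, hμ, hint⟩ := exists_isLaw hα hη ha hT hTa
  have hex : ∃ μ, IsLaw α T η μ := ⟨μ, hμ⟩
  have h : law α T η = μ := by
    rw [law, dif_pos hex]
    exact hex.choose_spec.unique hμ
  rw [h]
  exact ⟨hμ.prob, hint⟩

/-! ### The law is carried by `Ω'` -/

/-- The `g R` share the same `N` and `C`, hence the same dominating geometric series, and for each
`k` the coefficients agree once `R` is large. -/
theorem tendsto_expSeries_generator {α : ℝ} (hα : 0 ≤ α) {η : Config} (hη : η ∈ bothSided) {N : ℕ}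
    {g : ℕ → Config → ℝ} {f : Config → ℝ} {C K ρ T : ℝ} (hg : ∀ R, LocalN N (g R))
    (hf : LocalN N f) (hC : ∀ R ζ, |g R ζ| ≤ C)
    (hgf : ∀ R : ℕ, ∀ ζ ∈ bothSided, Enough N (-(R : ℤ)) R ζ → g R ζ = f ζ)
    (hK : ∀ k : ℕ, (2 * (1 + α) * ((span η (N + k) : ℝ) + 1)) ^ k ≤ K * k.factorial * ρ ^ k)
    (hρ : 0 ≤ ρ) (hT : 0 ≤ T) (hTρ : T * ρ < 1) :
    Tendsto (fun R => expSeries (fun k => (generator α)^[k] (g R) η) T) atTop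
      (𝓝 (expSeries (fun k => (generator α)^[k] f η) T)) := by
  simp_rw [expSeries, ← boxGen_univ]
  refine tendsto_tsum_of_dominated_convergence (summable_geometric_mul (K := C * K) hρ hT hTρ)
    (fun k => ?_) (Eventually.of_forall fun R k => ?_)
  · refine tendsto_const_nhds.congr' ?_
    obtain ⟨R₀, hR₀⟩ := exists_enough hη (N + k)
    filter_upwards [eventually_ge_atTop R₀] with R hR
    rw [iterate_eq_on_box α (fun _ _ => Iff.rfl) k (hg R) hf (hgf R) η hη
      (hR₀.mono (by omega) (by omega) le_rfl)]
  · exact abs_expSeries_term_le (abs_iterate_le_of_le hα hη hη le_rfl _ (hg R) (hC R) hK) hT k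

open Classical in
/-- The indicator that `[-R, R]` has at most `N` sites of height one on one side of the origin. -/
def scarce (N R : ℕ) (ζ : Config) : ℝ := if Enough N (-(R : ℤ)) R ζ then 0 else 1

theorem scarce_congr {N R : ℕ} {η ξ : Config}
    (h : Enough N (-(R : ℤ)) R η ↔ Enough N (-(R : ℤ)) R ξ) : scarce N R η = scarce N R ξ := by
  classical
  exact if_congr h rfl rfl

theorem isLocal_scarce (N R : ℕ) : IsLocal (scarce N R) := by
  refine ⟨Finset.Icc (-(R : ℤ)) R, fun η ξ h => scarce_congr ?_⟩
  have h' : ∀ z ∈ Set.Icc (-(R : ℤ)) R, η z = ξ z := fun z hz => h z (Finset.mem_Icc.2 hz)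
  exact ⟨fun hE => hE.congr h', fun hE => hE.congr fun z hz => (h' z hz).symm⟩

theorem lt_ones_congr {N : ℕ} {b c : ℤ} {η ξ : Config} (hb : N < ones 0 b η)
    (hag : ∀ z ∈ Set.Icc 0 b, η z = ξ z) (h : N < ones 0 c η) : N < ones 0 c ξ := by
  rcases le_total b c with hbc | hbc
  · exact (hb.trans_eq (ones_congr hag)).trans_le (ones_mono le_rfl hbc le_rfl)
  · exact h.trans_eq (ones_congr fun z hz => hag z ⟨hz.1, hz.2.trans hbc⟩)

theorem lt_ones_congr_left {N : ℕ} {a c : ℤ} {η ξ : Config} (ha : N < ones a (-1) η)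
    (hag : ∀ z ∈ Set.Icc a (-1), η z = ξ z) (h : N < ones c (-1) η) : N < ones c (-1) ξ := by
  rcases le_total c a with hca | hca
  · exact (ha.trans_eq (ones_congr hag)).trans_le (ones_mono hca le_rfl le_rfl)
  · exact h.trans_eq (ones_congr fun z hz => hag z ⟨hca.trans hz.1, hz.2⟩)

theorem Enough.congr_of_enough {N : ℕ} {a b a' b' : ℤ} {η ξ : Config} (hE : Enough N a b η)
    (hag : ∀ z ∈ Set.Icc a b, η z = ξ z) (h : Enough N a' b' η) : Enough N a' b' ξ := by
  have hle := hE.le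
  exact ⟨lt_ones_congr hE.1 (fun z hz => hag z ⟨by have := hz.1; omega, hz.2⟩) h.1,
    lt_ones_congr_left hE.2 (fun z hz => hag z ⟨hz.1, by have := hz.2; omega⟩) h.2⟩

/-- The index `N` does not depend on `R`. On each side, either `[-R, R]` extends past the given box
and so holds more than `N` ones anyway, or its count can be read off inside the box. -/
theorem localN_scarce (N R : ℕ) : LocalN N (scarce N R) := fun _ _ _ _ _ _ hE hag =>
  scarce_congr ⟨fun h => hE.congr_of_enough hag h,
    fun h => (hE.congr hag).congr_of_enough (fun z hz => (hag z hz).symm) h⟩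

theorem abs_scarce_le (N R : ℕ) (ζ : Config) : |scarce N R ζ| ≤ 1 := by
  unfold scarce; split_ifs <;> simp

/-- The event that no `[-R, R]` has more than `N` ones on either side lies in each local event
`scarce N R = 1`. The probabilities of these are given by the exponential series and tend to zero as
`R` grows, because `scarce N R` agrees with zero wherever `[-R, R]` has enough ones. -/
theorem ae_mem_bothSided {α : ℝ} (hα : 0 ≤ α) {η : Config} (hη : η ∈ decent) {a : ℝ}
    (ha : (meanGap η).toReal < a) {T : ℝ} (hT : 0 ≤ T)
    (hTa : T * (4 * (1 + α) * Real.exp 1 * a) < 1) : ∀ᵐ ζ ∂(law α T η), ζ ∈ bothSided := by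
  obtain ⟨hprob, hint⟩ := law_spec hα hη ha hT hTa
  have ha0 : 0 < a := ENNReal.toReal_nonneg.trans_lt ha
  have key : ∀ N : ℕ, ∀ᵐ ζ ∂(law α T η), ∃ R : ℕ, Enough N (-(R : ℤ)) R ζ := by
    intro N
    obtain ⟨K, _, hK⟩ := exists_span_pow_le hα hη ha N
    have hlim := tendsto_expSeries_generator hα hη.1 (localN_scarce N) (localN_const N 0)
      (abs_scarce_le N) (fun R ζ _ hE => if_pos hE) hK (by positivity) hT hTa
    have hzero : expSeries (fun k => (generator α)^[k] (fun _ => 0) η) T = 0 := by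
      simp_rw [expSeries, ← boxGen_univ, iterate_boxGen_zero]
      simp
    rw [hzero] at hlim
    simp_rw [← hint _ (isLocal_scarce N _) 1 (abs_scarce_le N _)] at hlim
    rw [ae_iff]
    set A : Set Config := {ζ | ¬∃ R : ℕ, Enough N (-(R : ℤ)) R ζ} with hA
    have hle : ∀ R, (law α T η).real A ≤ ∫ ζ, scarce N R ζ ∂(law α T η) := by
      intro R
      have hm : MeasurableSet {ζ | scarce N R ζ = 1} :=
        (isLocal_scarce N R).continuous.measurable (measurableSet_singleton 1)
      have hind : scarce N R = Set.indicator {ζ | scarce N R ζ = 1} 1 := by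
        funext ζ
        by_cases h : Enough N (-(R : ℤ)) R ζ <;> simp [Set.indicator, scarce, h]
      rw [hind, integral_indicator_one hm]
      exact measureReal_mono fun ζ hζ => if_neg (not_exists.1 hζ R)
    have h0 : (law α T η).real A ≤ 0 := ge_of_tendsto' hlim hle
    exact (measureReal_eq_zero_iff).1 (le_antisymm h0 measureReal_nonneg)
  filter_upwards [ae_all_iff.2 key] with ζ hζ
  exact mem_bothSided_of_enough fun N => let ⟨R, hR⟩ := hζ N; ⟨_, _, hR⟩

/-! ### The semigroup on local functions -/

theorem isLocal_comp_cut (f : Config → ℝ) (R : ℕ) : IsLocal fun ζ => f (cut R ζ).1 := by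
  refine ⟨Finset.Icc (-(R : ℤ)) R, fun η ξ h => ?_⟩
  have : (cut R η).1 = (cut R ξ).1 := by
    funext z
    by_cases hz : z ∈ Set.Icc (-(R : ℤ)) R
    · rw [cut_apply hz, cut_apply hz, h z (Finset.mem_Icc.2 hz)]
    · rw [Bool.eq_iff_iff, cut_apply_eq_true, cut_apply_eq_true]
      exact iff_of_false (fun h => hz h.1) (fun h => hz h.1)
  simp only [this]

/-- Cutting off only adds ones, so the same `N` works for all `R`, as the domination requires. -/
theorem LocalN.comp_cut {N : ℕ} {f : Config → ℝ} (hf : LocalN N f) (R : ℕ) :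
    LocalN N fun ζ => f (cut R ζ).1 := by
  intro η _ ξ _ a b hE hag
  refine hf _ (cut R η).mem_bothSided _ (cut R ξ).mem_bothSided a b
    (hE.mono le_rfl le_rfl (cut_le R η)) fun z hz => ?_
  rw [Bool.eq_iff_iff, cut_apply_eq_true, cut_apply_eq_true, hag z hz]

theorem LocalN.comp_cut_eq {N : ℕ} {f : Config → ℝ} (hf : LocalN N f) {R : ℕ} {ζ : Config}
    (hζ : ζ ∈ bothSided) (hE : Enough N (-(R : ℤ)) R ζ) : f (cut R ζ).1 = f ζ :=
  (hf ζ hζ _ (cut R ζ).mem_bothSided _ _ hE fun _ hz => (cut_apply hz).symm).symm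

/-- On `Ω'`, which carries the law, `f` is the limit of the local functions `f ∘ cut R`. This
supplies the measurability of `f` up to null sets, and both sides of the formula pass to the limit
by domination. -/
theorem semigroup_eq_expSeries {α : ℝ} (hα : 0 ≤ α) {η : Config} (hη : η ∈ decent) {a : ℝ}
    (ha : (meanGap η).toReal < a) {T : ℝ} (hT : 0 ≤ T)
    (hTa : T * (4 * (1 + α) * Real.exp 1 * a) < 1) {N : ℕ} {f : Config → ℝ} {C : ℝ}
    (hf : LocalN N f) (hC : ∀ ζ, |f ζ| ≤ C) :
    Integrable f (law α T η) ∧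
      semigroup α T f η = expSeries (fun k => (generator α)^[k] f η) T := by
  obtain ⟨hprob, hint⟩ := law_spec hα hη ha hT hTa
  have ha0 : 0 < a := ENNReal.toReal_nonneg.trans_lt ha
  have hmeas : ∀ R, AEStronglyMeasurable (fun ζ => f (cut R ζ).1) (law α T η) := fun R =>
    (isLocal_comp_cut f R).continuous.aestronglyMeasurable
  have hlim : ∀ᵐ ζ ∂(law α T η), Tendsto (fun R => f (cut R ζ).1) atTop (𝓝 (f ζ)) := by
    filter_upwards [ae_mem_bothSided hα hη ha hT hTa] with ζ hζ
    refine tendsto_const_nhds.congr' ?_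
    obtain ⟨R₀, hR₀⟩ := exists_enough hζ N
    filter_upwards [eventually_ge_atTop R₀] with R hR
    exact (hf.comp_cut_eq hζ (hR₀.mono (by omega) (by omega) le_rfl)).symm
  have hfm : AEStronglyMeasurable f (law α T η) := aestronglyMeasurable_of_tendsto_ae atTop hmeas hlim
  refine ⟨Integrable.of_bound hfm C (Eventually.of_forall hC), ?_⟩
  have h1 : Tendsto (fun R : ℕ => ∫ ζ, f (cut R ζ).1 ∂(law α T η)) atTop
      (𝓝 (∫ ζ, f ζ ∂(law α T η))) :=
    tendsto_integral_of_dominated_convergence (fun _ => C) hmeas (integrable_const C)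
      (fun R => Eventually.of_forall fun ζ => hC _) hlim
  obtain ⟨K, _, hK⟩ := exists_span_pow_le hα hη ha N
  have h2 := tendsto_expSeries_generator hα hη.1 (g := fun R ζ => f (cut R ζ).1) hf.comp_cut hf
    (fun R ζ => hC _) (fun R ζ hζ hE => hf.comp_cut_eq hζ hE) hK (by positivity) hT hTa
  simp_rw [← hint _ (isLocal_comp_cut f _) C fun ζ => hC _] at h2
  exact tendsto_nhds_unique h1 h2

end

end SandFlip

/-! ### The main theorem -/

theorem mainTheorem6 (α : ℝ) (hα : 0 ≤ α) (N : ℕ) (f : SandFlip.Config → ℝ)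
    (hbdd : ∃ C : ℝ, ∀ ζ, |f ζ| ≤ C) (hloc : SandFlip.IsNLocal N f)
    (η : SandFlip.Config) (hη : η ∈ SandFlip.decent) :
    -- all the sums that define the iterates of the generator on `Ω'` converge
    (∀ n : ℕ, ∀ ζ ∈ SandFlip.bothSided,
      Summable (fun x : ℤ => ((SandFlip.generator α)^[n] f) (SandFlip.addOp x ζ)
        - ((SandFlip.generator α)^[n] f) ζ) ∧
      Summable (fun x : ℤ => ((SandFlip.generator α)^[n] f) (SandFlip.flip x ζ)
        - ((SandFlip.generator α)^[n] f) ζ)) ∧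
    -- the exponential series converges absolutely, and its sum is `S(t) f(η)`
    (∀ t : ℝ, 0 ≤ t → t < 1 / (4 * (1 + α) * Real.exp 1 * (SandFlip.meanGap η).toReal) →
      Summable (fun n : ℕ => |t ^ n * ((SandFlip.generator α)^[n] f) η / (n.factorial : ℝ)|) ∧
      Integrable f (SandFlip.law α t η) ∧
      ∑' n : ℕ, t ^ n * ((SandFlip.generator α)^[n] f) η / (n.factorial : ℝ)
        = SandFlip.semigroup α t f η) ∧
    -- `L` is the pointwise generator
    Tendsto (fun t : ℝ => (SandFlip.semigroup α t f η - f η) / t) (𝓝[>] 0)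
      (𝓝 (SandFlip.generator α f η)) := by
  obtain ⟨C, hC⟩ := hbdd
  have hf := hloc.localN
  have hbound : ∀ {a K : ℝ}, (∀ k : ℕ, (2 * (1 + α) * ((SandFlip.span η (N + k) : ℝ) + 1)) ^ k ≤
      K * k.factorial * (4 * (1 + α) * Real.exp 1 * a) ^ k) → ∀ k,
      |(SandFlip.generator α)^[k] f η| ≤
        C * K * k.factorial * (4 * (1 + α) * Real.exp 1 * a) ^ k := by
    intro a K hK k
    have := SandFlip.abs_iterate_le_of_le hα hη.1 hη.1 le_rfl Set.univ hf hC hK k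
    rwa [SandFlip.boxGen_univ] at this
  refine ⟨fun n ζ hζ => ?_, fun t ht ht' => ?_, ?_⟩
  · have := (hf.iterate α Set.univ n).summable hζ
    rwa [SandFlip.boxGen_univ] at this
  · set m := (SandFlip.meanGap η).toReal with hm
    have hm1 : 1 ≤ m := by
      have := ENNReal.toReal_mono hη.2.ne (SandFlip.one_le_meanGap hη.1)
      simpa using this
    rw [lt_div_iff₀ (by positivity)] at ht'
    -- The strict bound on `t` leaves room for some `a` strictly above the mean gap, as the growth
    -- estimate demands.
    obtain ⟨a, ha, hta⟩ : ∃ a, m < a ∧ t * (4 * (1 + α) * Real.exp 1 * a) < 1 := by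
      have h : ∀ᶠ a in 𝓝 m, t * (4 * (1 + α) * Real.exp 1 * a) < 1 :=
        ((continuous_const_mul (4 * (1 + α) * Real.exp 1)).const_smul
          t).continuousAt.eventually_lt_const ht'
      obtain ⟨a, h1, h2⟩ := ((h.filter_mono nhdsWithin_le_nhds).and
        (self_mem_nhdsWithin : Set.Ioi m ∈ 𝓝[>] m)).exists
      exact ⟨a, h2, h1⟩
    obtain ⟨K, _, hK⟩ := SandFlip.exists_span_pow_le hα hη ha N
    have h1 := SandFlip.semigroup_eq_expSeries hα hη ha ht hta hf hC
    have ha0 : 0 < a := by linarith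
    exact ⟨SandFlip.summable_abs_expSeries (hbound hK) (by positivity) ht hta, h1.1, h1.2.symm⟩
  -- Only small `t` matter here, so any `a` above the mean gap will do. The series is differentiable
  -- at zero from both sides; it equals the semigroup for small `t > 0`.
  · obtain ⟨a, ha⟩ := exists_gt (SandFlip.meanGap η).toReal
    have ha0 : 0 < a := ENNReal.toReal_nonneg.trans_lt ha
    obtain ⟨K, _, hK⟩ := SandFlip.exists_span_pow_le hα hη ha N
    have hd := SandFlip.hasDerivAt_expSeries (hbound hK) (t := 0) (by positivity) (by simp)
    rw [SandFlip.expSeries_zero, hasDerivAt_iff_tendsto_slope_zero] at hd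
    refine (hd.mono_left (nhdsWithin_mono 0 fun t ht => ne_of_gt ht)).congr' ?_
    have hρ : 0 < 4 * (1 + α) * Real.exp 1 * a := by positivity
    filter_upwards [self_mem_nhdsWithin, nhdsWithin_le_nhds (Iio_mem_nhds (inv_pos.2 hρ))]
      with t ht0 ht1
    have ht : t * (4 * (1 + α) * Real.exp 1 * a) < 1 := by
      have := mul_lt_mul_of_pos_right ht1 hρ
      rwa [inv_mul_cancel₀ hρ.ne'] at this
    rw [(SandFlip.semigroup_eq_expSeries hα hη ha (le_of_lt ht0) ht hf hC).2, zero_add,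
      SandFlip.expSeries_zero, smul_eq_mul, div_eq_inv_mul]
    rfl
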